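/- Let $\sigma$ be a finite relational vocabulary and let $\varphi$ be a formula of inclusion logic $\mathrm{FO}(\subseteq)$ over $\sigma$, that is, a formula built from the literals $x=y$, $x\neq y$, $R(\bar x)$, $\neg R(\bar x)$ and the inclusion atoms $\bar x\subseteq\bar y$ by $\wedge,\vee,\exists x,\forall x$. Formulas are evaluated in lax team semantics: for a structure $\mathcal A$ with universe $A$ and a team $X$ (a finite set of assignments into $A$ with a common domain), a literal holds in $X$ if it holds for every $s\in X$; $\mathcal A\models_X\bar x\subseteq\bar y$ iff for every $s\in X$ there is $t\in X$ with $s(\bar x)=t(\bar y)$; $\wedge$ is conjunction; $\mathcal A\models_X\psi\vee\chi$ iff $X=Y\cup Z$ for some $Y,Z$ with $\mathcal A\models_Y\psi$ and $\mathcal A\models_Z\chi$; $\mathcal A\models_X\exists x\,\psi$ iff there is a map $F$ from $X$ to the nonempty subsets of $A$ with $\mathcal A\models_{X'}\psi$ for $X'=\{s(a/x): s\in X,\ a\in F(s)\}$; and $\mathcal A\models_X\forall x\,\psi$ iff $\mathcal A\models_{X'}\psi$ for $X'=\{s(a/x): s\in X,\ a\in A\}$. Consider the enumeration problem $\textsc{E-Sat}^{\mathrm{team}}_\varphi$: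 given (an encoding of) a finite $\sigma$-structure $\mathcal A$, output all nonempty teams $X$ of $\mathcal A$, with domain the set of free variables of $\varphi$, such that $\mathcal A\models_X\varphi$. (Structures and teams are encoded as binary words in the standard way, the universe size in unary; words that encode no structure have no solutions.) **Theorem.** For every $\varphi\in\mathrm{FO}(\subseteq)$, $\textsc{E-Sat}^{\mathrm{team}}_\varphi\in\mathrm{DelP}$. That is, there are a language $L\in\mathrm P$, a random access machine $M$ with oracle $L$ and a polynomial $p$, all depending only on $\varphi$, such that on every input $x$ the machine $M$ outputs every solution exactly once and nothing else and then halts, the time before the first output, between consecutive outputs and from the last output to halting is at most $p(|x|)$, and all oracle questions have length at most $p(|x|)$. (Here every machine instruction counts as one step, and the register contents are required to have at most $p(|x|)$ bits at all times.) -/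

import Mathlib

namespace TeamEnum

/-! ### Inclusion logic with lax team semantics -/

/-- A finite relational vocabulary: `numRel` relation symbols with positive arities. -/
structure Vocabulary where
  numRel : ℕ
  arity : Fin numRel → ℕ
  arity_pos : ∀ i, 0 < arity i

/-- Formulas of inclusion logic `FO(⊆)` over `σ`, with first-order variables named by naturals. -/
inductive Formula (σ : Vocabulary) : Type where
  | eq (x y : ℕ) : Formula σ
  | neq (x y : ℕ) : Formula σ
  | rel (i : Fin σ.numRel) (xs : Fin (σ.arity i) → ℕ) : Formula σ
  | nrel (i : Fin σ.numRel) (xs : Fin (σ.arity i) → ℕ) : Formula σ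
  | incl {m : ℕ} (xs ys : Fin m → ℕ) : Formula σ
  | and (φ ψ : Formula σ) : Formula σ
  | or (φ ψ : Formula σ) : Formula σ
  | ex (x : ℕ) (φ : Formula σ) : Formula σ
  | all (x : ℕ) (φ : Formula σ) : Formula σ

/-- The set of free variables. -/
def Formula.free {σ : Vocabulary} : Formula σ → Finset ℕ
  | .eq x y => {x, y}
  | .neq x y => {x, y}
  | .rel _ xs => Finset.univ.image xs
  | .nrel _ xs => Finset.univ.image xs
  | .incl xs ys => Finset.univ.image xs ∪ Finset.univ.image ys
  | .and φ ψ => φ.free ∪ ψ.free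
  | .or φ ψ => φ.free ∪ ψ.free
  | .ex x φ => φ.free.erase x
  | .all x φ => φ.free.erase x

/-- An interpretation of the symbols of `σ` in the universe `A`. -/
abbrev Interp (σ : Vocabulary) (A : Type) : Type :=
  ∀ i : Fin σ.numRel, Set (Fin (σ.arity i) → A)

/-- An assignment, as a partial function; its domain is the set of `v` with `s v ≠ none`. -/
abbrev Assignment (A : Type) : Type := ℕ → Option A

/-- The assignment `s(a/x)`. -/
def Assignment.supplement {A : Type} (s : Assignment A) (x : ℕ) (a : A) : Assignment A :=
  Function.update s x (some a)

/-- `s(xs) ∈ R`. -/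
def Assignment.MemRel {A : Type} {m : ℕ} (s : Assignment A) (xs : Fin m → ℕ)
    (R : Set (Fin m → A)) : Prop :=
  ∃ a ∈ R, ∀ i, s (xs i) = some (a i)

/-- `X` is a set of assignments with common domain `D`. (Over a finite universe, with `D` finite,
such a set is automatically finite.) -/
def IsTeam {A : Type} (D : Finset ℕ) (X : Set (Assignment A)) : Prop :=
  ∀ s ∈ X, ∀ v, s v ≠ none ↔ v ∈ D

/-- The team `X[F/x]`. -/
def supplementTeam {A : Type} (X : Set (Assignment A)) (x : ℕ) (F : Assignment A → Set A) :
    Set (Assignment A) :=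
  {t | ∃ s ∈ X, ∃ a ∈ F s, t = s.supplement x a}

/-- Lax team semantics. -/
def Sat {σ : Vocabulary} {A : Type} (I : Interp σ A) :
    Formula σ → Set (Assignment A) → Prop
  | .eq x y, X => ∀ s ∈ X, s x = s y
  | .neq x y, X => ∀ s ∈ X, s x ≠ s y
  | .rel i xs, X => ∀ s ∈ X, s.MemRel xs (I i)
  | .nrel i xs, X => ∀ s ∈ X, ¬ s.MemRel xs (I i)
  | .incl xs ys, X => ∀ s ∈ X, ∃ t ∈ X, ∀ i, s (xs i) = t (ys i)
  | .and φ ψ, X => Sat I φ X ∧ Sat I ψ X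
  | .or φ ψ, X => ∃ Y Z, Y ⊆ X ∧ Z ⊆ X ∧ Y ∪ Z = X ∧ Sat I φ Y ∧ Sat I ψ Z
  | .ex x φ, X => ∃ F : Assignment A → Set A,
      (∀ s ∈ X, (F s).Nonempty) ∧ Sat I φ (supplementTeam X x F)
  | .all x φ, X => Sat I φ (supplementTeam X x fun _ => Set.univ)

/-! ### Finite structures and teams as words -/

/-- A finite `σ`-structure, with universe `{0, …, size - 1}`. -/
structure FinStructure (σ : Vocabulary) where
  size : ℕ
  interp : Interp σ (Fin size)

open Classical in
/-- The characteristic word, of length `n ^ m`, of a set of `m`-tuples over `Fin n`; the tuple `a`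
has position `∑ i, a i * n ^ i`. -/
noncomputable def encodeRel {n m : ℕ} (R : Set (Fin m → Fin n)) : List Bool :=
  List.ofFn fun j : Fin (n ^ m) => decide (finFunctionFinEquiv.symm j ∈ R)

/-- The word `1ⁿ0` followed by the characteristic words of the relations. -/
noncomputable def FinStructure.encode {σ : Vocabulary} (𝒜 : FinStructure σ) : List Bool :=
  List.replicate 𝒜.size true ++ false ::
    (List.finRange σ.numRel).flatMap fun i => encodeRel (𝒜.interp i)

/-- The assignment with domain `D` that maps the `i`-th smallest element of `D` to `a i`. -/
def assignmentOf {A : Type} (D : Finset ℕ) (a : Fin D.card → A) : Assignment A := fun v =>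
  if h : v ∈ D then some (a ((D.orderIsoOfFin rfl).symm ⟨v, h⟩)) else none

/-- A team with domain `D` over `Fin n`, as the characteristic word of its set of value tuples. -/
noncomputable def encodeTeam {n : ℕ} (D : Finset ℕ) (X : Set (Assignment (Fin n))) : List Bool :=
  encodeRel {a : Fin D.card → Fin n | assignmentOf D a ∈ X}

/-! ### Random access machines with an oracle -/

/-- RAM instructions; `d`, `a`, `b` are register numbers, `l` is a program line. -/
inductive Instr : Type where
  /-- `R[d] := k` -/
  | const (d k : ℕ)
  /-- `R[d] := R[a]` -/
  | copy (d a : ℕ)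
  /-- `R[d] := R[a] + R[b]` -/
  | add (d a b : ℕ)
  /-- `R[d] := max (R[a] - R[b]) 0` -/
  | sub (d a b : ℕ)
  /-- `R[d] := R[a] * R[b]` -/
  | mul (d a b : ℕ)
  /-- `R[d] := ⌊R[a] / R[b]⌋`, and `0` if `R[b] = 0` -/
  | div (d a b : ℕ)
  /-- `R[d] := R[R[a]]` -/
  | load (d a : ℕ)
  /-- `R[R[d]] := R[a]` -/
  | store (d a : ℕ)
  /-- go to line `l` -/
  | jump (l : ℕ)
  /-- go to line `l` if `R[a] = 0` -/
  | jumpZero (a l : ℕ)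
  /-- append one bit to the solution being written: `0` if `R[a] = 0`, else `1` -/
  | write (a : ℕ)
  /-- output the solution that has been written, and start a new one -/
  | output
  /-- append one bit to the oracle question being written: `0` if `R[a] = 0`, else `1` -/
  | ask (a : ℕ)
  /-- `R[d] := 1` if the oracle question that has been written is in the oracle, else `0`;
  start a new question -/
  | query (d : ℕ)

/-- Configurations of a RAM. -/
structure Config where
  /-- the current program line -/
  pc : ℕ
  /-- the contents of the registers -/
  reg : ℕ → ℕ
  /-- the solution being written -/
  word : List Bool
  /-- the oracle question being written -/
  question : List Bool
  /-- the solutions output so far, in order -/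
  outputs : List (List Bool)

/-- On input `x`, register `0` holds `|x|`, register `i + 1` holds the `i`-th bit of `x`
(counted from `0`), and all other registers hold `0`. -/
def Config.init (x : List Bool) : Config where
  pc := 0
  reg
    | 0 => x.length
    | i + 1 => (x.getD i false).toNat
  word := []
  question := []
  outputs := []

/-- Write `k` to register `d` and go to the next line. -/
def Config.set (c : Config) (d k : ℕ) : Config :=
  { c with reg := Function.update c.reg d k, pc := c.pc + 1 }

open Classical in
/-- The effect of one instruction, with oracle `L`. -/
noncomputable def Instr.exec (L : Set (List Bool)) (c : Config) : Instr → Config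
  | .const d k => c.set d k
  | .copy d a => c.set d (c.reg a)
  | .add d a b => c.set d (c.reg a + c.reg b)
  | .sub d a b => c.set d (c.reg a - c.reg b)
  | .mul d a b => c.set d (c.reg a * c.reg b)
  | .div d a b => c.set d (c.reg a / c.reg b)
  | .load d a => c.set d (c.reg (c.reg a))
  | .store d a => c.set (c.reg d) (c.reg a)
  | .jump l => { c with pc := l }
  | .jumpZero a l => { c with pc := if c.reg a = 0 then l else c.pc + 1 }
  | .write a => { c with word := c.word ++ [decide (c.reg a ≠ 0)], pc := c.pc + 1 }
  | .output => { c with outputs := c.outputs ++ [c.word], word := [], pc := c.pc + 1 }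
  | .ask a => { c with question := c.question ++ [decide (c.reg a ≠ 0)], pc := c.pc + 1 }
  | .query d => { c.set d (if c.question ∈ L then 1 else 0) with question := [] }

/-- A program; the machine halts when the program line does not exist. -/
abbrev Program : Type := List Instr

/-- `c` is a halting configuration of `M`. -/
def Program.Halted (M : Program) (c : Config) : Prop := M[c.pc]? = none

/-- One step; a halting configuration does not change. -/
noncomputable def Program.step (M : Program) (L : Set (List Bool)) (c : Config) : Config :=
  match M[c.pc]? with
  | none => c
  | some i => i.exec L c

/-- The configuration of `M` with oracle `L` on input `x` after `t` steps. -/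
noncomputable def Program.run (M : Program) (L : Set (List Bool)) (x : List Bool) (t : ℕ) : Config :=
  (M.step L)^[t] (Config.init x)

/-- Throughout the computation on input `x` every register content has at most `b` bits. Every
instruction counts as one step; this bound, with `b` polynomial in `|x|`, keeps that cost measure
polynomially equivalent to counting bit operations. -/
def Program.RegistersBounded (M : Program) (L : Set (List Bool)) (x : List Bool) (b : ℕ) : Prop :=
  ∀ t r, ((M.run L x t).reg r).size ≤ b

/-- Every oracle question asked on input `x` has length at most `b`. -/
def Program.QueriesBounded (M : Program) (L : Set (List Bool)) (x : List Bool) (b : ℕ) : Prop :=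
  ∀ t d, M[(M.run L x t).pc]? = some (.query d) → (M.run L x t).question.length ≤ b

/-- On input `x`, `M` halts after having output every element of `S` exactly once and nothing
else. -/
def Program.Enumerates (M : Program) (L : Set (List Bool)) (x : List Bool) (S : Set (List Bool)) :
    Prop :=
  ∃ t, M.Halted (M.run L x t) ∧ (M.run L x t).outputs.Nodup ∧
    {y | y ∈ (M.run L x t).outputs} = S

/-- On input `x`, the time before the first output, between consecutive outputs, and from the last
output to halting, is at most `b`: within any `b` steps `M` outputs a solution or has halted. -/
def Program.DelayAtMost (M : Program) (L : Set (List Bool)) (x : List Bool) (b : ℕ) : Prop :=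
  ∀ t, M.Halted (M.run L x (t + b)) ∨
    (M.run L x t).outputs.length < (M.run L x (t + b)).outputs.length

/-! ### Complexity classes -/

/-- The class `P`: languages decided in polynomial time by a RAM (no oracle), which accepts if
register `0` is nonzero when it halts. -/
def PTime : Set (Set (List Bool)) :=
  {L | ∃ (M : Program) (p : Polynomial ℕ), ∀ x : List Bool,
    M.Halted (M.run ∅ x (p.eval x.length)) ∧
    M.RegistersBounded ∅ x (p.eval x.length) ∧
    (x ∈ L ↔ (M.run ∅ x (p.eval x.length)).reg 0 ≠ 0)}

/-- An enumeration problem assigns to every input its set of solutions. -/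
abbrev EnumProblem : Type := List Bool → Set (List Bool)

/-- The class `Del C`: problems enumerated with polynomial delay by a RAM with an oracle from `C`,
all oracle questions being of polynomial length. -/
def Del (C : Set (Set (List Bool))) : Set EnumProblem :=
  {E | ∃ L ∈ C, ∃ (M : Program) (p : Polynomial ℕ), ∀ x : List Bool,
    M.Enumerates L x (E x) ∧
    M.DelayAtMost L x (p.eval x.length) ∧
    M.RegistersBounded L x (p.eval x.length) ∧
    M.QueriesBounded L x (p.eval x.length)}

/-- The class `DelP`. -/
def DelP : Set EnumProblem := Del PTime

/-- The problem to enumerate, given a finite structure, all nonempty teams with domain `φ.free`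
that satisfy `φ`. A word that does not encode a structure has no solutions. -/
def ESatTeam {σ : Vocabulary} (φ : Formula σ) : EnumProblem := fun x =>
  {y | ∃ 𝒜 : FinStructure σ, x = 𝒜.encode ∧ ∃ X : Set (Assignment (Fin 𝒜.size)),
    IsTeam φ.free X ∧ X.Nonempty ∧ Sat 𝒜.interp φ X ∧ y = encodeTeam φ.free X}

end TeamEnum

/-! Truth of an inclusion logic formula is a greatest fixed point condition that can be evaluated in
polynomial time. This gives a polynomial test for whether a partial solution extends to a full one,
and hence an enumeration in lexicographic order.

Attach to every subformula occurrence the team at which it is evaluated. That such a family `W` is a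
correct evaluation is expressed by conditions of the form "every member `s` of team `j` satisfies `P
W s`", where `P` is monotone in `W` (`conds`, `conds_mono`, `Con.sat`, `exists_con_of_sat`).
Conditions of this kind are preserved by unions, so below every given family there is a largest one
that satisfies them. It is reached by deleting violating assignments until nothing changes. For a
fixed formula there are at most `(n + 1) ^ k` partial assignments per team, so polynomially many
deletions suffice (`Shrinking.iterate_fixed`, `roundsCmd_spec`).

Suppose now that some bits of a team are prescribed. A satisfying team with these bits exists iff
the largest satisfying subteam of the allowed assignments contains all the required ones
(`exists_solution_iff`). A word `y` lies lexicographically above `v` iff at some index `v` has `0`,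
`y` has `1`, and both agree before that index. Trying all indices therefore decides whether a
solution with a given prefix lies above `v` (`searchCmd_lex`). Fixing the bits one after the other,
and choosing `0` whenever possible, produces the least solution above `v` (`nextCmd_spec`). The
enumeration starts from the zero word, which stands for the empty team and is not a solution, and
meets every solution exactly once. Each step takes polynomial time, so no oracle questions are
needed and the empty language serves as oracle.

The machine is obtained from a small language of arithmetical expressions and bounded loops over a
bit memory. Running times are bounded by polynomials in the values of the variables, and
`Cmd.compile_correct` transfers meaning and cost to the machine. `mem_DelP_of_loop` turns such
programs, together with an invariant that counts the outputs still to come, into membership in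
`DelP`. -/

namespace TeamEnum

/-! ### Computation segments of a RAM -/

/-- All registers hold at most `B`. -/
def Config.Bounded (B : ℕ) (c : Config) : Prop := ∀ r, c.reg r ≤ B

/-- `M` goes from `c` to `c'` in at most `t` steps, the registers being bounded by `B` meanwhile. -/
def Steps (M : Program) (L : Set (List Bool)) (B t : ℕ) (c c' : Config) : Prop :=
  ∃ t' ≤ t, (M.step L)^[t'] c = c' ∧ ∀ s ≤ t', ((M.step L)^[s] c).Bounded B

section Steps

variable {M : Program} {L : Set (List Bool)} {B t t₁ t₂ : ℕ} {c c₁ c₂ c' : Config}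

theorem Steps.refl (h : c.Bounded B) : Steps M L B 0 c c :=
  ⟨0, le_rfl, rfl, fun s hs => by obtain rfl : s = 0 := by omega
                                  exact h⟩

theorem Steps.mono (h : Steps M L B t₁ c c') (ht : t₁ ≤ t₂) : Steps M L B t₂ c c' := by
  obtain ⟨t', h₁, h₂⟩ := h
  exact ⟨t', h₁.trans ht, h₂⟩

theorem Steps.trans (h₁ : Steps M L B t₁ c c₁) (h₂ : Steps M L B t₂ c₁ c₂) :
    Steps M L B (t₁ + t₂) c c₂ := by
  obtain ⟨a, ha, rfl, ha'⟩ := h₁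
  obtain ⟨b, hb, rfl, hb'⟩ := h₂
  refine ⟨a + b, by omega, by rw [add_comm, Function.iterate_add_apply], fun s hs => ?_⟩
  rcases le_total s a with h | h
  · exact ha' s h
  · obtain ⟨e, rfl⟩ := Nat.exists_eq_add_of_le h
    rw [add_comm, Function.iterate_add_apply]
    exact hb' e (by omega)

theorem Steps.bounded_right (h : Steps M L B t c c') : c'.Bounded B := by
  obtain ⟨t', _, rfl, h⟩ := h
  exact h t' le_rfl

theorem Steps.single {i : Instr} (hi : M[c.pc]? = some i) (h : c.Bounded B)
    (h' : (i.exec L c).Bounded B) : Steps M L B 1 c (i.exec L c) := by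
  have e : M.step L c = i.exec L c := by simp only [Program.step, hi]
  refine ⟨1, le_rfl, e, fun s hs => ?_⟩
  interval_cases s
  · exact h
  · simpa [e] using h'

theorem Config.Bounded.set (h : c.Bounded B) {d k : ℕ} (hk : k ≤ B) : (c.set d k).Bounded B := by
  intro r
  by_cases hr : r = d <;> simp [Config.set, hr, hk, h r]

theorem Steps.set {i : Instr} {d k : ℕ} (hi : M[c.pc]? = some i) (h : c.Bounded B)
    (he : i.exec L c = c.set d k) (hk : k ≤ B) : Steps M L B 1 c (c.set d k) := by
  have := Steps.single (L := L) hi h (he ▸ h.set hk)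
  rwa [he] at this

end Steps

/-- The program `M` contains `code` from line `pc` on. -/
def CodeAt (M : Program) (pc : ℕ) (code : List Instr) : Prop :=
  ∀ i < code.length, M[pc + i]? = code[i]?

section CodeAt

variable {M : Program} {pc : ℕ}

theorem codeAt_nil : CodeAt M pc [] := fun i hi => by simp at hi

theorem codeAt_cons {i : Instr} {l : List Instr} :
    CodeAt M pc (i :: l) ↔ M[pc]? = some i ∧ CodeAt M (pc + 1) l := by
  constructor
  · intro h
    refine ⟨by simpa using h 0 (by simp), fun j hj => ?_⟩
    have := h (j + 1) (by simpa using hj)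
    rw [add_assoc, add_comm 1 j]
    simpa using this
  · rintro ⟨h₁, h₂⟩ j hj
    cases j with
    | zero => simpa using h₁
    | succ j =>
      have := h₂ j (by simpa using hj)
      rw [add_assoc, add_comm 1 j] at this
      simpa using this

theorem codeAt_append {l₁ l₂ : List Instr} :
    CodeAt M pc (l₁ ++ l₂) ↔ CodeAt M pc l₁ ∧ CodeAt M (pc + l₁.length) l₂ := by
  induction l₁ generalizing pc with
  | nil => simp [codeAt_nil]
  | cons i l ih =>
    simp only [List.cons_append, codeAt_cons, ih, List.length_cons, and_assoc]
    rw [show pc + (l.length + 1) = pc + 1 + l.length by omega]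

theorem codeAt_self (M : Program) : CodeAt M 0 M := fun i _ => by rw [zero_add]

end CodeAt

/-- `c'` differs from `c` only in the program line and in registers outside `S`. -/
structure Frame (S : ℕ → Prop) (c c' : Config) : Prop where
  reg : ∀ r, S r → c'.reg r = c.reg r
  word : c'.word = c.word
  question : c'.question = c.question
  outputs : c'.outputs = c.outputs

theorem Frame.refl {S : ℕ → Prop} {c : Config} : Frame S c c := ⟨fun _ _ => rfl, rfl, rfl, rfl⟩

theorem Frame.trans {S S' T : ℕ → Prop} {c c' c'' : Config} (h : Frame S c c')
    (h' : Frame S' c' c'') (hS : ∀ r, T r → S r) (hS' : ∀ r, T r → S' r) : Frame T c c'' :=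
  ⟨fun r hr => (h'.reg r (hS' r hr)).trans (h.reg r (hS r hr)), h'.word.trans h.word,
    h'.question.trans h.question, h'.outputs.trans h.outputs⟩

theorem Frame.set {S : ℕ → Prop} {c c' : Config} (h : Frame S c c') {d k : ℕ} (hd : ¬ S d) :
    Frame S c (c'.set d k) :=
  ⟨fun r hr => by
    have : r ≠ d := fun e => hd (e ▸ hr)
    simp [Config.set, Function.update_of_ne this, h.reg r hr], h.word, h.question, h.outputs⟩

@[simp] theorem Config.set_pc (c : Config) (d k : ℕ) : (c.set d k).pc = c.pc + 1 := rfl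

theorem Config.set_reg (c : Config) (d k r : ℕ) :
    (c.set d k).reg r = if r = d then k else c.reg r := by
  simp [Config.set, Function.update_apply]

@[simp] theorem Config.set_word (c : Config) (d k : ℕ) : (c.set d k).word = c.word := rfl

/-! ### Counting loops -/

/-- Run `body` with register `x` going through `0, …, R[d] - 1`; afterwards restore `x`. The
registers `d`, `d + 1`, `d + 2` are used. -/
def loopCode (x d pc : ℕ) (body : List Instr) : List Instr :=
  [.copy (d + 1) x, .const x 0, .const (d + 2) 1, .jumpZero d (pc + 4 + body.length + 3)] ++ body ++
    [.add x x (d + 2), .sub d d (d + 2), .jump (pc + 3), .copy x (d + 1)]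

theorem loopCode_length (x d pc : ℕ) (body : List Instr) :
    (loopCode x d pc body).length = body.length + 8 := by
  simp [loopCode]

section Loop

variable {M : Program} {L : Set (List Bool)} {B : ℕ}

/-- Induction on the number `n` of passes still to come, at the head of the loop in line `pc + 3`:
register `d` counts down while `x` counts up, so `x` holds `k - n`. The invariant `P` has to ignore
the four control registers and the program line, since the loop control changes them between passes.
-/
theorem loop_iterate {x d pc : ℕ} {body : List Instr} {tb k : ℕ} (P : ℕ → Config → Prop)
    (hx : x < d) (hM : CodeAt M pc (loopCode x d pc body)) (hB : k + 1 ≤ B)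
    (hP : ∀ i c c', P i c → Frame (fun r => r ≠ x ∧ r ≠ d ∧ r ≠ d + 1 ∧ r ≠ d + 2) c c' → P i c')
    (hbody : ∀ i c, i < k → c.pc = pc + 4 → c.reg x = i → P i c → c.Bounded B →
      ∃ c', Steps M L B tb c c' ∧ c'.pc = pc + 4 + body.length ∧ P (i + 1) c' ∧
        ∀ r < d + 3, c'.reg r = c.reg r) (n : ℕ) :
    ∀ c : Config, n ≤ k → c.pc = pc + 3 → c.reg d = n → c.reg x = k - n → c.reg (d + 2) = 1 →
      P (k - n) c → c.Bounded B →
      ∃ c', Steps M L B (n * (tb + 4) + 1) c c' ∧ c'.pc = pc + 4 + body.length + 3 ∧ P k c' ∧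
        c'.reg (d + 1) = c.reg (d + 1) := by
  simp only [loopCode, List.cons_append, List.nil_append, codeAt_cons,
    codeAt_append] at hM
  obtain ⟨-, -, -, h₃, hb, h₄, h₅, h₆, -⟩ := hM
  have e₃ : pc + 1 + 1 + 1 = pc + 3 := by omega
  have e₄ : pc + 3 + 1 = pc + 4 := by omega
  rw [e₃] at h₃ h₄ h₅ h₆
  rw [e₄] at h₄ h₅ h₆
  induction n with
  | zero =>
    intro c _ hpc hd _ _ hPc hc
    have hi := Steps.single (M := M) (L := L) (c := c)
      (i := .jumpZero d (pc + 4 + body.length + 3)) (by rw [hpc]; exact h₃) hc hc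
    refine ⟨_, hi.mono (by omega), ?_, hP _ _ _ hPc ⟨fun _ _ => rfl, rfl, rfl, rfl⟩, rfl⟩
    simp [Instr.exec, hd]
  | succ n ih =>
    intro c hn hpc hd hxc h1 hPc hc
    have hi := Steps.single (M := M) (L := L) (c := c)
      (i := .jumpZero d (pc + 4 + body.length + 3)) (by rw [hpc]; exact h₃) hc hc
    set c₁ := Instr.exec L c (.jumpZero d (pc + 4 + body.length + 3)) with hc₁
    have hpc₁ : c₁.pc = pc + 4 := by simp [hc₁, Instr.exec, hd, hpc]
    have hreg₁ : c₁.reg = c.reg := rfl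
    obtain ⟨c₂, hs₂, hpc₂, hP₂, hr₂⟩ := hbody (k - (n + 1)) c₁ (by omega) hpc₁
      (by rw [hreg₁, hxc]) (hP _ _ _ hPc ⟨fun _ _ => rfl, rfl, rfl, rfl⟩) hc
    have hB₂ := hs₂.bounded_right
    have hx₂ : c₂.reg x = k - (n + 1) := by rw [hr₂ x (by omega), hreg₁, hxc]
    have hd₂ : c₂.reg d = n + 1 := by rw [hr₂ d (by omega), hreg₁, hd]
    have h1₂ : c₂.reg (d + 2) = 1 := by rw [hr₂ (d + 2) (by omega), hreg₁, h1]
    have hs₃ : Steps M L B 1 c₂ (c₂.set x (k - n)) :=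
      Steps.set (i := .add x x (d + 2)) (by rw [hpc₂]; exact h₄) hB₂
        (by simp only [Instr.exec, hx₂, h1₂]; congr 1; omega) (by omega)
    have hs₄ : Steps M L B 1 (c₂.set x (k - n)) ((c₂.set x (k - n)).set d n) :=
      Steps.set (i := .sub d d (d + 2)) (by rw [Config.set_pc, hpc₂]; exact h₅) hs₃.bounded_right
        (by simp only [Instr.exec, Config.set_reg]
            rw [if_neg (by omega), if_neg (by omega), hd₂, h1₂]; rfl) (by omega)
    rw [show k - (n + 1) + 1 = k - n by omega] at hP₂
    set c₄ := (c₂.set x (k - n)).set d n with hc₄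
    have hs₅ := Steps.single (M := M) (L := L) (c := c₄) (i := .jump (pc + 3))
      (by rw [hc₄, Config.set_pc, Config.set_pc, hpc₂]; exact h₆) hs₄.bounded_right
      hs₄.bounded_right
    set c₅ := Instr.exec L c₄ (.jump (pc + 3)) with hc₅
    have hr₅ : ∀ r, c₅.reg r = if r = d then n else if r = x then k - n else c₂.reg r := by
      intro r
      simp only [hc₅, Instr.exec, hc₄, Config.set_reg]
    obtain ⟨c₆, hs₆, hpc₆, hP₆, hd₆⟩ := ih c₅ (by omega) rfl (by simp [hr₅])
      (by rw [hr₅, if_neg (by omega), if_pos rfl])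
      (by rw [hr₅, if_neg (by omega), if_neg (by omega), h1₂])
      (hP _ _ _ hP₂
        ⟨fun r hr => by rw [hr₅, if_neg hr.2.1, if_neg hr.1], rfl, rfl, rfl⟩)
      hs₅.bounded_right
    refine ⟨c₆, ?_, hpc₆, hP₆, ?_⟩
    · refine (hi.trans (hs₂.trans (hs₃.trans (hs₄.trans (hs₅.trans hs₆))))).mono ?_
      rw [add_mul]; omega
    · rw [hd₆, hr₅, if_neg (by omega), if_neg (by omega), hr₂ _ (by omega), hreg₁]

/-- The preamble saves `x` in `d + 1`, and the exit of the loop leads to the instruction that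
restores it. Hence nested loops may even share a variable. -/
theorem loop_correct {x d : ℕ} {body : List Instr} {tb k : ℕ} (P : ℕ → Config → Prop) {c : Config}
    (hx : x < d) (hM : CodeAt M c.pc (loopCode x d c.pc body)) (hB : k + 1 ≤ B)
    (hP : ∀ i c c', P i c → Frame (fun r => r ≠ x ∧ r ≠ d ∧ r ≠ d + 1 ∧ r ≠ d + 2) c c' → P i c')
    (hbody : ∀ i c₁, i < k → c₁.pc = c.pc + 4 → c₁.reg x = i → P i c₁ → c₁.Bounded B →
      ∃ c', Steps M L B tb c₁ c' ∧ c'.pc = c.pc + 4 + body.length ∧ P (i + 1) c' ∧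
        ∀ r < d + 3, c'.reg r = c₁.reg r)
    (hd : c.reg d = k) (hP₀ : P 0 c) (hc : c.Bounded B) :
    ∃ c', Steps M L B (k * (tb + 4) + 5) c c' ∧ c'.pc = c.pc + (loopCode x d c.pc body).length ∧
      P k c' ∧ c'.reg x = c.reg x := by
  have key := loop_iterate (L := L) P hx hM hB hP hbody k
  simp only [loopCode, List.cons_append, List.nil_append, codeAt_cons,
    codeAt_append] at hM
  obtain ⟨h₀, h₁, h₂, -, -, -, -, -, h₇, -⟩ := hM
  have hs₁ : Steps M L B 1 c (c.set (d + 1) (c.reg x)) :=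
    Steps.set (i := .copy (d + 1) x) h₀ hc rfl (hc x)
  have hs₂ : Steps M L B 1 (c.set (d + 1) (c.reg x)) ((c.set (d + 1) (c.reg x)).set x 0) :=
    Steps.set (i := .const x 0) h₁ hs₁.bounded_right rfl (by omega)
  have hs₃ : Steps M L B 1 ((c.set (d + 1) (c.reg x)).set x 0)
      (((c.set (d + 1) (c.reg x)).set x 0).set (d + 2) 1) :=
    Steps.set (i := .const (d + 2) 1) h₂ hs₂.bounded_right rfl (by omega)
  set c₃ := ((c.set (d + 1) (c.reg x)).set x 0).set (d + 2) 1 with hc₃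
  have hr₃ : ∀ r, c₃.reg r = if r = d + 2 then 1 else if r = x then 0 else
      if r = d + 1 then c.reg x else c.reg r := by
    intro r
    simp only [hc₃, Config.set_reg]
  obtain ⟨c₄, hs₄, hpc₄, hP₄, hd₄⟩ := key c₃ le_rfl rfl
    (by rw [hr₃, if_neg (by omega), if_neg (by omega), if_neg (by omega), hd])
    (by rw [hr₃, if_neg (by omega), if_pos rfl]; omega)
    (by rw [hr₃, if_pos rfl])
    (by rw [Nat.sub_self]
        exact hP _ _ _ hP₀ ⟨fun r hr => by
          rw [hr₃, if_neg hr.2.2.2, if_neg hr.1, if_neg hr.2.2.1], rfl, rfl, rfl⟩)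
    hs₃.bounded_right
  have hd₄' : c₄.reg (d + 1) = c.reg x := by
    rw [hd₄, hr₃, if_neg (by omega), if_neg (by omega), if_pos rfl]
  have hs₅ : Steps M L B 1 c₄ (c₄.set x (c.reg x)) :=
    Steps.set (i := .copy x (d + 1))
      (by rw [hpc₄, ← h₇])
      hs₄.bounded_right (by simp only [Instr.exec, hd₄']) (hc x)
  refine ⟨_, ((hs₁.trans (hs₂.trans (hs₃.trans (hs₄.trans hs₅)))).mono (by omega)), ?_, ?_, ?_⟩
  · rw [Config.set_pc, hpc₄, loopCode_length]; omega
  · exact hP _ _ _ hP₄ (Frame.refl.set (by simp))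
  · simp [Config.set_reg]

end Loop

end TeamEnum

namespace TeamEnum

/-! ### Arithmetical expressions and their evaluation on a RAM -/

/-- The arithmetical operations of a RAM. -/
inductive Op : Type where
  | add | sub | mul | div

def Op.fn : Op → ℕ → ℕ → ℕ
  | .add, a, b => a + b
  | .sub, a, b => a - b
  | .mul, a, b => a * b
  | .div, a, b => a / b

def Op.instr : Op → ℕ → ℕ → ℕ → Instr
  | .add => .add
  | .sub => .sub
  | .mul => .mul
  | .div => .div

/-- One polynomial bound for all four operations, so that `Exp.cost` needs a single clause for
`bin`. -/
theorem Op.fn_le (o : Op) (a b : ℕ) : o.fn a b ≤ a + b + a * b := by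
  cases o with
  | add => exact Nat.le_add_right _ _
  | sub => exact (Nat.sub_le _ _).trans (by rw [add_assoc]; exact Nat.le_add_right _ _)
  | mul => exact Nat.le_add_left _ _
  | div => exact (Nat.div_le_self _ _).trans (by rw [add_assoc]; exact Nat.le_add_right _ _)

theorem Op.instr_exec (o : Op) (L : Set (List Bool)) (c : Config) (d a b : ℕ) :
    (o.instr d a b).exec L c = c.set d (o.fn (c.reg a) (c.reg b)) := by
  cases o <;> rfl

/-- Values of the variables. -/
abbrev Env : Type := ℕ → ℕ

/-- A memory of bits. -/
abbrev Mem : Type := ℕ → Bool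

/-- Expressions for numbers, over variables and a memory of bits; `get a` is the bit at address `a`
and `sum x a b` is `∑ x < a, b`. -/
inductive Exp : Type where
  | var (x : ℕ)
  | const (k : ℕ)
  | bin (o : Op) (a b : Exp)
  | get (a : Exp)
  | sum (x : ℕ) (a b : Exp)

namespace Exp

def eval : Exp → Env → Mem → ℕ
  | var x, ρ, _ => ρ x
  | const k, _, _ => k
  | bin o a b, ρ, m => o.fn (a.eval ρ m) (b.eval ρ m)
  | get a, ρ, m => (m (a.eval ρ m)).toNat
  | sum x a b, ρ, m => ∑ i ∈ Finset.range (a.eval ρ m), b.eval (Function.update ρ x i) m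

/-- The number of registers used for the evaluation. -/
def need : Exp → ℕ
  | var _ => 1
  | const _ => 1
  | bin _ a b => max a.need (1 + b.need)
  | get a => max a.need 2
  | sum _ a b => max a.need (4 + b.need)

/-- A strict upper bound for the variables that occur. -/
def vars : Exp → ℕ
  | var x => x + 1
  | const _ => 0
  | bin _ a b => max a.vars b.vars
  | get a => a.vars
  | sum x a b => max (x + 1) (max a.vars b.vars)

/-- Code for the evaluation into register `d`, to be placed at line `pc`; the memory starts at
register `M₀`. -/
def compile (M₀ : ℕ) : Exp → ℕ → ℕ → List Instr
  | var x, _, d => [.copy d x]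
  | const k, _, d => [.const d k]
  | bin o a b, pc, d =>
    a.compile M₀ pc d ++ (b.compile M₀ (pc + (a.compile M₀ pc d).length) (d + 1) ++
      [o.instr d d (d + 1)])
  | get a, pc, d => a.compile M₀ pc d ++ [.const (d + 1) M₀, .add d d (d + 1), .load d d]
  | sum x a b, pc, d =>
    a.compile M₀ pc d ++ ([.const (d + 3) 0] ++
      (loopCode x d (pc + (a.compile M₀ pc d).length + 1)
        (b.compile M₀ (pc + (a.compile M₀ pc d).length + 1 + 4) (d + 4) ++
          [.add (d + 3) (d + 3) (d + 4)]) ++ [.copy d (d + 3)]))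

/-- A bound for the value, for the evaluation time and for the numbers that occur in an
evaluation, in terms of a bound for the values of the variables. -/
noncomputable def cost (M₀ : ℕ) : Exp → Polynomial ℕ
  | var _ => .X + 1
  | const k => (k : Polynomial ℕ) + 1
  | bin _ a b => a.cost M₀ + b.cost M₀ + a.cost M₀ * b.cost M₀ + 1
  | get a => a.cost M₀ + (M₀ : Polynomial ℕ) + 5
  | sum _ a b => a.cost M₀ + a.cost M₀ * ((b.cost M₀).comp (.X + a.cost M₀) + 10) + 20

theorem update_le {ρ : Env} {K K' : ℕ} (hρ : ∀ x, ρ x ≤ K) (h : K ≤ K') {x i : ℕ} (hi : i ≤ K') :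
    ∀ y, Function.update ρ x i y ≤ K' := by
  intro y
  rw [Function.update_apply]
  split_ifs
  · exact hi
  · exact (hρ y).trans h

/-- The index of a sum stays below the value of its limit, so the body is evaluated with variables
at most `K` plus the bound for the limit; this is the composition with `.X + a.cost M₀`. The memory
contributes single bits only, so the bound is independent of it. -/
theorem eval_le (M₀ : ℕ) (e : Exp) : ∀ {ρ : Env} {m : Mem} {K : ℕ}, (∀ x, ρ x ≤ K) →
    e.eval ρ m ≤ (e.cost M₀).eval K := by
  induction e with
  | var x => intro ρ m K h; simpa [eval, cost] using (h x).trans (Nat.le_succ _)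
  | const k => intro ρ m K h; simp [eval, cost]
  | bin o a b iha ihb =>
    intro ρ m K h
    simp only [eval, cost, Polynomial.eval_add, Polynomial.eval_mul, Polynomial.eval_one]
    refine (o.fn_le _ _).trans (Nat.le_succ_of_le ?_)
    gcongr <;> first | exact iha h | exact ihb h
  | get a iha =>
    intro ρ m K h
    simp only [eval, cost, Polynomial.eval_add, Polynomial.eval_natCast, Polynomial.eval_ofNat]
    refine (Bool.toNat_le _).trans (by omega)
  | sum x a b iha ihb =>
    intro ρ m K h
    simp only [eval, cost, Polynomial.eval_add, Polynomial.eval_mul, Polynomial.eval_ofNat,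
      Polynomial.eval_comp, Polynomial.eval_X]
    refine (Finset.sum_le_card_nsmul _ _ ((b.cost M₀).eval (K + (a.cost M₀).eval K)) ?_).trans ?_
    · intro i hi
      have := (Finset.mem_range.1 hi).le.trans (iha h)
      exact ihb (update_le h (by omega) (by omega))
    · rw [Finset.card_range, smul_eq_mul]
      have := Nat.mul_le_mul (iha (m := m) h)
        (Nat.le_add_right ((b.cost M₀).eval (K + (a.cost M₀).eval K)) 10)
      exact this.trans (by omega)

/-- The registers that the evaluation into register `d` does not change. -/
abbrev Kept (M₀ d r : ℕ) : Prop := r < d ∨ M₀ ≤ r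

/-- The registers between the variables and the memory form a stack: after an evaluation into `d`,
everything below `d` and everything from `M₀` on is as before, a summation variable having been
restored. The condition on `need` keeps the stack from running into the memory. -/
theorem compile_correct {M : Program} {L : Set (List Bool)} {B nv M₀ : ℕ} (e : Exp) :
    ∀ {ρ : Env} {m : Mem} {K d : ℕ} {c : Config}, CodeAt M c.pc (e.compile M₀ c.pc d) →
      e.vars ≤ nv → nv ≤ d → d + e.need ≤ M₀ → (∀ x < nv, c.reg x = ρ x) → (∀ x, ρ x ≤ K) →
      (∀ a, c.reg (M₀ + a) = (m a).toNat) → (e.cost M₀).eval K ≤ B → c.Bounded B →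
      ∃ c', Steps M L B ((e.cost M₀).eval K) c c' ∧ c'.pc = c.pc + (e.compile M₀ c.pc d).length ∧
        c'.reg d = e.eval ρ m ∧ Frame (Kept M₀ d) c c' := by
  induction e with
  | var x =>
    intro ρ m K d c hM hv hd hn hr hK hm hB hc
    simp only [compile, codeAt_cons] at hM
    refine ⟨c.set d (c.reg x), (Steps.set hM.1 hc rfl (hc x)).mono (by simp [cost]), rfl, ?_,
      Frame.refl.set (by simp [need] at hn ⊢; omega)⟩
    simp [Config.set_reg, eval, hr x hv]
  | const k =>
    intro ρ m K d c hM hv hd hn hr hK hm hB hc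
    simp only [compile, codeAt_cons] at hM
    refine ⟨c.set d k, (Steps.set hM.1 hc rfl ?_).mono (by simp [cost]), rfl, ?_,
      Frame.refl.set (by simp [need] at hn ⊢; omega)⟩
    · simp [cost] at hB; omega
    · simp [Config.set_reg, eval]
  | bin o a b iha ihb =>
    intro ρ m K d c hM hv hd hn hr hK hm hB hc
    simp only [compile, codeAt_append, codeAt_cons] at hM
    obtain ⟨h₁, h₂, h₃, -⟩ := hM
    simp only [vars, max_le_iff] at hv
    have hn₁ : d + a.need ≤ M₀ := (Nat.add_le_add_left (le_max_left _ _) d).trans hn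
    have hn₂ : d + (1 + b.need) ≤ M₀ := (Nat.add_le_add_left (le_max_right _ _) d).trans hn
    have hval := eval_le M₀ (bin o a b) (m := m) hK
    simp only [cost, Polynomial.eval_add, Polynomial.eval_mul, Polynomial.eval_one] at hB hval ⊢
    obtain ⟨c₁, hs₁, hp₁, he₁, hf₁⟩ := iha h₁ hv.1 hd hn₁ hr hK hm (by omega) hc
    rw [← hp₁] at h₂ h₃
    obtain ⟨c₂, hs₂, hp₂, he₂, hf₂⟩ := ihb (ρ := ρ) (m := m) (K := K) h₂ hv.2 (by omega) (by omega)
      (fun x hx => by rw [hf₁.reg x (.inl (by omega)), hr x hx]) hK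
      (fun x => by rw [hf₁.reg _ (.inr (by omega)), hm]) (by omega) hs₁.bounded_right
    have hd₂ : c₂.reg d = a.eval ρ m := by rw [hf₂.reg d (.inl (by omega)), he₁]
    have hs₃ : Steps M L B 1 c₂ (c₂.set d ((bin o a b).eval ρ m)) :=
      Steps.set (by rw [hp₂]; exact h₃) hs₂.bounded_right
        (by rw [Op.instr_exec, hd₂, he₂]; rfl) (hval.trans hB)
    refine ⟨_, (hs₁.trans (hs₂.trans hs₃)).mono (by omega), ?_, by simp [Config.set_reg],
      (hf₁.trans hf₂ (T := Kept M₀ d) (fun r h => h) fun r h => ?_).set ?_⟩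
    · simp only [Config.set_pc, hp₂, hp₁, compile, List.length_append, List.length_cons,
        List.length_nil]; omega
    · unfold Kept at *; omega
    · unfold Kept at *; omega
  | get a iha =>
    intro ρ m K d c hM hv hd hn hr hK hm hB hc
    simp only [compile, codeAt_append, codeAt_cons] at hM
    obtain ⟨h₁, h₂, h₃, h₄, -⟩ := hM
    have hn₁ : d + a.need ≤ M₀ := (Nat.add_le_add_left (le_max_left _ _) d).trans hn
    have hn₂ : d + 2 ≤ M₀ := (Nat.add_le_add_left (le_max_right _ _) d).trans hn
    simp only [cost, Polynomial.eval_add, Polynomial.eval_natCast, Polynomial.eval_ofNat,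
      Nat.cast_id] at hB ⊢
    have hval := eval_le M₀ a (m := m) hK
    obtain ⟨c₁, hs₁, hp₁, he₁, hf₁⟩ := iha h₁ hv hd hn₁ hr hK hm (by omega) hc
    rw [← hp₁] at h₂ h₃ h₄
    have hs₂ : Steps M L B 1 c₁ (c₁.set (d + 1) M₀) :=
      Steps.set h₂ hs₁.bounded_right rfl (by omega)
    have hs₃ : Steps M L B 1 (c₁.set (d + 1) M₀)
        ((c₁.set (d + 1) M₀).set d (M₀ + a.eval ρ m)) :=
      Steps.set h₃ hs₂.bounded_right
        (by simp only [Instr.exec, Config.set_reg, if_true]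
            rw [if_neg (by omega), he₁, add_comm M₀]) (by omega)
    have hs₄ : Steps M L B 1 ((c₁.set (d + 1) M₀).set d (M₀ + a.eval ρ m))
        (((c₁.set (d + 1) M₀).set d (M₀ + a.eval ρ m)).set d ((get a).eval ρ m)) :=
      Steps.set h₄ hs₃.bounded_right
        (by simp only [Instr.exec, Config.set_reg, if_true]
            rw [if_neg (by omega), if_neg (by omega), hf₁.reg _ (.inr (by omega)), hm]; rfl)
        ((Bool.toNat_le _).trans (by omega))
    refine ⟨_, (hs₁.trans (hs₂.trans (hs₃.trans hs₄))).mono (by omega), ?_,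
      by simp [Config.set_reg], ((hf₁.set ?_).set ?_).set ?_⟩
    · simp only [Config.set_pc, hp₁, compile, List.length_append, List.length_cons,
        List.length_nil]
      omega
    all_goals unfold Kept at *; omega
  | sum x a b iha ihb =>
    intro ρ m K d c hM hv hd hn hr hK hm hB hc
    simp only [compile, codeAt_append, codeAt_cons] at hM
    obtain ⟨h₁, ⟨h₂, -⟩, h₃, h₄, -⟩ := hM
    simp only [vars, max_le_iff] at hv
    have hn₁ : d + a.need ≤ M₀ := (Nat.add_le_add_left (le_max_left _ _) d).trans hn
    have hn₂ : d + (4 + b.need) ≤ M₀ := (Nat.add_le_add_left (le_max_right _ _) d).trans hn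
    have hval := eval_le M₀ a (m := m) hK
    have hval' := eval_le M₀ (sum x a b) (m := m) hK
    simp only [cost, Polynomial.eval_add, Polynomial.eval_mul, Polynomial.eval_ofNat,
      Polynomial.eval_comp, Polynomial.eval_X] at hB hval' ⊢
    set ca := (a.cost M₀).eval K with hca
    set cb := (b.cost M₀).eval (K + ca) with hcb
    obtain ⟨c₁, hs₁, hp₁, he₁, hf₁⟩ := iha h₁ hv.2.1 hd hn₁ hr hK hm (by omega) hc
    rw [← hp₁] at h₂ h₃ h₄
    have hs₂ : Steps M L B 1 c₁ (c₁.set (d + 3) 0) :=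
      Steps.set h₂ hs₁.bounded_right rfl (by omega)
    set c₂ := c₁.set (d + 3) 0 with hc₂
    have hp₂ : c₂.pc = c₁.pc + 1 := rfl
    have hf₂ : Frame (Kept M₀ d) c c₂ := hf₁.set (by unfold Kept; omega)
    simp only [List.length_cons, List.length_nil, zero_add] at h₃ h₄
    rw [← hp₂] at h₃ h₄
    set F : ℕ → ℕ := fun i => b.eval (Function.update ρ x i) m with hF
    have hFle : ∀ i ≤ ca, F i ≤ cb := fun i hi => eval_le M₀ b (update_le hK (by omega) (by omega))
    let P : ℕ → Config → Prop := fun i c' => c'.reg (d + 3) = ∑ j ∈ Finset.range i, F j ∧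
      Frame (fun r => Kept M₀ d r ∧ r ≠ x) c c'
    have hk1 : a.eval ρ m * 10 ≤ ca * (cb + 10) := Nat.mul_le_mul hval (by omega)
    -- The bound `cb` for the body need not be below `B` when the sum is empty. It is required only
    -- if the body runs, and then the factor `ca` is positive.
    have hcbB : 0 < a.eval ρ m → cb ≤ ca * (cb + 10) := fun h0 =>
      (Nat.le_add_right cb 10).trans (Nat.le_mul_of_pos_left _ (by omega))
    obtain ⟨c₃, hs₃, hp₃, hP₃, hx₃⟩ := loop_correct (L := L) (B := B) (tb := cb + 1)
      (k := a.eval ρ m) P (by omega) h₃ (by omega)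
      (fun i c c' hP hf => ⟨by rw [hf.reg _ (by omega), hP.1],
        hP.2.trans hf (fun r h => h) fun r h => by unfold Kept at h; omega⟩)
      (by
        intro i c₃ hi hp hxi hP hB₃
        have hcode := (codeAt_append.1 (codeAt_append.1 h₃).1).2
        simp only [List.length_cons, List.length_nil, zero_add, Nat.reduceAdd] at hcode
        rw [← hp, codeAt_append, codeAt_cons] at hcode
        have hcb' := hcbB (by omega)
        obtain ⟨c₄, hs₄, hp₄, he₄, hf₄⟩ := ihb (ρ := Function.update ρ x i) (m := m)
          (K := K + ca) (d := d + 4) hcode.1 hv.2.2 (by omega) (by omega)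
          (fun y hy => by
            rw [Function.update_apply]
            split_ifs with h
            · rw [h, hxi]
            · rw [hP.2.reg y ⟨.inl (by omega), h⟩, hr y hy])
          (update_le hK (by omega) (by omega))
          (fun a => by rw [hP.2.reg _ ⟨.inr (by omega), by omega⟩, hm]) (by omega) hB₃
        have hsum : ∑ j ∈ Finset.range i, F j + F i ≤ B := by
          rw [← Finset.sum_range_succ]
          exact (Finset.sum_le_sum_of_subset (Finset.range_subset_range.2 (by omega))).trans
            (hval'.trans hB)
        have hd₄ : c₄.reg (d + 3) = ∑ j ∈ Finset.range i, F j := by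
          rw [hf₄.reg _ (.inl (by omega)), hP.1]
        have hs₅ : Steps M L B 1 c₄ (c₄.set (d + 3) (∑ j ∈ Finset.range i, F j + F i)) :=
          Steps.set (by rw [hp₄]; exact hcode.2.1) hs₄.bounded_right
            (by simp only [Instr.exec, hd₄, he₄, hF]) hsum
        refine ⟨_, hs₄.trans hs₅, ?_, ⟨?_, ?_⟩, ?_⟩
        · rw [Config.set_pc, hp₄, hp, List.length_append]; rfl
        · rw [Finset.sum_range_succ]; simp [Config.set_reg]
        · refine (hP.2.trans hf₄ (fun r h => h) fun r h => ?_).set ?_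
          · unfold Kept at *; omega
          · unfold Kept; omega
        · intro r hr'
          rw [Config.set_reg, if_neg (by omega), hf₄.reg r (.inl (by omega))])
      (by rw [hc₂, Config.set_reg, if_neg (by omega), he₁])
      ⟨by simp [hc₂, Config.set_reg], hf₂.trans Frame.refl (fun r h => h.1) (fun r h => h)⟩
      hs₂.bounded_right
    have hs₄ : Steps M L B 1 c₃ (c₃.set d ((sum x a b).eval ρ m)) :=
      Steps.set (by rw [hp₃]; exact h₄) hs₃.bounded_right
        (by simp only [Instr.exec, hP₃.1]; rfl) (hval'.trans hB)
    refine ⟨_, (hs₁.trans (hs₂.trans (hs₃.trans hs₄))).mono ?_, ?_, by simp [Config.set_reg],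
      Frame.set ⟨fun r h => ?_, hP₃.2.word, hP₃.2.question, hP₃.2.outputs⟩ ?_⟩
    · have : a.eval ρ m * (cb + 1 + 4) ≤ ca * (cb + 10) := Nat.mul_le_mul hval (by omega)
      omega
    · simp only [compile, Config.set_pc, List.length_append, List.length_cons, List.length_nil]
      rw [hp₃, hp₂, hp₁]
      simp only [loopCode_length, List.length_append, List.length_cons, List.length_nil]
      omega
    · by_cases hrx : r = x
      · rw [hrx, hx₃, hf₂.reg x (hrx ▸ h)]
      · exact hP₃.2.reg r ⟨h, hrx⟩
    · unfold Kept; omega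

end Exp

end TeamEnum

namespace TeamEnum

/-! ### Loop programs over a bit memory -/

/-- Programs with bounded loops: `store a e` stores the bit `e ≠ 0` at address `a`, `loop x e C`
runs `C` with `x = 0, …, e - 1`, `bind x e C` runs `C` with `x = e`, and `write e` emits the bit
`e ≠ 0`. -/
inductive Cmd : Type where
  | store (a e : Exp)
  | loop (x : ℕ) (e : Exp) (C : Cmd)
  | seq (C D : Cmd)
  | bind (x : ℕ) (e : Exp) (C : Cmd)
  | write (e : Exp)

/-- Apply `f 0`, …, `f (k - 1)` to `m`, in this order. -/
def iter {α : Type*} (f : ℕ → α → α) : ℕ → α → α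
  | 0, m => m
  | k + 1, m => f k (iter f k m)

namespace Cmd

/-- The memory after running a program. -/
def run : Cmd → Env → Mem → Mem
  | store a e, ρ, m => Function.update m (a.eval ρ m) (decide (e.eval ρ m ≠ 0))
  | loop x e C, ρ, m => iter (fun i => C.run (Function.update ρ x i)) (e.eval ρ m) m
  | seq C D, ρ, m => D.run ρ (C.run ρ m)
  | bind x e C, ρ, m => C.run (Function.update ρ x (e.eval ρ m)) m
  | write _, _, m => m

/-- The bits written by a program. -/
def emit : Cmd → Env → Mem → List Bool
  | store _ _, _, _ => []
  | loop x e C, ρ, m => (List.range (e.eval ρ m)).flatMap fun i =>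
      C.emit (Function.update ρ x i) (iter (fun i => C.run (Function.update ρ x i)) i m)
  | seq C D, ρ, m => C.emit ρ m ++ D.emit ρ (C.run ρ m)
  | bind x e C, ρ, m => C.emit (Function.update ρ x (e.eval ρ m)) m
  | write e, ρ, m => [decide (e.eval ρ m ≠ 0)]

/-- The number of auxiliary registers used. -/
def need : Cmd → ℕ
  | store a e => max a.need (max (1 + e.need) 3)
  | loop _ e C => max e.need (3 + C.need)
  | seq C D => max C.need D.need
  | bind _ e C => max e.need (2 + C.need)
  | write e => e.need

/-- A strict upper bound for the variables that occur. -/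
def vars : Cmd → ℕ
  | store a e => max a.vars e.vars
  | loop x e C => max (x + 1) (max e.vars C.vars)
  | seq C D => max C.vars D.vars
  | bind x e C => max (x + 1) (max e.vars C.vars)
  | write e => e.vars

/-- Code for a program, to be placed at line `pc`, with auxiliary registers from `d` on; the memory
starts at register `M₀`. -/
def compile (M₀ : ℕ) : Cmd → ℕ → ℕ → List Instr
  | store a e, pc, d =>
    a.compile M₀ pc d ++ (e.compile M₀ (pc + (a.compile M₀ pc d).length) (d + 1) ++
      [.const (d + 2) M₀, .add d d (d + 2), .const (d + 2) 1, .sub (d + 1) (d + 2) (d + 1),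
        .sub (d + 1) (d + 2) (d + 1), .store d (d + 1)])
  | loop x e C, pc, d =>
    e.compile M₀ pc d ++ loopCode x d (pc + (e.compile M₀ pc d).length)
      (C.compile M₀ (pc + (e.compile M₀ pc d).length + 4) (d + 3))
  | seq C D, pc, d => C.compile M₀ pc d ++ D.compile M₀ (pc + (C.compile M₀ pc d).length) d
  | bind x e C, pc, d =>
    e.compile M₀ pc d ++ ([.copy (d + 1) x, .copy x d] ++
      (C.compile M₀ (pc + (e.compile M₀ pc d).length + 2) (d + 2) ++ [.copy x (d + 1)]))
  | write e, pc, d => e.compile M₀ pc d ++ [.write d]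

/-- A bound for the running time and for the numbers that occur, in terms of a bound for the values
of the variables. -/
noncomputable def cost (M₀ : ℕ) : Cmd → Polynomial ℕ
  | store a e => a.cost M₀ + e.cost M₀ + (M₀ : Polynomial ℕ) + 10
  | loop _ e C => e.cost M₀ + e.cost M₀ * ((C.cost M₀).comp (.X + e.cost M₀) + 10) + 20
  | seq C D => C.cost M₀ + D.cost M₀
  | bind _ e C => e.cost M₀ + (C.cost M₀).comp (.X + e.cost M₀) + 10
  | write e => e.cost M₀ + 1

/-- `c'` is a result of running `C` from `c` with memory contents `m`. -/
structure Done (C : Cmd) (M₀ : ℕ) (d : ℕ) (ρ : Env) (m : Mem) (c c' : Config) : Prop where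
  pc : c'.pc = c.pc + (C.compile M₀ c.pc d).length
  mem : ∀ a, c'.reg (M₀ + a) = (C.run ρ m a).toNat
  reg : ∀ r < d, c'.reg r = c.reg r
  word : c'.word = c.word ++ C.emit ρ m
  question : c'.question = c.question
  outputs : c'.outputs = c.outputs

/-- The stack discipline is that of expressions. Variables changed by `loop` and `bind` are saved on
the stack and restored, so the same environment describes the variables before and after, and
sequential composition is immediate. -/
theorem compile_correct {M : Program} {L : Set (List Bool)} {B nv M₀ : ℕ} (C : Cmd) :
    ∀ {ρ : Env} {m : Mem} {K d : ℕ} {c : Config}, CodeAt M c.pc (C.compile M₀ c.pc d) →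
      C.vars ≤ nv → nv ≤ d → d + C.need ≤ M₀ → (∀ x < nv, c.reg x = ρ x) → (∀ x, ρ x ≤ K) →
      (∀ a, c.reg (M₀ + a) = (m a).toNat) → (C.cost M₀).eval K ≤ B → c.Bounded B →
      ∃ c', Steps M L B ((C.cost M₀).eval K) c c' ∧ C.Done M₀ d ρ m c c' := by
  induction C with
  | store a e =>
    intro ρ m K d c hM hv hd hn hr hK hm hB hc
    simp only [compile, codeAt_append, codeAt_cons] at hM
    obtain ⟨h₁, h₂, h₃, h₄, h₅, h₆, h₇, h₈, -⟩ := hM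
    simp only [vars, max_le_iff] at hv
    have hn₁ : d + a.need ≤ M₀ := (Nat.add_le_add_left (le_max_left _ _) d).trans hn
    have hn' : d + max (1 + e.need) 3 ≤ M₀ := (Nat.add_le_add_left (le_max_right _ _) d).trans hn
    have hn₂ : d + (1 + e.need) ≤ M₀ := (Nat.add_le_add_left (le_max_left _ _) d).trans hn'
    have hn₃ : d + 3 ≤ M₀ := (Nat.add_le_add_left (le_max_right _ _) d).trans hn'
    simp only [cost, Polynomial.eval_add, Polynomial.eval_natCast, Polynomial.eval_ofNat,
      Nat.cast_id] at hB ⊢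
    have hval := Exp.eval_le M₀ a (m := m) hK
    obtain ⟨c₁, hs₁, hp₁, he₁, hf₁⟩ := a.compile_correct (L := L) h₁ hv.1 hd hn₁ hr hK hm (by omega) hc
    rw [← hp₁] at h₂ h₃ h₄ h₅ h₆ h₇ h₈
    obtain ⟨c₂, hs₂, hp₂, he₂, hf₂⟩ := e.compile_correct (L := L) (ρ := ρ) (m := m) (K := K) h₂ hv.2
      (by omega) (by omega) (fun x hx => by rw [hf₁.reg x (.inl (by omega)), hr x hx]) hK
      (fun x => by rw [hf₁.reg _ (.inr (by omega)), hm]) (by omega) hs₁.bounded_right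
    rw [← hp₂] at h₃ h₄ h₅ h₆ h₇ h₈
    have hd₂ : c₂.reg d = a.eval ρ m := by rw [hf₂.reg d (.inl (by omega)), he₁]
    have hf : Frame (Exp.Kept M₀ d) c c₂ :=
      hf₁.trans hf₂ (fun r h => h) fun r h => by unfold Exp.Kept at *; omega
    set v := e.eval ρ m with hv'
    have hs₃ : Steps M L B 1 c₂ (c₂.set (d + 2) M₀) :=
      Steps.set h₃ hs₂.bounded_right rfl (by omega)
    set c₃ := c₂.set (d + 2) M₀ with hc₃
    have hs₄ : Steps M L B 1 c₃ (c₃.set d (M₀ + a.eval ρ m)) :=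
      Steps.set h₄ hs₃.bounded_right
        (by simp only [Instr.exec, hc₃, Config.set_reg, if_true]
            rw [if_neg (by omega), hd₂, add_comm M₀]) (by omega)
    set c₄ := c₃.set d (M₀ + a.eval ρ m) with hc₄
    have hs₅ : Steps M L B 1 c₄ (c₄.set (d + 2) 1) :=
      Steps.set h₅ hs₄.bounded_right rfl (by omega)
    set c₅ := c₄.set (d + 2) 1 with hc₅
    have hr₅ : c₅.reg (d + 1) = v := by
      simp only [hc₅, hc₄, hc₃, Config.set_reg]
      rw [if_neg (by omega), if_neg (by omega), if_neg (by omega), he₂]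
    have hr₅' : c₅.reg (d + 2) = 1 := by simp [hc₅, Config.set_reg]
    -- Two subtractions from `1` turn `v` into the bit `v ≠ 0`, so that the memory never holds
    -- anything but bits.
    have hs₆ : Steps M L B 1 c₅ (c₅.set (d + 1) (1 - v)) :=
      Steps.set h₆ hs₅.bounded_right (by simp only [Instr.exec, hr₅, hr₅']) (by omega)
    set c₆ := c₅.set (d + 1) (1 - v) with hc₆
    have hs₇ : Steps M L B 1 c₆ (c₆.set (d + 1) (1 - (1 - v))) :=
      Steps.set h₇ hs₆.bounded_right
        (by simp only [Instr.exec, hc₆, Config.set_reg, if_true]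
            rw [if_neg (by omega), hr₅']) (by omega)
    set c₇ := c₆.set (d + 1) (1 - (1 - v)) with hc₇
    have hr₇ : c₇.reg d = M₀ + a.eval ρ m := by
      simp only [hc₇, hc₆, hc₅, hc₄, Config.set_reg, if_true]
      rw [if_neg (by omega), if_neg (by omega), if_neg (by omega)]
    have hs₈ : Steps M L B 1 c₇ (c₇.set (M₀ + a.eval ρ m) (1 - (1 - v))) :=
      Steps.set h₈ hs₇.bounded_right
        (by simp only [Instr.exec, hr₇]
            simp only [hc₇, Config.set_reg, if_true]) (by omega)
    refine ⟨_, (hs₁.trans (hs₂.trans (hs₃.trans (hs₄.trans (hs₅.trans (hs₆.trans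
      (hs₇.trans hs₈))))))).mono (by omega), ?_, ?_, ?_, ?_, ?_, ?_⟩
    · simp only [compile, List.length_append, List.length_cons, List.length_nil, Config.set_pc,
        hc₇, hc₆, hc₅, hc₄, hc₃, hp₂, hp₁]
      omega
    · intro b
      rw [Config.set_reg]
      simp only [run, Function.update_apply]
      by_cases hb : b = a.eval ρ m
      · rw [if_pos (by omega), if_pos hb]
        by_cases h0 : v = 0
        · simp [← hv', h0]
        · simp only [← hv', ne_eq, h0, not_false_eq_true, decide_true, Bool.toNat_true]; omega
      · rw [if_neg (by omega), if_neg hb]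
        simp only [hc₇, hc₆, hc₅, hc₄, hc₃, Config.set_reg]
        rw [if_neg (by omega), if_neg (by omega), if_neg (by omega), if_neg (by omega),
          if_neg (by omega), hf.reg _ (.inr (by omega)), hm]
    · intro r hr'
      simp only [hc₇, hc₆, hc₅, hc₄, hc₃, Config.set_reg]
      rw [if_neg (by omega), if_neg (by omega), if_neg (by omega), if_neg (by omega),
        if_neg (by omega), if_neg (by omega), hf.reg _ (.inl hr')]
    · simp only [emit, List.append_nil]; exact hf.word
    · exact hf.question
    · exact hf.outputs
  | loop x e C ih =>
    intro ρ m K d c hM hv hd hn hr hK hm hB hc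
    simp only [compile, codeAt_append] at hM
    obtain ⟨h₁, h₂⟩ := hM
    simp only [vars, max_le_iff] at hv
    have hn₁ : d + e.need ≤ M₀ := (Nat.add_le_add_left (le_max_left _ _) d).trans hn
    have hn₂ : d + (3 + C.need) ≤ M₀ := (Nat.add_le_add_left (le_max_right _ _) d).trans hn
    have hval := Exp.eval_le M₀ e (m := m) hK
    simp only [cost, Polynomial.eval_add, Polynomial.eval_mul, Polynomial.eval_ofNat,
      Polynomial.eval_comp, Polynomial.eval_X] at hB ⊢
    set ce := (e.cost M₀).eval K with hce
    set cb := (C.cost M₀).eval (K + ce) with hcb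
    obtain ⟨c₁, hs₁, hp₁, he₁, hf₁⟩ := e.compile_correct (L := L) h₁ hv.2.1 hd hn₁ hr hK hm (by omega) hc
    rw [← hp₁] at h₂
    let P : ℕ → Config → Prop := fun i c' =>
      (∀ a, c'.reg (M₀ + a) = (iter (fun i => C.run (Function.update ρ x i)) i m a).toNat) ∧
      (∀ r, r < d ∧ r ≠ x → c'.reg r = c.reg r) ∧
      c'.word = c.word ++ (List.range i).flatMap (fun i => C.emit (Function.update ρ x i)
        (iter (fun i => C.run (Function.update ρ x i)) i m)) ∧
      c'.question = c.question ∧ c'.outputs = c.outputs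
    have hcbB : 0 < e.eval ρ m → cb ≤ ce * (cb + 10) := fun h0 =>
      (Nat.le_add_right cb 10).trans (Nat.le_mul_of_pos_left _ (by omega))
    obtain ⟨c₃, hs₃, hp₃, hP₃, hx₃⟩ := loop_correct (L := L) (B := B) (tb := cb)
      (k := e.eval ρ m) P (by omega) h₂ (by omega)
      (fun i c c' hP hf => ⟨fun a => by rw [hf.reg _ (by omega), hP.1],
        fun r h => by rw [hf.reg _ (by omega), hP.2.1 r h], by rw [hf.word, hP.2.2.1],
        by rw [hf.question, hP.2.2.2.1], by rw [hf.outputs, hP.2.2.2.2]⟩)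
      (by
        intro i c₃ hi hp hxi hP hB₃
        have hcode := (codeAt_append.1 (codeAt_append.1 h₂).1).2
        simp only [List.length_cons, List.length_nil, zero_add, Nat.reduceAdd] at hcode
        have hcb' := hcbB (by omega)
        rw [← hp] at hcode ⊢
        obtain ⟨c₄, hs₄, hD⟩ := ih (ρ := Function.update ρ x i)
          (m := iter (fun i => C.run (Function.update ρ x i)) i m)
          (K := K + ce) (d := d + 3) hcode hv.2.2 (by omega) (by omega)
          (fun y hy => by
            rw [Function.update_apply]
            split_ifs with h
            · rw [h, hxi]
            · rw [hP.2.1 y ⟨by omega, h⟩, hr y hy])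
          (Exp.update_le hK (by omega) (by omega)) hP.1 (by omega) hB₃
        refine ⟨c₄, hs₄, hD.pc, ⟨hD.mem, ?_, ?_, ?_, ?_⟩, hD.reg⟩
        · intro r h
          rw [hD.reg r (by omega), hP.2.1 r h]
        · rw [hD.word, hP.2.2.1, List.range_succ, List.flatMap_append, List.append_assoc]
          simp
        · rw [hD.question, hP.2.2.2.1]
        · rw [hD.outputs, hP.2.2.2.2])
      he₁
      ⟨fun a => by rw [hf₁.reg _ (.inr (by omega)), hm]; rfl, fun r h => hf₁.reg r (.inl h.1),
        by simpa using hf₁.word, hf₁.question, hf₁.outputs⟩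
      hs₁.bounded_right
    refine ⟨c₃, (hs₁.trans hs₃).mono ?_, ?_, hP₃.1, ?_, hP₃.2.2.1, hP₃.2.2.2.1, hP₃.2.2.2.2⟩
    · have : e.eval ρ m * (cb + 4) ≤ ce * (cb + 10) := Nat.mul_le_mul hval (by omega)
      omega
    · rw [hp₃, hp₁]
      simp only [compile, List.length_append]
      omega
    · intro r h
      by_cases hrx : r = x
      · rw [hrx, hx₃, hf₁.reg x (.inl (by omega))]
      · exact hP₃.2.1 r ⟨h, hrx⟩
  | seq C D ihC ihD =>
    intro ρ m K d c hM hv hd hn hr hK hm hB hc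
    simp only [compile, codeAt_append] at hM
    obtain ⟨h₁, h₂⟩ := hM
    simp only [vars, max_le_iff] at hv
    have hn₁ : d + C.need ≤ M₀ := (Nat.add_le_add_left (le_max_left _ _) d).trans hn
    have hn₂ : d + D.need ≤ M₀ := (Nat.add_le_add_left (le_max_right _ _) d).trans hn
    simp only [cost, Polynomial.eval_add] at hB ⊢
    obtain ⟨c₁, hs₁, hD₁⟩ := ihC h₁ hv.1 hd hn₁ hr hK hm (by omega) hc
    rw [← hD₁.pc] at h₂
    obtain ⟨c₂, hs₂, hD₂⟩ := ihD h₂ hv.2 hd hn₂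
      (fun x hx => by rw [hD₁.reg x (by omega), hr x hx]) hK hD₁.mem (by omega) hs₁.bounded_right
    refine ⟨c₂, hs₁.trans hs₂, ?_, hD₂.mem, fun r h => by rw [hD₂.reg r h, hD₁.reg r h], ?_,
      hD₂.question.trans hD₁.question, hD₂.outputs.trans hD₁.outputs⟩
    · rw [hD₂.pc, hD₁.pc, compile, List.length_append, add_assoc]
    · rw [hD₂.word, hD₁.word, emit, List.append_assoc]
  | bind x e C ih =>
    intro ρ m K d c hM hv hd hn hr hK hm hB hc
    simp only [compile, codeAt_append, codeAt_cons, List.length_cons, List.length_nil,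
      zero_add, Nat.reduceAdd] at hM
    obtain ⟨h₁, ⟨h₂, h₃, -⟩, h₄, h₅, -⟩ := hM
    simp only [vars, max_le_iff] at hv
    have hn₁ : d + e.need ≤ M₀ := (Nat.add_le_add_left (le_max_left _ _) d).trans hn
    have hn₂ : d + (2 + C.need) ≤ M₀ := (Nat.add_le_add_left (le_max_right _ _) d).trans hn
    have hval := Exp.eval_le M₀ e (m := m) hK
    simp only [cost, Polynomial.eval_add, Polynomial.eval_ofNat,
      Polynomial.eval_comp, Polynomial.eval_X] at hB ⊢
    obtain ⟨c₁, hs₁, hp₁, he₁, hf₁⟩ := e.compile_correct (L := L) h₁ hv.2.1 hd hn₁ hr hK hm (by omega) hc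
    rw [← hp₁] at h₂ h₃ h₄ h₅
    have hs₂ : Steps M L B 1 c₁ (c₁.set (d + 1) (c₁.reg x)) :=
      Steps.set h₂ hs₁.bounded_right rfl (hs₁.bounded_right _)
    have hs₃ : Steps M L B 1 (c₁.set (d + 1) (c₁.reg x))
        ((c₁.set (d + 1) (c₁.reg x)).set x (e.eval ρ m)) :=
      Steps.set h₃ hs₂.bounded_right
        (by simp only [Instr.exec, Config.set_reg]
            rw [if_neg (by omega), he₁]) (by omega)
    set c₃ := (c₁.set (d + 1) (c₁.reg x)).set x (e.eval ρ m) with hc₃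
    have hr₃ : ∀ r, c₃.reg r = if r = x then e.eval ρ m else if r = d + 1 then c₁.reg x
        else c₁.reg r := fun r => by simp only [hc₃, Config.set_reg]
    have hp₃ : c₃.pc = c₁.pc + 2 := rfl
    rw [← hp₃] at h₄ h₅
    obtain ⟨c₄, hs₄, hD⟩ := ih (ρ := Function.update ρ x (e.eval ρ m)) (m := m)
      (K := K + (e.cost M₀).eval K) h₄ hv.2.2 (by omega) (by omega)
      (fun y hy => by
        rw [hr₃, Function.update_apply]
        split_ifs with h h'
        · rfl
        · omega
        · rw [hf₁.reg y (.inl (by omega)), hr y hy])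
      (Exp.update_le hK (by omega) (by omega))
      (fun a => by
        rw [hr₃, if_neg (by omega), if_neg (by omega), hf₁.reg _ (.inr (by omega)), hm])
      (by omega) hs₃.bounded_right
    have hd₄ : c₄.reg (d + 1) = c.reg x := by
      rw [hD.reg _ (by omega), hr₃, if_neg (by omega), if_pos rfl, hf₁.reg _ (.inl (by omega))]
    have hs₅ : Steps M L B 1 c₄ (c₄.set x (c.reg x)) :=
      Steps.set (by rw [hD.pc]; exact h₅) hs₄.bounded_right (by simp only [Instr.exec, hd₄]) (hc x)
    refine ⟨_, (hs₁.trans (hs₂.trans (hs₃.trans (hs₄.trans hs₅)))).mono (by omega), ?_, ?_, ?_, ?_,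
      ?_, ?_⟩
    · rw [Config.set_pc, hD.pc, hp₃, hp₁]
      simp only [compile, List.length_append, List.length_cons, List.length_nil]
      omega
    · intro a
      rw [Config.set_reg, if_neg (by omega), hD.mem]; rfl
    · intro r h
      rw [Config.set_reg]
      split_ifs with hrx
      · rw [hrx]
      · rw [hD.reg r (by omega), hr₃, if_neg hrx, if_neg (by omega), hf₁.reg r (.inl h)]
    · rw [Config.set_word, hD.word]
      exact congrArg (· ++ _) hf₁.word
    · exact hD.question.trans hf₁.question
    · exact hD.outputs.trans hf₁.outputs
  | write e =>
    intro ρ m K d c hM hv hd hn hr hK hm hB hc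
    simp only [compile, codeAt_append, codeAt_cons] at hM
    obtain ⟨h₁, h₂, -⟩ := hM
    simp only [cost, Polynomial.eval_add, Polynomial.eval_one] at hB ⊢
    obtain ⟨c₁, hs₁, hp₁, he₁, hf₁⟩ := e.compile_correct (L := L) h₁ hv hd hn hr hK hm (by omega) hc
    rw [← hp₁] at h₂
    refine ⟨_, hs₁.trans (Steps.single h₂ hs₁.bounded_right hs₁.bounded_right), ?_, ?_, ?_, ?_,
      hf₁.question, hf₁.outputs⟩
    · simp [Instr.exec, hp₁, compile, add_assoc]
    · intro a
      simp only [Instr.exec]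
      rw [hf₁.reg _ (.inr (by omega)), hm]; rfl
    · intro r h
      exact hf₁.reg r (.inl h)
    · simp only [Instr.exec, he₁, emit, hf₁.word]

end Cmd

end TeamEnum

namespace TeamEnum

/-! ### Enumeration by iterating a loop program -/

section Run

variable {M : Program} {L : Set (List Bool)} {B D : ℕ} {c c' : Config}

theorem Program.step_outputs_length_le (M : Program) (L : Set (List Bool)) (c : Config) :
    c.outputs.length ≤ (M.step L c).outputs.length := by
  unfold Program.step
  cases M[c.pc]? with
  | none => exact le_rfl
  | some i => cases i <;> simp [Instr.exec, Config.set]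

theorem Program.iterate_outputs_length_mono (M : Program) (L : Set (List Bool)) (c : Config)
    {s t : ℕ} (h : s ≤ t) :
    ((M.step L)^[s] c).outputs.length ≤ ((M.step L)^[t] c).outputs.length := by
  induction t, h using Nat.le_induction with
  | base => exact le_rfl
  | succ t _ ih =>
    rw [Function.iterate_succ_apply']
    exact ih.trans (M.step_outputs_length_le L _)

theorem Program.Halted.iterate (h : M.Halted c) (t : ℕ) : (M.step L)^[t] c = c := by
  have : M.step L c = c := by
    unfold Program.Halted at h
    simp only [Program.step, h]
  exact Function.iterate_fixed this t

/-- From `c` on, `M` halts with outputs satisfying `Q`, the registers are bounded by `B`, and the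
delay is at most `2 * D`. -/
structure Enumerating (M : Program) (L : Set (List Bool)) (B D : ℕ)
    (Q : List (List Bool) → Prop) (c : Config) : Prop where
  halt : ∃ t, M.Halted ((M.step L)^[t] c) ∧ Q ((M.step L)^[t] c).outputs
  bounded : ∀ t, ((M.step L)^[t] c).Bounded B
  delay : ∀ t, M.Halted ((M.step L)^[t + 2 * D] c) ∨
    ((M.step L)^[t] c).outputs.length < ((M.step L)^[t + 2 * D] c).outputs.length

/-- Within `D` steps from `c`, `M` halts or outputs a solution. -/
def Prompt (M : Program) (L : Set (List Bool)) (D : ℕ) (c : Config) : Prop :=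
  M.Halted ((M.step L)^[D] c) ∨ c.outputs.length < ((M.step L)^[D] c).outputs.length

theorem Steps.prompt_of_halted (h : Steps M L B D c c') (hc' : M.Halted c') : Prompt M L D c := by
  obtain ⟨t, ht, rfl, -⟩ := h
  obtain ⟨e, rfl⟩ := Nat.exists_eq_add_of_le ht
  left
  rw [add_comm, Function.iterate_add_apply, hc'.iterate]
  exact hc'

theorem Steps.prompt_of_lt (h : Steps M L B D c c') (hc' : c.outputs.length < c'.outputs.length) :
    Prompt M L D c := by
  obtain ⟨t, ht, rfl, -⟩ := h
  exact .inr (hc'.trans_le (M.iterate_outputs_length_mono L c ht))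

theorem Steps.enumerating_of_halted {Q : List (List Bool) → Prop} (h : Steps M L B D c c')
    (hc' : M.Halted c') (hQ : Q c'.outputs) : Enumerating M L B D Q c := by
  obtain ⟨t, ht, rfl, hB⟩ := h
  have key : ∀ s, t ≤ s → (M.step L)^[s] c = (M.step L)^[t] c := by
    intro s hs
    obtain ⟨e, rfl⟩ := Nat.exists_eq_add_of_le hs
    rw [add_comm, Function.iterate_add_apply, hc'.iterate]
  refine ⟨⟨t, hc', hQ⟩, fun s => ?_, fun s => .inl ?_⟩
  · rcases le_total s t with hs | hs
    · exact hB s hs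
    · rw [key s hs]
      exact hB t le_rfl
  · rw [key _ (by omega)]
    exact hc'

/-- From a moment before `c'` it takes at most `D` steps to reach `c'`, and promptness at `c'` adds
another `D`; this is the origin of the delay `2 * D`. Later moments are covered by the hypothesis on
`c'`. -/
theorem Steps.enumerating {Q : List (List Bool) → Prop} (h : Steps M L B D c c')
    (hc' : Enumerating M L B D Q c') (hp : Prompt M L D c') : Enumerating M L B D Q c := by
  obtain ⟨t, ht, rfl, hB⟩ := h
  have key : ∀ s, (M.step L)^[s + t] c = (M.step L)^[s] ((M.step L)^[t] c) := fun s =>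
    Function.iterate_add_apply _ _ _ _
  refine ⟨?_, fun s => ?_, fun s => ?_⟩
  · obtain ⟨s, hs⟩ := hc'.halt
    exact ⟨s + t, by rwa [key]⟩
  · rcases le_total s t with hs | hs
    · exact hB s hs
    · obtain ⟨e, rfl⟩ := Nat.exists_eq_add_of_le hs
      rw [add_comm, key]
      exact hc'.bounded e
  · rcases le_total t s with hs | hs
    · obtain ⟨e, rfl⟩ := Nat.exists_eq_add_of_le hs
      have := hc'.delay e
      rwa [← key, ← key, show e + t = t + e by omega,
        show e + 2 * D + t = t + e + 2 * D by omega] at this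
    · have hle := M.iterate_outputs_length_mono L c hs
      rcases hp with hp | hp
      · left
        rw [← key] at hp
        rw [show s + 2 * D = (s + D - t) + (D + t) by omega, Function.iterate_add_apply,
          hp.iterate]
        exact hp
      · right
        rw [← key] at hp
        exact hle.trans_lt (hp.trans_le (M.iterate_outputs_length_mono L c (by omega)))

end Run

/-- The program contains no oracle questions. -/
def NoQuery (l : List Instr) : Prop := ∀ d, Instr.query d ∉ l

theorem noQuery_append {l₁ l₂ : List Instr} : NoQuery (l₁ ++ l₂) ↔ NoQuery l₁ ∧ NoQuery l₂ := by
  simp only [NoQuery, List.mem_append, not_or, forall_and]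

theorem noQuery_loopCode {x d pc : ℕ} {l : List Instr} (h : NoQuery l) :
    NoQuery (loopCode x d pc l) := by
  intro e
  simp [loopCode, h e]

theorem Op.noQuery (o : Op) (d a b : ℕ) : NoQuery [o.instr d a b] := by
  cases o <;> simp [NoQuery, Op.instr]

theorem Exp.noQuery (M₀ : ℕ) (e : Exp) : ∀ pc d, NoQuery (e.compile M₀ pc d) := by
  induction e with
  | var x => simp [NoQuery, compile]
  | const k => simp [NoQuery, compile]
  | bin o a b iha ihb =>
    intro pc d
    simp only [compile, noQuery_append]
    exact ⟨iha _ _, ihb _ _, o.noQuery _ _ _⟩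
  | get a ih =>
    intro pc d
    simp only [compile, noQuery_append]
    exact ⟨ih _ _, by simp [NoQuery]⟩
  | sum x a b iha ihb =>
    intro pc d
    simp only [compile, noQuery_append]
    exact ⟨iha _ _, by simp [NoQuery],
      noQuery_loopCode (noQuery_append.2 ⟨ihb _ _, by simp [NoQuery]⟩), by simp [NoQuery]⟩

theorem Cmd.noQuery (M₀ : ℕ) (C : Cmd) : ∀ pc d, NoQuery (C.compile M₀ pc d) := by
  induction C with
  | store a e =>
    intro pc d
    simp only [compile, noQuery_append]
    exact ⟨a.noQuery _ _ _, e.noQuery _ _ _, by simp [NoQuery]⟩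
  | loop x e C ih =>
    intro pc d
    simp only [compile, noQuery_append]
    exact ⟨e.noQuery _ _ _, noQuery_loopCode (ih _ _)⟩
  | seq C D ihC ihD =>
    intro pc d
    simp only [compile, noQuery_append]
    exact ⟨ihC _ _, ihD _ _⟩
  | bind x e C ih =>
    intro pc d
    simp only [compile, noQuery_append]
    exact ⟨e.noQuery _ _ _, by simp [NoQuery], ih _ _, by simp [NoQuery]⟩
  | write e =>
    intro pc d
    simp only [compile, noQuery_append]
    exact ⟨e.noQuery _ _ _, by simp [NoQuery]⟩

/-! ### Packing the low input registers into one number -/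

/-- Shift the first `l` bits of `x` into the binary representation of `v`. -/
def pack (x : List Bool) : ℕ → ℕ → ℕ
  | 0, v => v
  | l + 1, v => pack x l (2 * v + (x.getD l false).toNat)

/-- Intermediate values of the packing never exceed the final one, so a bound for the latter covers
the whole run of `packCode`. -/
theorem le_pack (x : List Bool) (l : ℕ) : ∀ v, v ≤ pack x l v := by
  induction l with
  | zero => exact fun v => le_rfl
  | succ l ih => exact fun v => (by omega : v ≤ 2 * v + _).trans (ih _)

/-- The packed bits are shifted in below `v`, which survives as the high part. With the input length
as `v`, one division recovers the length. -/
theorem pack_div (x : List Bool) (l : ℕ) : ∀ v, pack x l v / 2 ^ l = v := by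
  induction l with
  | zero => intro v; simp [pack]
  | succ l ih =>
    intro v
    rw [pack, pow_succ, ← Nat.div_div_eq_div_mul, ih]
    have := Bool.toNat_lt (x.getD l false)
    omega

theorem pack_bit (x : List Bool) {j l : ℕ} (h : j < l) :
    ∀ v, pack x l v / 2 ^ j % 2 = (x.getD j false).toNat := by
  induction l with
  | zero => omega
  | succ l ih =>
    intro v
    rw [pack]
    rcases Nat.lt_succ_iff_lt_or_eq.1 h with h | rfl
    · exact ih h _
    · rw [pack_div]
      have := Bool.toNat_lt (x.getD j false)
      omega

theorem pack_lt (x : List Bool) (l v : ℕ) : pack x l v < 2 ^ l * (v + 1) := by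
  have h := pack_div x l v
  rw [mul_comm]
  exact (Nat.div_lt_iff_lt_mul (by positivity)).1 (by rw [h]; exact Nat.lt_succ_self v)

/-- Code that packs registers `1, …, l` into register `0`. -/
def packCode : ℕ → List Instr
  | 0 => []
  | l + 1 => [.add 0 0 0, .add 0 0 (l + 1)] ++ packCode l

theorem packCode_length (l : ℕ) : (packCode l).length = 2 * l := by
  induction l with
  | zero => rfl
  | succ l ih => simp [packCode, ih]; omega

theorem noQuery_packCode (l : ℕ) : NoQuery (packCode l) := by
  induction l with
  | zero => simp [NoQuery, packCode]
  | succ l ih =>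
    rw [packCode, noQuery_append]
    exact ⟨by simp [NoQuery], ih⟩

theorem packCode_correct {M : Program} {L : Set (List Bool)} {B : ℕ} (x : List Bool) (l : ℕ) :
    ∀ {v : ℕ} {c : Config}, CodeAt M c.pc (packCode l) → c.reg 0 = v →
      (∀ j < l, c.reg (j + 1) = (x.getD j false).toNat) → pack x l v ≤ B → c.Bounded B →
      ∃ c', Steps M L B (2 * l) c c' ∧ c'.pc = c.pc + 2 * l ∧ c'.reg 0 = pack x l v ∧
        Frame (· ≠ 0) c c' := by
  induction l with
  | zero =>
    intro v c _ hv _ _ hc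
    exact ⟨c, Steps.refl hc, rfl, hv, Frame.refl⟩
  | succ l ih =>
    intro v c hM hv hx hB hc
    simp only [packCode, codeAt_append, codeAt_cons] at hM
    obtain ⟨⟨h₁, h₂, -⟩, h₃⟩ := hM
    have hle : 2 * v + (x.getD l false).toNat ≤ B := (le_pack x l _).trans hB
    have hs₁ : Steps M L B 1 c (c.set 0 (2 * v)) :=
      Steps.set h₁ hc (by simp only [Instr.exec, hv]; rw [two_mul]) (by omega)
    have hs₂ : Steps M L B 1 (c.set 0 (2 * v))
        ((c.set 0 (2 * v)).set 0 (2 * v + (x.getD l false).toNat)) :=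
      Steps.set h₂ hs₁.bounded_right
        (by simp only [Instr.exec, Config.set_reg, if_true]
            rw [if_neg (by omega), hx l (by omega)]) hle
    obtain ⟨c₃, hs₃, hp₃, hv₃, hf₃⟩ := ih
      (c := (c.set 0 (2 * v)).set 0 (2 * v + (x.getD l false).toNat)) h₃
      (by simp [Config.set_reg])
      (fun j hj => by
        rw [Config.set_reg, if_neg (by omega), Config.set_reg, if_neg (by omega), hx j (by omega)])
      hB hs₂.bounded_right
    refine ⟨c₃, (hs₁.trans (hs₂.trans hs₃)).mono (by omega), ?_, hv₃,
      ((Frame.refl.set (by simp)).set (by simp)).trans hf₃ (fun r h => h) fun r h => h⟩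
    rw [hp₃, Config.set_pc, Config.set_pc]; omega

/-- The bits of the input that are stored from register `M₀` on. -/
def inputMem (M₀ : ℕ) (x : List Bool) : Mem := fun a => x.getD (M₀ - 1 + a) false

/-! ### The machine that iterates a loop program -/

section Enum

variable (nv M₀ : ℕ) (init test body : Cmd) (flag : Exp)

/-- Pack the low registers, run `init`, and then, as long as `flag ≠ 0` after running `test`, output
the word written by `body`. -/
def enumProgram : Program :=
  let pre := packCode (M₀ - 1) ++ [.const 1 (2 ^ (M₀ - 1)), .div 1 0 1]
  let i := init.compile M₀ pre.length nv
  let h := pre.length + i.length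
  let t := test.compile M₀ h nv
  let f := flag.compile M₀ (h + t.length) nv
  let b := body.compile M₀ (h + t.length + f.length + 1) nv
  pre ++ (i ++ (t ++ (f ++ ([.jumpZero nv (h + t.length + f.length + 1 + b.length + 2)] ++
    (b ++ [.output, .jump h])))))

theorem noQuery_enumProgram : NoQuery (enumProgram nv M₀ init test body flag) := by
  simp only [enumProgram, noQuery_append]
  exact ⟨⟨noQuery_packCode _, by simp [NoQuery]⟩, init.noQuery _ _ _, test.noQuery _ _ _,
    flag.noQuery _ _ _, by simp [NoQuery], body.noQuery _ _ _, by simp [NoQuery]⟩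

/-- Covers the initial segment as well as one full pass through the main loop. The constant pays for
packing and control instructions, and `.X` for the numbers present at the start. -/
noncomputable def enumCost : Polynomial ℕ :=
  init.cost M₀ + test.cost M₀ + flag.cost M₀ + body.cost M₀ + (2 * M₀ + 10 : ℕ) + .X

/-- The enumerating machine asks nothing, so any language in `PTime` will do as oracle; a single
instruction rejects every word. -/
theorem empty_mem_PTime : (∅ : Set (List Bool)) ∈ PTime := by
  refine ⟨[.const 0 0], .X + 1, fun x => ?_⟩
  have hstep : ∀ t, Program.run [.const 0 0] ∅ x (t + 1) = (Config.init x).set 0 0 := by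
    intro t
    rw [Program.run, Function.iterate_succ_apply]
    exact Program.Halted.iterate (by simp [Program.Halted, Program.step, Instr.exec, Config.init]) t
  have hsize : ∀ {v b : ℕ}, v ≤ b → v.size ≤ b := fun h =>
    Nat.size_le.2 (h.trans_lt Nat.lt_two_pow_self)
  have hinit : ∀ r, (Config.init x).reg r ≤ x.length + 1 := by
    intro r
    cases r with
    | zero => exact Nat.le_succ _
    | succ i => exact (Bool.toNat_le _).trans (Nat.le_add_left _ _)
  simp only [Polynomial.eval_add, Polynomial.eval_X, Polynomial.eval_one]
  refine ⟨?_, ?_, ?_⟩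
  · rw [hstep]
    simp [Program.Halted, Config.init]
  · intro t r
    refine hsize ?_
    cases t with
    | zero => exact hinit r
    | succ t =>
      rw [hstep, Config.set_reg]
      split_ifs
      · exact Nat.zero_le _
      · exact hinit r
  · rw [hstep]
    simp [Config.set_reg]

variable {nv M₀ init test body flag}

/-- The number `r` in `Inv r m out` counts the outputs still to come and drives the induction that
proves termination. One run of `test`, `flag` and `body` lies between consecutive outputs, always
from variables bounded by `K = 2 ^ M₀ * (|x| + 1)`, so its cost is polynomial in `|x|`. -/
theorem mem_DelP_of_loop {E : EnumProblem} (hnv : 2 ≤ nv) (hM₀ : nv < M₀)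
    (hvars : init.vars ≤ nv ∧ test.vars ≤ nv ∧ body.vars ≤ nv ∧ flag.vars ≤ nv)
    (hneed : nv + init.need ≤ M₀ ∧ nv + test.need ≤ M₀ ∧ nv + body.need ≤ M₀ ∧ nv + flag.need ≤ M₀)
    (hspec : ∀ (x : List Bool) (ρ : Env), ρ 0 = pack x (M₀ - 1) x.length → ρ 1 = x.length →
      ∃ Inv : ℕ → Mem → List (List Bool) → Prop,
        init.emit ρ (inputMem M₀ x) = [] ∧
        (∃ r, Inv r (init.run ρ (inputMem M₀ x)) []) ∧
        ∀ r m out, Inv r m out → test.emit ρ m = [] ∧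
          (r = 0 → flag.eval ρ (test.run ρ m) = 0 ∧ out.Nodup ∧ {y | y ∈ out} = E x) ∧
          ∀ r', r = r' + 1 → flag.eval ρ (test.run ρ m) ≠ 0 ∧
            Inv r' (body.run ρ (test.run ρ m)) (out ++ [body.emit ρ (test.run ρ m)])) :
    E ∈ DelP := by
  refine ⟨∅, empty_mem_PTime, enumProgram nv M₀ init test body flag,
    2 * (enumCost M₀ init test body flag).comp ((2 ^ M₀ : ℕ) * (.X + 1)), fun x => ?_⟩
  have hcode := codeAt_self (enumProgram nv M₀ init test body flag)
  have hnq := noQuery_enumProgram nv M₀ init test body flag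
  obtain ⟨M, hMdef⟩ : ∃ M, M = enumProgram nv M₀ init test body flag := ⟨_, rfl⟩
  rw [← hMdef] at hnq ⊢
  replace hcode : CodeAt M 0 (enumProgram nv M₀ init test body flag) := by
    conv => arg 1; rw [hMdef]
    exact hcode
  simp only [Polynomial.eval_mul, Polynomial.eval_comp, Polynomial.eval_ofNat,
    Polynomial.eval_natCast, Polynomial.eval_add, Polynomial.eval_X, Polynomial.eval_one,
    Nat.cast_id]
  set K := 2 ^ M₀ * (x.length + 1) with hK
  set D := (enumCost M₀ init test body flag).eval K with hD
  have hDK : (init.cost M₀).eval K + (test.cost M₀).eval K + (flag.cost M₀).eval K +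
      (body.cost M₀).eval K + (2 * M₀ + 10) + K = D := by
    simp only [hD, enumCost, Polynomial.eval_add, Polynomial.eval_natCast, Polynomial.eval_X,
      Nat.cast_id]
  set p : ℕ := (packCode (M₀ - 1) ++ [Instr.const 1 (2 ^ (M₀ - 1)), Instr.div 1 0 1]).length with hp
  set h := p + (init.compile M₀ p nv).length with hh
  set f := h + (test.compile M₀ h nv).length with hf
  set b := f + (flag.compile M₀ f nv).length + 1 with hb
  set e := b + (body.compile M₀ b nv).length with he
  have hlen : M.length = e + 2 := by
    simp only [hMdef, enumProgram, List.length_append, List.length_cons, List.length_nil, ← hp,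
      ← hh, ← hf, ← hb]
    simp only [he, hb, hf, hh, hp, List.length_append, List.length_cons, List.length_nil]
    omega
  simp only [enumProgram] at hcode
  rw [codeAt_append, codeAt_append, codeAt_append, codeAt_append, codeAt_append, codeAt_append,
    codeAt_append, zero_add] at hcode
  simp only [← hp, ← hh, ← hf, ← hb, List.length_cons, List.length_nil, zero_add, ← he,
    codeAt_cons] at hcode
  obtain ⟨⟨hc₁, hc₂, hc₃, -⟩, hci, hct, hcf, ⟨hcz, -⟩, hcb, hco, hcj, -⟩ := hcode
  -- the initial segment
  have h2 : 2 ^ (M₀ - 1) * (x.length + 1) ≤ K :=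
    Nat.mul_le_mul_right _ (Nat.pow_le_pow_right (by norm_num) (by omega))
  have h2' : 2 ^ (M₀ - 1) ≤ K := (Nat.le_mul_of_pos_right _ (by omega)).trans h2
  have hxK : x.length + 1 ≤ K := (Nat.le_mul_of_pos_left _ (by positivity)).trans h2
  have hKD : K ≤ D := by omega
  have hpackK : pack x (M₀ - 1) x.length ≤ K := (pack_lt _ _ _).le.trans h2
  have hinitK : (Config.init x).Bounded K := by
    intro r
    cases r with
    | zero => exact (Nat.le_succ _).trans hxK
    | succ i => exact (Bool.toNat_le _).trans ((Nat.le_add_left _ _).trans hxK)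
  obtain ⟨c₁, hs₁, hp₁, hv₁, hf₁⟩ := packCode_correct (L := ∅) (B := D) x (M₀ - 1)
    (c := Config.init x) hc₁ rfl (fun j hj => rfl) (hpackK.trans hKD)
    (fun r => (hinitK r).trans hKD)
  have hp₁' : c₁.pc = (packCode (M₀ - 1)).length := by
    rw [hp₁, packCode_length]; simp [Config.init]
  rw [← hp₁'] at hc₂ hc₃
  have hs₂ : Steps M ∅ D 1 c₁ (c₁.set 1 (2 ^ (M₀ - 1))) :=
    Steps.set hc₂ hs₁.bounded_right rfl (h2'.trans hKD)
  have hs₃ : Steps M ∅ D 1 (c₁.set 1 (2 ^ (M₀ - 1)))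
      ((c₁.set 1 (2 ^ (M₀ - 1))).set 1 x.length) :=
    Steps.set hc₃ hs₂.bounded_right
      (by simp only [Instr.exec, Config.set_reg, if_true]
          rw [if_neg (by omega), hv₁, pack_div]; rfl) (by omega)
  set c₃ := (c₁.set 1 (2 ^ (M₀ - 1))).set 1 x.length with hc₃def
  have hr₃ : ∀ r, c₃.reg r = if r = 1 then x.length else c₁.reg r := by
    intro r
    simp only [hc₃def, Config.set_reg]
    split_ifs <;> rfl
  have hp₃ : c₃.pc = p := by
    rw [hc₃def, Config.set_pc, Config.set_pc, hp₁']
    simp [hp]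
  have hf₃ : ∀ r, 2 ≤ r → c₃.reg r = (Config.init x).reg r := by
    intro r hr
    rw [hr₃, if_neg (by omega), hf₁.reg r (by omega)]
  have hb₃ : c₃.Bounded K := by
    intro r
    rcases Nat.lt_or_ge r 2 with hr | hr
    · interval_cases r
      · rw [hr₃, if_neg (by omega), hv₁]; exact hpackK
      · rw [hr₃, if_pos rfl]; omega
    · rw [hf₃ r hr]; exact hinitK r
  have hmem₃ : ∀ a, c₃.reg (M₀ + a) = (inputMem M₀ x a).toNat := by
    intro a
    rw [hf₃ _ (by omega), show M₀ + a = (M₀ - 1 + a) + 1 by omega]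
    rfl
  -- Variables from `2` on may still contain input bits; therefore the specification is demanded for
  -- every environment with the right values at `0` and `1`.
  set ρ : Env := fun r => c₃.reg r with hρ
  obtain ⟨Inv, hie, ⟨r₀, hr₀⟩, hstep⟩ := hspec x ρ (by simp only [hρ, hr₃]; rw [if_neg (by omega), hv₁]; rfl)
    (by simp only [hρ, hr₃, if_true])
  rw [← hp₃] at hci
  obtain ⟨c₄, hs₄, hd₄⟩ := init.compile_correct (ρ := ρ) (K := K) hci hvars.1 le_rfl hneed.1
    (fun r _ => rfl) hb₃ hmem₃ (by omega) hs₃.bounded_right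
  -- the loop
  have hhalt : ∀ c : Config, c.pc = e + 2 → M.Halted c := by
    intro c hc
    rw [Program.Halted, List.getElem?_eq_none_iff, hlen, hc]
  have hfrom : ∀ r (c : Config) m out, Inv r m out → c.pc = h → (∀ y < nv, c.reg y = ρ y) →
      (∀ a, c.reg (M₀ + a) = (m a).toNat) → c.word = [] → c.outputs = out → c.Bounded D →
      Enumerating M ∅ D D (fun out => out.Nodup ∧ {y | y ∈ out} = E x) c ∧ Prompt M ∅ D c := by
    intro r
    induction r with
    | zero =>
      intro c m out hI hpc hr hm hw ho hB
      obtain ⟨hte, h0, -⟩ := hstep 0 m out hI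
      obtain ⟨hfl, hout⟩ := h0 rfl
      rw [← hpc] at hct
      obtain ⟨c₅, hs₅, hd₅⟩ := test.compile_correct (L := ∅) (ρ := ρ) (K := K) hct hvars.2.1 le_rfl
        hneed.2.1 hr hb₃ hm (by omega) hB
      have hp₅ : c₅.pc = f := by rw [hd₅.pc, hpc]
      rw [← hp₅] at hcf hcz
      obtain ⟨c₆, hs₆, hp₆, he₆, hf₆⟩ := flag.compile_correct (L := ∅) (ρ := ρ) (K := K) hcf
        hvars.2.2.2 le_rfl hneed.2.2.2 (fun y hy => by rw [hd₅.reg y hy, hr y hy]) hb₃ hd₅.mem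
        (by omega) hs₅.bounded_right
      rw [← hp₆] at hcz
      have hs₇ := Steps.single (L := ∅) hcz hs₆.bounded_right hs₆.bounded_right
      have hs := ((hs₅.trans hs₆).trans hs₇).mono (t₂ := D) (by omega)
      have hh' := hhalt (Instr.exec ∅ c₆ (.jumpZero nv (e + 2)))
        (by simp [Instr.exec, he₆, hfl])
      refine ⟨hs.enumerating_of_halted hh' ?_, hs.prompt_of_halted hh'⟩
      have : (Instr.exec ∅ c₆ (.jumpZero nv (e + 2))).outputs = out :=
        hf₆.outputs.trans (hd₅.outputs.trans ho)
      rw [this]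
      exact hout
    | succ r ih =>
      intro c m out hI hpc hr hm hw ho hB
      obtain ⟨hte, -, h1⟩ := hstep (r + 1) m out hI
      obtain ⟨hfl, hI'⟩ := h1 r rfl
      rw [← hpc] at hct
      obtain ⟨c₅, hs₅, hd₅⟩ := test.compile_correct (L := ∅) (ρ := ρ) (K := K) hct hvars.2.1 le_rfl
        hneed.2.1 hr hb₃ hm (by omega) hB
      have hp₅ : c₅.pc = f := by rw [hd₅.pc, hpc]
      have hcf' := hcf
      rw [← hp₅] at hcf'
      obtain ⟨c₆, hs₆, hp₆, he₆, hf₆⟩ := flag.compile_correct (L := ∅) (ρ := ρ) (K := K) hcf'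
        hvars.2.2.2 le_rfl hneed.2.2.2 (fun y hy => by rw [hd₅.reg y hy, hr y hy]) hb₃ hd₅.mem
        (by omega) hs₅.bounded_right
      have hcz' : M[c₆.pc]? = some (.jumpZero nv (e + 2)) := by rw [hp₆, hp₅]; exact hcz
      have hs₇ := Steps.single (L := ∅) hcz' hs₆.bounded_right hs₆.bounded_right
      set c₇ := Instr.exec ∅ c₆ (.jumpZero nv (e + 2)) with hc₇
      have hp₇ : c₇.pc = b := by simp [hc₇, Instr.exec, he₆, hfl, hp₆, hp₅, hb]
      rw [← hp₇] at hcb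
      obtain ⟨c₈, hs₈, hd₈⟩ := body.compile_correct (L := ∅) (ρ := ρ) (K := K)
        (m := test.run ρ m) hcb hvars.2.2.1 le_rfl hneed.2.2.1
        (fun y hy => by
          rw [show c₇.reg y = c₆.reg y from rfl, hf₆.reg y (.inl hy), hd₅.reg y hy, hr y hy])
        hb₃
        (fun a => by
          rw [show c₇.reg (M₀ + a) = c₆.reg (M₀ + a) from rfl, hf₆.reg _ (.inr (by omega)),
            hd₅.mem]) (by omega) hs₇.bounded_right
      have hp₈ : c₈.pc = e := by rw [hd₈.pc, hp₇]
      rw [← hp₈] at hco hcj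
      have hs₉ := Steps.single (L := ∅) hco hs₈.bounded_right hs₈.bounded_right
      set c₉ := Instr.exec ∅ c₈ .output with hc₉
      have hs₁₀ := Steps.single (L := ∅) (c := c₉) hcj hs₉.bounded_right hs₉.bounded_right
      set c₁₀ := Instr.exec ∅ c₉ (.jump h) with hc₁₀
      have hs := (hs₅.trans (hs₆.trans (hs₇.trans (hs₈.trans (hs₉.trans hs₁₀))))).mono (t₂ := D)
        (by omega)
      have hw₈ : c₈.word = body.emit ρ (test.run ρ m) := by
        rw [hd₈.word, show c₇.word = c₆.word from rfl, hf₆.word, hd₅.word, hw, hte]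
        rfl
      have ho₈ : c₈.outputs = out := by
        rw [hd₈.outputs, show c₇.outputs = c₆.outputs from rfl, hf₆.outputs, hd₅.outputs, ho]
      have ho₁₀ : c₁₀.outputs = out ++ [body.emit ρ (test.run ρ m)] := by
        rw [show c₁₀.outputs = c₈.outputs ++ [c₈.word] from rfl, hw₈, ho₈]
      obtain ⟨hE, hP⟩ := ih c₁₀ _ _ hI' rfl
        (fun y hy => by
          rw [show c₁₀.reg y = c₈.reg y from rfl, hd₈.reg y hy,
            show c₇.reg y = c₆.reg y from rfl, hf₆.reg y (.inl hy), hd₅.reg y hy, hr y hy])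
        hd₈.mem rfl ho₁₀ hs.bounded_right
      exact ⟨hs.enumerating hE hP, hs.prompt_of_lt (by rw [ho₁₀, ho]; simp)⟩
  have hs := (hs₁.trans (hs₂.trans (hs₃.trans hs₄))).mono (t₂ := D) (by omega)
  obtain ⟨hE, hP⟩ := hfrom r₀ c₄ _ _ hr₀ (by rw [hd₄.pc, hp₃])
    (fun y hy => by rw [hd₄.reg y hy]) hd₄.mem
    (by rw [hd₄.word, hie, List.append_nil]; exact hf₁.word)
    (by rw [hd₄.outputs]; exact hf₁.outputs) hs.bounded_right
  have hE₀ := hs.enumerating hE hP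
  refine ⟨hE₀.halt, hE₀.delay, fun t r => ?_, fun t d hq => ?_⟩
  -- The bit length of a number is at most its value, so the bound on values is more than enough.
  · exact Nat.size_le.2 (((hE₀.bounded t r).trans (by omega : D ≤ 2 * D)).trans_lt
      Nat.lt_two_pow_self)
  · exact absurd (List.mem_of_getElem? hq) (hnq d)

end Enum

end TeamEnum

namespace TeamEnum

/-! ### Inclusion logic in terms of local conditions on families of teams -/

/-- The number of subformula occurrences. -/
def Formula.size {σ : Vocabulary} : Formula σ → ℕ
  | .eq _ _ => 1
  | .neq _ _ => 1
  | .rel _ _ => 1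
  | .nrel _ _ => 1
  | .incl _ _ => 1
  | .and φ ψ => 1 + φ.size + ψ.size
  | .or φ ψ => 1 + φ.size + ψ.size
  | .ex _ φ => 1 + φ.size
  | .all _ φ => 1 + φ.size

theorem Formula.size_pos {σ : Vocabulary} (φ : Formula σ) : 0 < φ.size := by
  cases φ <;> simp only [size] <;> omega

/-- A strict upper bound for the variables that occur. -/
def Formula.bound {σ : Vocabulary} : Formula σ → ℕ
  | .eq x y => max (x + 1) (y + 1)
  | .neq x y => max (x + 1) (y + 1)
  | .rel _ xs => Finset.univ.sup fun i => xs i + 1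
  | .nrel _ xs => Finset.univ.sup fun i => xs i + 1
  | .incl xs ys => max (Finset.univ.sup fun i => xs i + 1) (Finset.univ.sup fun i => ys i + 1)
  | .and φ ψ => max φ.bound ψ.bound
  | .or φ ψ => max φ.bound ψ.bound
  | .ex x φ => max (x + 1) φ.bound
  | .all x φ => max (x + 1) φ.bound

theorem Formula.lt_bound_of_mem_free {σ : Vocabulary} {φ : Formula σ} :
    ∀ {v : ℕ}, v ∈ φ.free → v < φ.bound := by
  have key : ∀ {m : ℕ} (xs : Fin m → ℕ) (i : Fin m),
      xs i < Finset.univ.sup fun i => xs i + 1 := fun xs i =>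
    Nat.lt_of_succ_le (Finset.le_sup (f := fun i => xs i + 1) (Finset.mem_univ i))
  induction φ with
  | eq x y => intro v hv; simp [free, bound] at hv ⊢; omega
  | neq x y => intro v hv; simp [free, bound] at hv ⊢; omega
  | rel i xs =>
    intro v hv
    obtain ⟨j, -, rfl⟩ := Finset.mem_image.1 hv
    exact key xs j
  | nrel i xs =>
    intro v hv
    obtain ⟨j, -, rfl⟩ := Finset.mem_image.1 hv
    exact key xs j
  | incl xs ys =>
    intro v hv
    rcases Finset.mem_union.1 hv with hv | hv
    · obtain ⟨j, -, rfl⟩ := Finset.mem_image.1 hv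
      exact lt_max_of_lt_left (key xs j)
    · obtain ⟨j, -, rfl⟩ := Finset.mem_image.1 hv
      exact lt_max_of_lt_right (key ys j)
  | and φ ψ ih₁ ih₂ =>
    intro v hv
    exact (Finset.mem_union.1 hv).elim (fun h => lt_max_of_lt_left (ih₁ h))
      fun h => lt_max_of_lt_right (ih₂ h)
  | or φ ψ ih₁ ih₂ =>
    intro v hv
    exact (Finset.mem_union.1 hv).elim (fun h => lt_max_of_lt_left (ih₁ h))
      fun h => lt_max_of_lt_right (ih₂ h)
  | ex x φ ih => exact fun hv => lt_max_of_lt_right (ih (Finset.mem_of_mem_erase hv))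
  | all x φ ih => exact fun hv => lt_max_of_lt_right (ih (Finset.mem_of_mem_erase hv))

section Conds

variable {σ : Vocabulary} {A : Type}

/-- For every subformula occurrence, the team at which it is evaluated. -/
abbrev Family (A : Type) : Type := ℕ → Set (Assignment A)

/-- A condition on the members of one team of a family. -/
abbrev NodeCond (A : Type) : Type := ℕ × (Family A → Assignment A → Prop)

/-- Local conditions on a family of teams, expressing that they witness the truth of a formula whose
subformula occurrences are numbered from `o` on: `(j, P)` requires `P` of all members of team
`j`. -/
def conds (I : Interp σ A) : Formula σ → ℕ → List (NodeCond A)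
  | .eq x y, o => [(o, fun _ s => s x = s y)]
  | .neq x y, o => [(o, fun _ s => s x ≠ s y)]
  | .rel i xs, o => [(o, fun _ s => s.MemRel xs (I i))]
  | .nrel i xs, o => [(o, fun _ s => ¬ s.MemRel xs (I i))]
  | .incl xs ys, o => [(o, fun W s => ∃ t ∈ W o, ∀ i, s (xs i) = t (ys i))]
  | .and φ ψ, o =>
    ([(o, fun W s => s ∈ W (o + 1) ∧ s ∈ W (o + 1 + φ.size)), (o + 1, fun W s => s ∈ W o),
      (o + 1 + φ.size, fun W s => s ∈ W o)] : List (NodeCond A)) ++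
      (conds I φ (o + 1) ++ conds I ψ (o + 1 + φ.size))
  | .or φ ψ, o =>
    ([(o, fun W s => s ∈ W (o + 1) ∨ s ∈ W (o + 1 + φ.size)), (o + 1, fun W s => s ∈ W o),
      (o + 1 + φ.size, fun W s => s ∈ W o)] : List (NodeCond A)) ++
      (conds I φ (o + 1) ++ conds I ψ (o + 1 + φ.size))
  | .ex x φ, o =>
    ([(o, fun W s => ∃ a, s.supplement x a ∈ W (o + 1)),
      (o + 1, fun W t => ∃ s ∈ W o, ∃ a, t = s.supplement x a)] : List (NodeCond A)) ++
      conds I φ (o + 1)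
  | .all x φ, o =>
    ([(o, fun W s => ∀ a, s.supplement x a ∈ W (o + 1)),
      (o + 1, fun W t => ∃ s ∈ W o, ∃ a, t = s.supplement x a)] : List (NodeCond A)) ++
      conds I φ (o + 1)

/-- All local conditions hold. -/
def Con (I : Interp σ A) (φ : Formula σ) (o : ℕ) (W : Family A) : Prop :=
  ∀ f ∈ conds I φ o, ∀ s ∈ W f.1, f.2 W s

/-- Teams occur only positively in the conditions. This reflects the closure of inclusion logic
under unions, and it is the reason why an assignment of an admissible family is never deleted from a
larger one. -/
theorem conds_mono (I : Interp σ A) (φ : Formula σ) {W W' : Family A} (h : ∀ j, W j ⊆ W' j) :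
    ∀ o, ∀ f ∈ conds I φ o, ∀ s, f.2 W s → f.2 W' s := by
  induction φ with
  | eq | neq | rel | nrel => intro o f hf s hs; simp [conds] at hf; subst hf; exact hs
  | incl xs ys =>
    intro o f hf s hs
    simp only [conds, List.mem_singleton] at hf
    subst hf
    exact hs.imp fun t ht => ⟨h _ ht.1, ht.2⟩
  | and φ ψ ih₁ ih₂ =>
    intro o f hf s
    simp only [conds, List.mem_append, List.mem_cons, List.not_mem_nil, or_false] at hf
    rcases hf with (rfl | rfl | rfl) | hf | hf
    · exact And.imp (fun a => h _ a) fun a => h _ a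
    · exact fun a => h _ a
    · exact fun a => h _ a
    · exact ih₁ _ f hf s
    · exact ih₂ _ f hf s
  | or φ ψ ih₁ ih₂ =>
    intro o f hf s
    simp only [conds, List.mem_append, List.mem_cons, List.not_mem_nil, or_false] at hf
    rcases hf with (rfl | rfl | rfl) | hf | hf
    · exact Or.imp (fun a => h _ a) fun a => h _ a
    · exact fun a => h _ a
    · exact fun a => h _ a
    · exact ih₁ _ f hf s
    · exact ih₂ _ f hf s
  | ex x φ ih =>
    intro o f hf s
    simp only [conds, List.mem_append, List.mem_cons, List.not_mem_nil, or_false] at hf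
    rcases hf with (rfl | rfl) | hf
    · exact Exists.imp fun _ a => h _ a
    · exact Exists.imp fun _ => And.imp (fun a => h _ a) id
    · exact ih _ f hf s
  | all x φ ih =>
    intro o f hf s
    simp only [conds, List.mem_append, List.mem_cons, List.not_mem_nil, or_false] at hf
    rcases hf with (rfl | rfl) | hf
    · exact fun a b => h _ (a b)
    · exact Exists.imp fun _ => And.imp (fun a => h _ a) id
    · exact ih _ f hf s

/-- The conditions for a formula read only the teams of its own block of numbers. Families for
different subformulas can therefore be glued, and teams outside the block can be altered freely. -/
theorem conds_local (I : Interp σ A) (φ : Formula σ) : ∀ o, ∀ f ∈ conds I φ o,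
    (o ≤ f.1 ∧ f.1 < o + φ.size) ∧ ∀ W W' : Family A,
      (∀ j, o ≤ j → j < o + φ.size → W j = W' j) → ∀ s, f.2 W s → f.2 W' s := by
  induction φ with
  | eq | neq | rel | nrel =>
    intro o f hf
    simp [conds] at hf
    subst hf
    exact ⟨⟨le_rfl, Nat.lt_succ_self o⟩, fun _ _ _ s hs => hs⟩
  | incl xs ys =>
    intro o f hf
    simp only [conds, List.mem_singleton] at hf
    subst hf
    exact ⟨⟨le_rfl, Nat.lt_succ_self o⟩, fun W W' h s hs => by
      dsimp only at hs ⊢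
      rwa [h o le_rfl (Nat.lt_succ_self o)] at hs⟩
  | and φ ψ ih₁ ih₂ =>
    intro o f hf
    have := φ.size_pos
    have := ψ.size_pos
    simp only [conds, List.mem_append, List.mem_cons, List.not_mem_nil, or_false] at hf
    simp only [Formula.size]
    rcases hf with (rfl | rfl | rfl) | hf | hf
    · exact ⟨by constructor <;> dsimp only <;> omega, fun W W' h s hs => by
        dsimp only at hs ⊢
        rwa [h (o + 1) (by omega) (by omega), h (o + 1 + φ.size) (by omega) (by omega)] at hs⟩
    · exact ⟨by constructor <;> dsimp only <;> omega, fun W W' h s hs => by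
        dsimp only at hs ⊢
        rwa [h o (by omega) (by omega)] at hs⟩
    · exact ⟨by constructor <;> dsimp only <;> omega, fun W W' h s hs => by
        dsimp only at hs ⊢
        rwa [h o (by omega) (by omega)] at hs⟩
    · obtain ⟨h₁, h₂⟩ := ih₁ _ f hf
      exact ⟨by omega, fun W W' h => h₂ W W' fun j h h' => by apply_assumption <;> omega⟩
    · obtain ⟨h₁, h₂⟩ := ih₂ _ f hf
      exact ⟨by omega, fun W W' h => h₂ W W' fun j h h' => by apply_assumption <;> omega⟩
  | or φ ψ ih₁ ih₂ =>
    intro o f hf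
    have := φ.size_pos
    have := ψ.size_pos
    simp only [conds, List.mem_append, List.mem_cons, List.not_mem_nil, or_false] at hf
    simp only [Formula.size]
    rcases hf with (rfl | rfl | rfl) | hf | hf
    · exact ⟨by constructor <;> dsimp only <;> omega, fun W W' h s hs => by
        dsimp only at hs ⊢
        rwa [h (o + 1) (by omega) (by omega), h (o + 1 + φ.size) (by omega) (by omega)] at hs⟩
    · exact ⟨by constructor <;> dsimp only <;> omega, fun W W' h s hs => by
        dsimp only at hs ⊢
        rwa [h o (by omega) (by omega)] at hs⟩
    · exact ⟨by constructor <;> dsimp only <;> omega, fun W W' h s hs => by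
        dsimp only at hs ⊢
        rwa [h o (by omega) (by omega)] at hs⟩
    · obtain ⟨h₁, h₂⟩ := ih₁ _ f hf
      exact ⟨by omega, fun W W' h => h₂ W W' fun j h h' => by apply_assumption <;> omega⟩
    · obtain ⟨h₁, h₂⟩ := ih₂ _ f hf
      exact ⟨by omega, fun W W' h => h₂ W W' fun j h h' => by apply_assumption <;> omega⟩
  | ex x φ ih | all x φ ih =>
    intro o f hf
    have := φ.size_pos
    simp only [conds, List.mem_append, List.mem_cons, List.not_mem_nil, or_false] at hf
    simp only [Formula.size]
    rcases hf with (rfl | rfl) | hf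
    · exact ⟨by constructor <;> dsimp only <;> omega, fun W W' h s hs => by
        dsimp only at hs ⊢
        rwa [h (o + 1) (by omega) (by omega)] at hs⟩
    · exact ⟨by constructor <;> dsimp only <;> omega, fun W W' h s hs => by
        dsimp only at hs ⊢
        rwa [h o (by omega) (by omega)] at hs⟩
    · obtain ⟨h₁, h₂⟩ := ih _ f hf
      exact ⟨by omega, fun W W' h => h₂ W W' fun j h h' => by apply_assumption <;> omega⟩

theorem Con.congr {I : Interp σ A} {φ : Formula σ} {o : ℕ} {W W' : Family A} (hW : Con I φ o W)
    (h : ∀ j, o ≤ j → j < o + φ.size → W j = W' j) : Con I φ o W' := by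
  intro f hf s hs
  obtain ⟨⟨h₁, h₂⟩, h₃⟩ := conds_local I φ o f hf
  exact h₃ W W' h s (hW f hf s (by rwa [h _ h₁ h₂]))

theorem con_cons {l l' : List (NodeCond A)} {W : Family A} :
    (∀ f ∈ l ++ l', ∀ s ∈ W f.1, f.2 W s) ↔
      (∀ f ∈ l, ∀ s ∈ W f.1, f.2 W s) ∧ ∀ f ∈ l', ∀ s ∈ W f.1, f.2 W s := by
  simp only [List.mem_append, or_imp, forall_and]

/-- A choice function for a lax existential quantifier can be read off from the two teams: allow
every value that leads into `Y`. -/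
theorem supplementTeam_eq {X Y : Set (Assignment A)} {x : ℕ}
    (h : ∀ t ∈ Y, ∃ s ∈ X, ∃ a, t = s.supplement x a) :
    supplementTeam X x (fun s => {a | s.supplement x a ∈ Y}) = Y := by
  ext t
  constructor
  · rintro ⟨s, _, a, ha, rfl⟩
    exact ha
  · intro ht
    obtain ⟨s, hs, a, rfl⟩ := h t ht
    exact ⟨s, hs, a, ht, rfl⟩

/-- The conditions at a node amount to the semantic clause: equal teams for a conjunction, a cover
by subteams for a disjunction, and for a quantifier that the lower team is a supplement of the upper
one. -/
theorem Con.sat {I : Interp σ A} {φ : Formula σ} :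
    ∀ {o : ℕ} {W : Family A}, Con I φ o W → Sat I φ (W o) := by
  induction φ with
  | eq | neq | rel | nrel | incl =>
    intro o W h
    exact h _ (List.mem_singleton.2 rfl)
  | and φ ψ ih₁ ih₂ =>
    intro o W h
    simp only [Con, conds, con_cons, List.forall_mem_cons] at h
    obtain ⟨⟨h₁, h₂, h₃, -⟩, hφ, hψ⟩ := h
    have e₁ : W (o + 1) = W o := Set.Subset.antisymm h₂ fun s hs => (h₁ s hs).1
    have e₂ : W (o + 1 + φ.size) = W o := Set.Subset.antisymm h₃ fun s hs => (h₁ s hs).2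
    exact ⟨e₁ ▸ ih₁ hφ, e₂ ▸ ih₂ hψ⟩
  | or φ ψ ih₁ ih₂ =>
    intro o W h
    simp only [Con, conds, con_cons, List.forall_mem_cons] at h
    obtain ⟨⟨h₁, h₂, h₃, -⟩, hφ, hψ⟩ := h
    exact ⟨_, _, h₂, h₃, Set.Subset.antisymm (Set.union_subset h₂ h₃) h₁, ih₁ hφ, ih₂ hψ⟩
  | ex x φ ih =>
    intro o W h
    simp only [Con, conds, con_cons, List.forall_mem_cons] at h
    obtain ⟨⟨h₁, h₂, -⟩, hφ⟩ := h
    refine ⟨fun s => {a | s.supplement x a ∈ W (o + 1)}, h₁, ?_⟩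
    rw [supplementTeam_eq h₂]
    exact ih hφ
  | all x φ ih =>
    intro o W h
    simp only [Con, conds, con_cons, List.forall_mem_cons] at h
    obtain ⟨⟨h₁, h₂, -⟩, hφ⟩ := h
    have e : supplementTeam (W o) x (fun _ => Set.univ) = W (o + 1) := by
      refine Set.Subset.antisymm ?_ fun t ht => ?_
      · rintro t ⟨s, hs, a, -, rfl⟩
        exact h₁ s hs a
      · obtain ⟨s, hs, a, rfl⟩ := h₂ t ht
        exact ⟨s, hs, a, trivial, rfl⟩
    rw [Sat, e]
    exact ih hφ

/-- The domain of `s` is contained in `{0, …, k - 1}`. -/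
def Assignment.Below (k : ℕ) (s : Assignment A) : Prop := ∀ v, k ≤ v → s v = none

theorem Assignment.Below.supplement {k x : ℕ} {s : Assignment A} (h : s.Below k) (hx : x < k)
    (a : A) : (s.supplement x a).Below k := by
  intro v hv
  rw [Assignment.supplement, Function.update_of_ne (by omega)]
  exact h v hv

theorem supplementTeam_below {k x : ℕ} {X : Set (Assignment A)} (h : ∀ s ∈ X, s.Below k)
    (hx : x < k) (F : Assignment A → Set A) : ∀ s ∈ supplementTeam X x F, s.Below k := by
  rintro _ ⟨s, hs, a, -, rfl⟩
  exact (h s hs).supplement hx a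

theorem exists_family_unary {I : Interp σ A} {φ : Formula σ} {o k : ℕ} {X Y : Set (Assignment A)}
    (hX : ∀ s ∈ X, s.Below k)
    (h : ∃ W : Family A, W (o + 1) = Y ∧ (∀ j, ∀ s ∈ W j, s.Below k) ∧ Con I φ (o + 1) W) :
    ∃ W : Family A, W o = X ∧ W (o + 1) = Y ∧ (∀ j, ∀ s ∈ W j, s.Below k) ∧
      Con I φ (o + 1) W := by
  obtain ⟨W, hY, hb, hc⟩ := h
  refine ⟨fun j => if j = o then X else W j, if_pos rfl, ?_, fun j => ?_, hc.congr fun j hj _ => ?_⟩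
  · simp [hY]
  · dsimp only
    split_ifs
    exacts [hX, hb j]
  · rw [if_neg (by omega)]

/-- The two families matter on disjoint blocks of numbers, so they can be cut at `o + 1 + φ.size`
and joined. -/
theorem exists_family_binary {I : Interp σ A} {φ ψ : Formula σ} {o k : ℕ}
    {X Y Z : Set (Assignment A)} (hX : ∀ s ∈ X, s.Below k)
    (h : ∃ W : Family A, W (o + 1) = Y ∧ (∀ j, ∀ s ∈ W j, s.Below k) ∧ Con I φ (o + 1) W)
    (h' : ∃ W : Family A, W (o + 1 + φ.size) = Z ∧ (∀ j, ∀ s ∈ W j, s.Below k) ∧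
      Con I ψ (o + 1 + φ.size) W) :
    ∃ W : Family A, W o = X ∧ W (o + 1) = Y ∧ W (o + 1 + φ.size) = Z ∧
      (∀ j, ∀ s ∈ W j, s.Below k) ∧ Con I φ (o + 1) W ∧ Con I ψ (o + 1 + φ.size) W := by
  obtain ⟨W, hY, hb, hc⟩ := h
  obtain ⟨W', hZ, hb', hc'⟩ := h'
  have := φ.size_pos
  refine ⟨fun j => if j = o then X else if j < o + 1 + φ.size then W j else W' j, if_pos rfl,
    ?_, ?_, fun j => ?_, hc.congr fun j hj hj' => ?_, hc'.congr fun j hj _ => ?_⟩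
  · simp [hY, this]
  · dsimp only
    rw [if_neg (by omega), if_neg (by omega), hZ]
  · dsimp only
    split_ifs
    exacts [hX, hb j, hb' j]
  · rw [if_neg (by omega), if_pos hj']
  · rw [if_neg (by omega), if_neg (by omega)]

/-- Conversely, the teams met while evaluating a true formula form an admissible family. The bound
`k` is carried along because only assignments below `k` have codes and can be stored. -/
theorem exists_con_of_sat {I : Interp σ A} {k : ℕ} {φ : Formula σ} :
    ∀ {o : ℕ} {X : Set (Assignment A)}, φ.bound ≤ k → (∀ s ∈ X, s.Below k) → Sat I φ X →
      ∃ W : Family A, W o = X ∧ (∀ j, ∀ s ∈ W j, s.Below k) ∧ Con I φ o W := by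
  induction φ with
  | eq | neq | rel | nrel | incl =>
    intro o X _ hX h
    exact ⟨fun _ => X, rfl, fun _ => hX, List.forall_mem_singleton.2 h⟩
  | and φ ψ ih₁ ih₂ =>
    intro o X hk hX h
    simp only [Formula.bound, max_le_iff] at hk
    obtain ⟨W, h₀, h₁, h₂, hb, hc₁, hc₂⟩ :=
      exists_family_binary hX (ih₁ (o := o + 1) hk.1 hX h.1) (ih₂ hk.2 hX h.2)
    refine ⟨W, h₀, hb, ?_⟩
    simp only [Con, conds, con_cons, List.forall_mem_cons, h₀, h₁, h₂]
    exact ⟨⟨fun s hs => ⟨hs, hs⟩, fun s hs => hs, fun s hs => hs, by simp⟩, hc₁, hc₂⟩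
  | or φ ψ ih₁ ih₂ =>
    intro o X hk hX h
    simp only [Formula.bound, max_le_iff] at hk
    obtain ⟨Y, Z, hY, hZ, rfl, hs₁, hs₂⟩ := h
    obtain ⟨W, h₀, h₁, h₂, hb, hc₁, hc₂⟩ := exists_family_binary hX
      (ih₁ (o := o + 1) hk.1 (fun s hs => hX s (hY hs)) hs₁)
      (ih₂ hk.2 (fun s hs => hX s (hZ hs)) hs₂)
    refine ⟨W, h₀, hb, ?_⟩
    simp only [Con, conds, con_cons, List.forall_mem_cons, h₀, h₁, h₂]
    exact ⟨⟨fun s hs => hs, fun s hs => hY hs, fun s hs => hZ hs, by simp⟩, hc₁, hc₂⟩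
  | ex x φ ih =>
    intro o X hk hX h
    simp only [Formula.bound, max_le_iff] at hk
    obtain ⟨F, hF, hs⟩ := h
    obtain ⟨W, h₀, h₁, hb, hc⟩ := exists_family_unary hX
      (ih (o := o + 1) hk.2 (supplementTeam_below hX hk.1 F) hs)
    refine ⟨W, h₀, hb, ?_⟩
    simp only [Con, conds, con_cons, List.forall_mem_cons, h₀, h₁]
    refine ⟨⟨fun s hs => ?_, ?_, by simp⟩, hc⟩
    · obtain ⟨a, ha⟩ := hF s hs
      exact ⟨a, s, hs, a, ha, rfl⟩
    · rintro _ ⟨s, hs, a, -, rfl⟩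
      exact ⟨s, hs, a, rfl⟩
  | all x φ ih =>
    intro o X hk hX h
    simp only [Formula.bound, max_le_iff] at hk
    obtain ⟨W, h₀, h₁, hb, hc⟩ := exists_family_unary hX
      (ih (o := o + 1) hk.2 (supplementTeam_below hX hk.1 _) h)
    refine ⟨W, h₀, hb, ?_⟩
    simp only [Con, conds, con_cons, List.forall_mem_cons, h₀, h₁]
    refine ⟨⟨fun s hs a => ⟨s, hs, a, trivial, rfl⟩, ?_, by simp⟩, hc⟩
    rintro _ ⟨s, hs, a, -, rfl⟩
    exact ⟨s, hs, a, rfl⟩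

end Conds

end TeamEnum

namespace TeamEnum

/-! ### Expressions for truth values -/

namespace Exp

instance : Add Exp := ⟨bin .add⟩
instance : Sub Exp := ⟨bin .sub⟩
instance : Mul Exp := ⟨bin .mul⟩
instance : Div Exp := ⟨bin .div⟩

/-- The truth value of an expression. -/
def Tr (e : Exp) (ρ : Env) (m : Mem) : Prop := e.eval ρ m ≠ 0

def modE (a b : Exp) : Exp := a - a / b * b
def powE (a : Exp) : ℕ → Exp
  | 0 => const 1
  | v + 1 => powE a v * a
def sumL : List Exp → Exp
  | [] => const 0
  | e :: l => e + sumL l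

/-- Every nonzero value counts as true, so sums act as disjunctions and existential quantifiers, and
truncated subtraction from `1` is negation. -/
def notE (a : Exp) : Exp := const 1 - a
def andE (a b : Exp) : Exp := a * b
def orE (a b : Exp) : Exp := a + b
def impE (a b : Exp) : Exp := orE (notE a) b
def eqE (a b : Exp) : Exp := notE (a - b + (b - a))
def ltE (a b : Exp) : Exp := b - a
def exE (x : ℕ) (b e : Exp) : Exp := sum x b e
def allE (x : ℕ) (b e : Exp) : Exp := notE (exE x b (notE e))
def allL : List Exp → Exp
  | [] => const 1
  | e :: l => andE e (allL l)

section

variable (a b : Exp) (l : List Exp) (x k : ℕ) (ρ : Env) (m : Mem)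

@[simp] theorem eval_var : (var x).eval ρ m = ρ x := rfl
@[simp] theorem eval_const : (const k).eval ρ m = k := rfl
@[simp] theorem eval_add : (a + b).eval ρ m = a.eval ρ m + b.eval ρ m := rfl
@[simp] theorem eval_sub : (a - b).eval ρ m = a.eval ρ m - b.eval ρ m := rfl
@[simp] theorem eval_mul : (a * b).eval ρ m = a.eval ρ m * b.eval ρ m := rfl
@[simp] theorem eval_div : (a / b).eval ρ m = a.eval ρ m / b.eval ρ m := rfl
@[simp] theorem eval_get : (get a).eval ρ m = (m (a.eval ρ m)).toNat := rfl

theorem eval_sum : (sum x a b).eval ρ m =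
    ∑ i ∈ Finset.range (a.eval ρ m), b.eval (Function.update ρ x i) m := rfl

@[simp] theorem eval_modE : (modE a b).eval ρ m = a.eval ρ m % b.eval ρ m := by
  simp only [modE, eval_sub, eval_mul, eval_div]
  rw [mul_comm, Nat.mod_eq_sub_mul_div]

@[simp] theorem eval_powE : (powE a k).eval ρ m = a.eval ρ m ^ k := by
  induction k with
  | zero => rfl
  | succ k ih => rw [powE, eval_mul, ih, pow_succ]

@[simp] theorem eval_sumL : (sumL l).eval ρ m = (l.map fun e => e.eval ρ m).sum := by
  induction l with
  | nil => rfl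
  | cons e l ih => rw [sumL, eval_add, ih, List.map_cons, List.sum_cons]

@[simp] theorem tr_get : (get a).Tr ρ m ↔ m (a.eval ρ m) = true := by
  simp [Tr]

@[simp] theorem tr_const : (const k).Tr ρ m ↔ k ≠ 0 := Iff.rfl

@[simp] theorem tr_notE : (notE a).Tr ρ m ↔ ¬ a.Tr ρ m := by
  simp only [Tr, notE, eval_sub, eval_const]
  omega

@[simp] theorem tr_andE : (andE a b).Tr ρ m ↔ a.Tr ρ m ∧ b.Tr ρ m := by
  simp [Tr, andE]

@[simp] theorem tr_orE : (orE a b).Tr ρ m ↔ a.Tr ρ m ∨ b.Tr ρ m := by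
  simp only [Tr, orE, eval_add]
  omega

@[simp] theorem tr_impE : (impE a b).Tr ρ m ↔ (a.Tr ρ m → b.Tr ρ m) := by
  rw [impE, tr_orE, tr_notE, imp_iff_not_or]

@[simp] theorem tr_eqE : (eqE a b).Tr ρ m ↔ a.eval ρ m = b.eval ρ m := by
  simp only [Tr, eqE, notE, eval_sub, eval_add, eval_const]
  omega

@[simp] theorem tr_ltE : (ltE a b).Tr ρ m ↔ a.eval ρ m < b.eval ρ m := by
  simp only [Tr, ltE, eval_sub]
  omega

@[simp] theorem tr_exE :
    (exE x a b).Tr ρ m ↔ ∃ i < a.eval ρ m, b.Tr (Function.update ρ x i) m := by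
  simp [Tr, exE, eval]

@[simp] theorem tr_allE :
    (allE x a b).Tr ρ m ↔ ∀ i < a.eval ρ m, b.Tr (Function.update ρ x i) m := by
  simp [allE]

@[simp] theorem tr_allL : (allL l).Tr ρ m ↔ ∀ e ∈ l, e.Tr ρ m := by
  induction l with
  | nil => simp [allL]
  | cons e l ih => simp [allL, ih]

end

end Exp

/-! ### Partial assignments as numbers -/

/-- The digit of `s` with index `v`, in base `n + 1`. -/
def dig (n v s : ℕ) : ℕ := s / (n + 1) ^ v % (n + 1)

theorem dig_le (n v s : ℕ) : dig n v s ≤ n := Nat.lt_succ_iff.1 (Nat.mod_lt _ n.succ_pos)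

/-- The assignment with code `s`: the variable `v < k` has the value `d - 1`, where `d` is the digit
with index `v`, and is outside of the domain if `d = 0`. -/
def dec (n k s : ℕ) : Assignment (Fin n) := fun v =>
  if h : v < k ∧ dig n v s ≠ 0 then some ⟨dig n v s - 1, by have := dig_le n v s; omega⟩ else none

section dec

variable {n k s t v w x : ℕ}

theorem dec_below : (dec n k s).Below k := fun v hv => dif_neg (by omega)

theorem dec_eq_some (hv : v < k) {a : Fin n} : dec n k s v = some a ↔ dig n v s = a + 1 := by
  unfold dec
  split_ifs with h
  · rw [Option.some_inj, Fin.ext_iff]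
    dsimp only
    omega
  · simp only [false_iff]
    omega

theorem dec_eq_none (hv : v < k) : dec n k s v = none ↔ dig n v s = 0 := by
  unfold dec
  split_ifs with h <;> simp <;> omega

theorem dec_eq_dec (hv : v < k) (hw : w < k) :
    dec n k s v = dec n k t w ↔ dig n v s = dig n w t := by
  rcases h : dec n k t w with - | a
  · rw [dec_eq_none hv, (dec_eq_none hw).1 h]
  · rw [dec_eq_some hv, (dec_eq_some hw).1 h]

theorem dec_ext {s' : Assignment (Fin n)} (hs' : s'.Below k) :
    dec n k s = s' ↔ ∀ v < k, dec n k s v = s' v := by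
  refine ⟨fun h v _ => h ▸ rfl, fun h => funext fun v => ?_⟩
  rcases Nat.lt_or_ge v k with hv | hv
  · exact h v hv
  · rw [dec_below v hv, hs' v hv]

/-- Digit `0` is reserved for "undefined". Thus base `n + 1` codes all partial assignments on `k`
variables, and the domains of the teams of subformulas need not be tracked. -/
theorem exists_dec_eq {s' : Assignment (Fin n)} (hs' : s'.Below k) :
    ∃ s < (n + 1) ^ k, dec n k s = s' := by
  let f : Fin k → Fin (n + 1) := fun v => (s' v).elim 0 Fin.succ
  refine ⟨finFunctionFinEquiv f, (finFunctionFinEquiv f).2, (dec_ext hs').2 fun v hv => ?_⟩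
  have hd : dig n v (finFunctionFinEquiv f) = f ⟨v, hv⟩ := by
    have := congrFun (finFunctionFinEquiv.symm_apply_apply f) ⟨v, hv⟩
    rw [Fin.ext_iff, finFunctionFinEquiv_symm_apply_val] at this
    exact this
  rcases h : s' v with - | a
  · rw [dec_eq_none hv, hd]
    simp [f, h]
  · rw [dec_eq_some hv, hd]
    simp [f, h]

theorem dec_injOn (hs : s < (n + 1) ^ k) (ht : t < (n + 1) ^ k) (h : dec n k s = dec n k t) :
    s = t := by
  have : (⟨s, hs⟩ : Fin ((n + 1) ^ k)) = ⟨t, ht⟩ := by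
    apply finFunctionFinEquiv.symm.injective
    funext v
    rw [Fin.ext_iff, finFunctionFinEquiv_symm_apply_val, finFunctionFinEquiv_symm_apply_val]
    exact (dec_eq_dec v.2 v.2).1 (congrFun h v)
  simpa using this

/-- In terms of codes, `s(a/x)` is a comparison of `k` digits, which a fixed expression can carry
out. -/
theorem dec_eq_supplement (hx : x < k) {a : Fin n} :
    dec n k t = (dec n k s).supplement x a ↔
      (∀ v < k, v ≠ x → dig n v s = dig n v t) ∧ dig n x t = a + 1 := by
  rw [dec_ext (dec_below.supplement hx a)]
  constructor
  · intro h
    refine ⟨fun v hv hvx => ?_, ?_⟩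
    · have := h v hv
      rw [Assignment.supplement, Function.update_of_ne hvx, dec_eq_dec hv hv] at this
      exact this.symm
    · have := h x hx
      rwa [Assignment.supplement, Function.update_self, dec_eq_some hx] at this
  · rintro ⟨h, h'⟩ v hv
    by_cases hvx : v = x
    · subst hvx
      rw [Assignment.supplement, Function.update_self, dec_eq_some hv, h']
    · rw [Assignment.supplement, Function.update_of_ne hvx, dec_eq_dec hv hv, h v hv hvx]

end dec

/-! ### The local conditions as expressions -/

/-- The address of the bit for the assignment with code `s` in team `o`. -/
def wAddr (L N S o s : ℕ) : ℕ := L + L + 1 + N + N + o * S + s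

/-- Variable numbers: `1` is the input length `L`, `2` the universe size `n`, `3` the number `S` of
codes of assignments, `4` the number `N` of values of the free variables. -/
abbrev xE (i : Exp) : Exp := .get (.var 1 + i)
-- Memory layout from address `L` on: the input, the flag at `2L`, the solution `V` output last and
-- the word `U` under construction with `N` bits each, and then the teams with `S` bits each. The
-- addresses below `L` hold the part of the input that the machine left in place.
abbrev flagA : Exp := .var 1 + .var 1
abbrev vA (c : Exp) : Exp := .var 1 + .var 1 + .const 1 + c
abbrev uA (c : Exp) : Exp := .var 1 + .var 1 + .const 1 + .var 4 + c
abbrev wA (o : ℕ) (s : Exp) : Exp :=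
  .var 1 + .var 1 + .const 1 + .var 4 + .var 4 + .const o * .var 3 + s
abbrev wE (o : ℕ) (s : Exp) : Exp := .get (wA o s)

def digE (v : ℕ) (s : Exp) : Exp :=
  .modE (s / .powE (.var 2 + .const 1) v) (.var 2 + .const 1)

theorem eval_digE (v : ℕ) (s : Exp) (ρ : Env) (m : Mem) :
    (digE v s).eval ρ m = dig (ρ 2) v (s.eval ρ m) := by
  simp [digE, dig]

open Exp

def sameE (k x : ℕ) (s t : Exp) : Exp :=
  allL (((List.range k).filter (· ≠ x)).map fun v => eqE (digE v s) (digE v t))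

/-- The offset of the characteristic word of the relation `i`. -/
def relOffset (σ : Vocabulary) (n : ℕ) (i : ℕ) : ℕ :=
  (((List.finRange σ.numRel).take i).map fun j => n ^ σ.arity j).sum

def relOffsetE (σ : Vocabulary) (i : ℕ) : Exp :=
  sumL (((List.finRange σ.numRel).take i).map fun j => powE (.var 2) (σ.arity j))

theorem eval_relOffsetE (σ : Vocabulary) (i : ℕ) (ρ : Env) (m : Mem) :
    (relOffsetE σ i).eval ρ m = relOffset σ (ρ 2) i := by
  simp [relOffsetE, relOffset, Function.comp_def]

/-- A digit exceeds the value it codes by one, hence the `- 1` and the demand that all digits be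
nonzero. The address skips the prefix `1ⁿ0` and the preceding relations. -/
def relE {σ : Vocabulary} (i : Fin σ.numRel) (xs : Fin (σ.arity i) → ℕ) : Exp :=
  andE (allL ((List.finRange _).map fun l => digE (xs l) (.var 7)))
    (xE (.var 2 + .const 1 + relOffsetE σ i +
      sumL ((List.finRange _).map fun l => (digE (xs l) (.var 7) - .const 1) * powE (.var 2) l)))

/-- Expressions for the local conditions on the assignment whose code is variable `7`. -/
def condExps {σ : Vocabulary} (k : ℕ) : Formula σ → ℕ → List (ℕ × Exp)
  | .eq x y, o => [(o, eqE (digE x (.var 7)) (digE y (.var 7)))]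
  | .neq x y, o => [(o, notE (eqE (digE x (.var 7)) (digE y (.var 7))))]
  | .rel i xs, o => [(o, relE i xs)]
  | .nrel i xs, o => [(o, notE (relE i xs))]
  | .incl xs ys, o =>
    [(o, exE 8 (.var 3) (andE (wE o (.var 8)) (allL ((List.finRange _).map fun i =>
      eqE (digE (xs i) (.var 7)) (digE (ys i) (.var 8))))))]
  | .and φ ψ, o =>
    [(o, andE (wE (o + 1) (.var 7)) (wE (o + 1 + φ.size) (.var 7))), (o + 1, wE o (.var 7)),
      (o + 1 + φ.size, wE o (.var 7))] ++
      (condExps k φ (o + 1) ++ condExps k ψ (o + 1 + φ.size))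
  | .or φ ψ, o =>
    [(o, orE (wE (o + 1) (.var 7)) (wE (o + 1 + φ.size) (.var 7))), (o + 1, wE o (.var 7)),
      (o + 1 + φ.size, wE o (.var 7))] ++
      (condExps k φ (o + 1) ++ condExps k ψ (o + 1 + φ.size))
  | .ex x φ, o =>
    [(o, exE 8 (.var 3) (andE (wE (o + 1) (.var 8))
        (andE (sameE k x (.var 7) (.var 8)) (digE x (.var 8))))),
      (o + 1, andE (digE x (.var 7)) (exE 8 (.var 3) (andE (wE o (.var 8))
        (sameE k x (.var 8) (.var 7)))))] ++ condExps k φ (o + 1)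
  | .all x φ, o =>
    [(o, allE 9 (.var 2) (exE 8 (.var 3) (andE (wE (o + 1) (.var 8))
        (andE (sameE k x (.var 7) (.var 8)) (eqE (digE x (.var 8)) (.var 9 + .const 1)))))),
      (o + 1, andE (digE x (.var 7)) (exE 8 (.var 3) (andE (wE o (.var 8))
        (sameE k x (.var 8) (.var 7)))))] ++ condExps k φ (o + 1)

/-- The variables `1`, …, `4` have the values they stand for. -/
structure Dims (n k L N : ℕ) (ρ : Env) : Prop where
  len : ρ 1 = L
  size : ρ 2 = n
  codes : ρ 3 = (n + 1) ^ k
  values : ρ 4 = N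

theorem Dims.update {n k L N : ℕ} {ρ : Env} (h : Dims n k L N ρ) {x i : ℕ} (hx : 5 ≤ x) :
    Dims n k L N (Function.update ρ x i) := by
  constructor
  · rw [Function.update_of_ne (by omega), h.len]
  · rw [Function.update_of_ne (by omega), h.size]
  · rw [Function.update_of_ne (by omega), h.codes]
  · rw [Function.update_of_ne (by omega), h.values]

/-- The position, in the input, of the bit for a tuple in a relation. -/
def relPos (σ : Vocabulary) (n : ℕ) (i : Fin σ.numRel) (a : Fin (σ.arity i) → Fin n) : ℕ :=
  n + 1 + relOffset σ n i + ∑ l : Fin (σ.arity i), (a l : ℕ) * n ^ (l : ℕ)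

/-- The variables and the input part of the memory describe the structure `I` over `Fin n`. -/
structure Describes {σ : Vocabulary} {n : ℕ} (I : Interp σ (Fin n)) (k L N : ℕ) (ρ : Env)
    (m : Mem) : Prop extends Dims n k L N ρ where
  rel_lt : ∀ i a, relPos σ n i a < L
  rel : ∀ i a, a ∈ I i ↔ m (L + relPos σ n i a) = true

theorem Describes.congr {σ : Vocabulary} {n k L N : ℕ} {I : Interp σ (Fin n)} {ρ ρ' : Env}
    {m m' : Mem} (h : Describes I k L N ρ m) (hρ : Dims n k L N ρ')
    (hm : ∀ i < L, m' (L + i) = m (L + i)) : Describes I k L N ρ' m' :=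
  ⟨hρ, h.rel_lt, fun i a => by rw [h.rel, hm _ (h.rel_lt i a)]⟩

/-- The teams that are stored in the memory. -/
def teams (n k L N : ℕ) (m : Mem) : Family (Fin n) := fun o =>
  {a | ∃ s < (n + 1) ^ k, m (wAddr L N ((n + 1) ^ k) o s) = true ∧ dec n k s = a}

theorem dec_mem_teams {n k L N o s : ℕ} {m : Mem} (hs : s < (n + 1) ^ k) :
    dec n k s ∈ teams n k L N m o ↔ m (wAddr L N ((n + 1) ^ k) o s) = true := by
  constructor
  · rintro ⟨t, ht, h, hst⟩
    rwa [← dec_injOn ht hs hst]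
  · exact fun h => ⟨s, hs, h, rfl⟩

section Spec

variable {σ : Vocabulary} {n k L N : ℕ} {I : Interp σ (Fin n)} {ρ : Env} {m : Mem}

theorem Describes.tr_wE (h : Describes I k L N ρ m) {o x : ℕ} (hx : ρ x < (n + 1) ^ k) :
    (wE o (.var x)).Tr ρ m ↔ dec n k (ρ x) ∈ teams n k L N m o := by
  rw [dec_mem_teams hx]
  simp [wAddr, h.len, h.codes, h.values]

theorem Describes.update (h : Describes I k L N ρ m) {x i : ℕ} (hx : 5 ≤ x) :
    Describes I k L N (Function.update ρ x i) m :=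
  h.congr (h.toDims.update hx) fun _ _ => rfl

theorem Describes.tr_digE (h : Describes I k L N ρ m) {v x : ℕ} :
    (digE v (.var x)).Tr ρ m ↔ dig n v (ρ x) ≠ 0 := by
  rw [Exp.Tr, eval_digE, h.size]; rfl

theorem Describes.tr_sameE (h : Describes I k L N ρ m) {x y z : ℕ} :
    (sameE k x (.var y) (.var z)).Tr ρ m ↔ ∀ v < k, v ≠ x → dig n v (ρ y) = dig n v (ρ z) := by
  simp only [sameE, tr_allL, List.forall_mem_map, List.mem_filter, List.mem_range, ne_eq,
    decide_not, Bool.not_eq_true', decide_eq_false_iff_not, and_imp, tr_eqE, eval_digE, h.size,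
    eval_var]

theorem Describes.tr_relE (h : Describes I k L N ρ m) {i : Fin σ.numRel}
    {xs : Fin (σ.arity i) → ℕ} (hk : ∀ l, xs l < k) :
    (relE i xs).Tr ρ m ↔ (dec n k (ρ 7)).MemRel xs (I i) := by
  simp only [relE, tr_andE, tr_allL, List.mem_map, List.mem_finRange, true_and,
    forall_exists_index, forall_apply_eq_imp_iff, h.tr_digE, tr_get, eval_add, eval_var, h.len,
    h.size, eval_const, eval_relOffsetE, eval_sumL, List.map_map, Function.comp_def, eval_mul,
    eval_sub, eval_digE, eval_powE]
  have key : ∀ a : Fin (σ.arity i) → Fin n, (∀ l, dig n (xs l) (ρ 7) = a l + 1) →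
      ((List.finRange (σ.arity i)).map fun l => (dig n (xs l) (ρ 7) - 1) * n ^ (l : ℕ)).sum =
        ∑ l, (a l : ℕ) * n ^ (l : ℕ) := by
    intro a ha
    rw [← List.ofFn_eq_map, List.sum_ofFn]
    exact Finset.sum_congr rfl fun l _ => by rw [ha l, Nat.add_sub_cancel]
  constructor
  · rintro ⟨h₁, h₂⟩
    have ha : ∀ l, dig n (xs l) (ρ 7) =
        ((⟨dig n (xs l) (ρ 7) - 1, by
          have := dig_le n (xs l) (ρ 7); have := h₁ l; omega⟩ : Fin n) : ℕ) + 1 := by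
      intro l
      have := h₁ l
      dsimp only
      omega
    rw [key _ ha] at h₂
    exact ⟨_, (h.rel i _).2 h₂, fun l => (dec_eq_some (hk l)).2 (ha l)⟩
  · rintro ⟨a, ha, h'⟩
    have hd := fun l => (dec_eq_some (hk l)).1 (h' l)
    refine ⟨fun l => by rw [hd]; omega, ?_⟩
    rw [key a hd]
    exact (h.rel i a).1 ha

theorem exists_supplement_mem_teams {o x s : ℕ} (hx : x < k) {a : Fin n} :
    (dec n k s).supplement x a ∈ teams n k L N m o ↔ ∃ t < (n + 1) ^ k,
      dec n k t ∈ teams n k L N m o ∧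
        (∀ v < k, v ≠ x → dig n v s = dig n v t) ∧ dig n x t = a + 1 := by
  constructor
  · rintro ⟨t, ht, hm, h⟩
    exact ⟨t, ht, ⟨t, ht, hm, rfl⟩, (dec_eq_supplement hx).1 h⟩
  · rintro ⟨t, ht, hm, h⟩
    rwa [← (dec_eq_supplement hx).2 h]

theorem exists_eq_supplement {o x t : ℕ} (hx : x < k) :
    (∃ s ∈ teams n k L N m o, ∃ a, dec n k t = s.supplement x a) ↔ dig n x t ≠ 0 ∧
      ∃ s < (n + 1) ^ k, dec n k s ∈ teams n k L N m o ∧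
        ∀ v < k, v ≠ x → dig n v s = dig n v t := by
  constructor
  · rintro ⟨_, ⟨s, hs, hm, rfl⟩, a, h⟩
    rw [dec_eq_supplement hx] at h
    exact ⟨by omega, s, hs, ⟨s, hs, hm, rfl⟩, h.1⟩
  · rintro ⟨h, s, hs, hm, h'⟩
    have := dig_le n x t
    refine ⟨_, hm, ⟨dig n x t - 1, by omega⟩, (dec_eq_supplement hx).2 ⟨h', ?_⟩⟩
    dsimp only
    omega

theorem Describes.tr_erase (h : Describes I k L N ρ m) {o x : ℕ} (hx : x < k) :
    (andE (digE x (.var 7)) (exE 8 (.var 3) (andE (wE o (.var 8))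
        (sameE k x (.var 8) (.var 7))))).Tr ρ m ↔
      ∃ s ∈ teams n k L N m o, ∃ a, dec n k (ρ 7) = s.supplement x a := by
  rw [exists_eq_supplement hx]
  simp only [tr_andE, tr_exE, eval_var, h.codes]
  refine and_congr h.tr_digE (exists_congr fun s => and_congr_right fun hs => and_congr ?_ ?_)
  · rw [(h.update (by omega)).tr_wE (by simpa using hs), Function.update_self]
  · rw [(h.update (by omega)).tr_sameE, Function.update_self, Function.update_of_ne (by omega)]

/-- Both lists arise by the same recursion, so they match entry by entry and facts about one pass to
the other. Quantification over members of a team becomes quantification over codes, which loses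
nothing because members of `teams` are decoded codes by definition. -/
theorem condExps_spec (φ : Formula σ) : ∀ o, φ.bound ≤ k →
    List.Forall₂ (fun (f : NodeCond (Fin n)) (g : ℕ × Exp) => f.1 = g.1 ∧ ∀ ρ m,
      Describes I k L N ρ m → ρ 7 < (n + 1) ^ k →
        (g.2.Tr ρ m ↔ f.2 (teams n k L N m) (dec n k (ρ 7))))
      (conds I φ o) (condExps k φ o) := by
  have hsup : ∀ {j : ℕ} {xs : Fin j → ℕ}, (Finset.univ.sup fun i => xs i + 1) ≤ k →
      ∀ l, xs l < k := fun h l =>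
    (Finset.le_sup (f := fun i => _ + 1) (Finset.mem_univ l)).trans h
  induction φ with
  | eq x y =>
    intro o hk
    simp only [Formula.bound, max_le_iff] at hk
    refine .cons ⟨rfl, fun ρ m h hs => ?_⟩ .nil
    simp only [tr_eqE, eval_digE, h.size, eval_var, dec_eq_dec hk.1 hk.2]
  | neq x y =>
    intro o hk
    simp only [Formula.bound, max_le_iff] at hk
    refine .cons ⟨rfl, fun ρ m h hs => ?_⟩ .nil
    simp only [tr_notE, tr_eqE, eval_digE, h.size, eval_var, ne_eq, dec_eq_dec hk.1 hk.2]
  | rel i xs =>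
    intro o hk
    exact .cons ⟨rfl, fun ρ m h hs => h.tr_relE (hsup hk)⟩ .nil
  | nrel i xs =>
    intro o hk
    exact .cons ⟨rfl, fun ρ m h hs => (tr_notE _ _ _).trans (not_congr (h.tr_relE (hsup hk)))⟩ .nil
  | incl xs ys =>
    intro o hk
    simp only [Formula.bound, max_le_iff] at hk
    refine .cons ⟨rfl, fun ρ m h hs => ?_⟩ .nil
    simp only [tr_exE, tr_andE, tr_allL, List.mem_map, List.mem_finRange, true_and,
      forall_exists_index, forall_apply_eq_imp_iff, tr_eqE, eval_digE, eval_var, h.codes]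
    constructor
    · rintro ⟨t, ht, hm, he⟩
      rw [(h.update (by omega)).tr_wE (by simpa using ht), Function.update_self] at hm
      refine ⟨_, hm, fun i => (dec_eq_dec (hsup hk.1 i) (hsup hk.2 i)).2 ?_⟩
      simpa [h.size] using he i
    · rintro ⟨_, ⟨t, ht, hm, rfl⟩, he⟩
      refine ⟨t, ht, ?_, fun i => ?_⟩
      · rw [(h.update (by omega)).tr_wE (by simpa using ht), Function.update_self]
        exact ⟨t, ht, hm, rfl⟩
      · simpa [h.size] using (dec_eq_dec (hsup hk.1 i) (hsup hk.2 i)).1 (he i)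
  | and φ ψ ih₁ ih₂ =>
    intro o hk
    simp only [Formula.bound, max_le_iff] at hk
    refine List.rel_append (.cons ⟨rfl, fun ρ m h hs => ?_⟩ (.cons ⟨rfl, fun ρ m h hs => ?_⟩
      (.cons ⟨rfl, fun ρ m h hs => ?_⟩ .nil))) (List.rel_append (ih₁ _ hk.1) (ih₂ _ hk.2))
    · rw [tr_andE, h.tr_wE hs, h.tr_wE hs]
    · exact h.tr_wE hs
    · exact h.tr_wE hs
  | or φ ψ ih₁ ih₂ =>
    intro o hk
    simp only [Formula.bound, max_le_iff] at hk
    refine List.rel_append (.cons ⟨rfl, fun ρ m h hs => ?_⟩ (.cons ⟨rfl, fun ρ m h hs => ?_⟩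
      (.cons ⟨rfl, fun ρ m h hs => ?_⟩ .nil))) (List.rel_append (ih₁ _ hk.1) (ih₂ _ hk.2))
    · rw [tr_orE, h.tr_wE hs, h.tr_wE hs]
    · exact h.tr_wE hs
    · exact h.tr_wE hs
  | ex x φ ih =>
    intro o hk
    simp only [Formula.bound, max_le_iff] at hk
    refine List.rel_append (.cons ⟨rfl, fun ρ m h hs => ?_⟩ (.cons ⟨rfl, fun ρ m h hs => ?_⟩
      .nil)) (ih _ hk.2)
    · simp only [exists_supplement_mem_teams (L := L) (N := N) (m := m) hk.1, tr_exE, tr_andE,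
        eval_var, h.codes]
      rw [exists_comm]
      refine exists_congr fun t => ?_
      constructor
      · rintro ⟨ht, h₁, h₂, h₃⟩
        have hu := h.update (x := 8) (i := t) (by omega)
        rw [hu.tr_wE (by simpa using ht), Function.update_self] at h₁
        rw [hu.tr_sameE, Function.update_self, Function.update_of_ne (by omega)] at h₂
        rw [hu.tr_digE, Function.update_self] at h₃
        have := dig_le n x t
        refine ⟨⟨dig n x t - 1, by omega⟩, ht, h₁, h₂, ?_⟩
        dsimp only
        omega
      · rintro ⟨a, ht, h₁, h₂, h₃⟩
        have hu := h.update (x := 8) (i := t) (by omega)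
        rw [hu.tr_wE (by simpa using ht), hu.tr_sameE, hu.tr_digE, Function.update_self,
          Function.update_of_ne (by omega)]
        exact ⟨ht, h₁, h₂, by omega⟩
    · exact h.tr_erase hk.1
  | all x φ ih =>
    intro o hk
    simp only [Formula.bound, max_le_iff] at hk
    refine List.rel_append (.cons ⟨rfl, fun ρ m h hs => ?_⟩ (.cons ⟨rfl, fun ρ m h hs => ?_⟩
      .nil)) (ih _ hk.2)
    · simp only [exists_supplement_mem_teams (L := L) (N := N) (m := m) hk.1, tr_exE, tr_andE,
        tr_allE, eval_var, h.size]
      rw [Fin.forall_iff]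
      refine forall_congr' fun a => forall_congr' fun ha => ?_
      rw [Function.update_of_ne (by omega), h.codes]
      refine exists_congr fun t => and_congr_right fun ht => ?_
      have hu := (h.update (x := 9) (i := a) (by omega)).update (x := 8) (i := t) (by omega)
      rw [hu.tr_wE (by simpa using ht), hu.tr_sameE, tr_eqE, eval_digE, hu.size]
      simp
    · exact h.tr_erase hk.1

end Spec

end TeamEnum

namespace TeamEnum

/-! ### Computing the largest family of teams that satisfies the local conditions -/

theorem iter_induction {α : Type*} {f : ℕ → α → α} {k : ℕ} {m : α} (P : ℕ → α → Prop) (h₀ : P 0 m)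
    (hs : ∀ i < k, ∀ m, P i m → P (i + 1) (f i m)) : P k (iter f k m) := by
  induction k with
  | zero => exact h₀
  | succ k ih =>
    exact hs k (Nat.lt_succ_self k) _ (ih fun i hi => hs i (hi.trans (Nat.lt_succ_self k)))

/-- All stores go to distinct addresses from `b` on, while the stored values depend only on the
memory below `b`. So the stores do not influence each other and act as one simultaneous assignment.
-/
theorem iter_store {b k : ℕ} {A : ℕ → ℕ} {f : ℕ → Mem → Bool} {g : ℕ → Bool} {m₀ : Mem}
    (hA : ∀ i < k, b ≤ A i) (hinj : ∀ i < k, ∀ j < k, A i = A j → i = j)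
    (hf : ∀ i < k, ∀ m : Mem, (∀ a < b, m a = m₀ a) → f i m = g i) :
    (∀ i < k, iter (fun i m => Function.update m (A i) (f i m)) k m₀ (A i) = g i) ∧
      ∀ a, (∀ i < k, a ≠ A i) → iter (fun i m => Function.update m (A i) (f i m)) k m₀ a = m₀ a := by
  induction k with
  | zero => exact ⟨fun i hi => absurd hi (Nat.not_lt_zero i), fun a _ => rfl⟩
  | succ k ih =>
    obtain ⟨ih₁, ih₂⟩ := ih (fun i hi => hA i (by omega))
      (fun i hi j hj => hinj i (by omega) j (by omega)) fun i hi => hf i (by omega)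
    refine ⟨fun i hi => ?_, fun a ha => ?_⟩
    · simp only [iter]
      by_cases hik : i = k
      · subst hik
        rw [Function.update_self]
        exact hf i hi _ fun a ha => ih₂ a fun j hj => by have := hA j (by omega); omega
      · rw [Function.update_of_ne fun h => hik (hinj i hi k (by omega) h)]
        exact ih₁ i (by omega)
    · simp only [iter]
      rw [Function.update_of_ne (ha k (by omega))]
      exact ih₂ a fun i hi => ha i (by omega)

/-- `F` only clears bits, it preserves `good` and the properties in `inv`, and its fixed points
satisfy `fix`. -/
structure Shrinking (good : Mem → Prop) (inv : Set (Mem → Prop)) (fix : Mem → Prop)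
    (F : Mem → Mem) : Prop where
  keeps : ∀ m, good m → good (F m)
  le : ∀ m, good m → ∀ a, F m a = true → m a = true
  keeps_inv : ∀ m, good m → ∀ P ∈ inv, P m → P (F m)
  fixed : ∀ m, good m → F m = m → fix m

namespace Shrinking

variable {good : Mem → Prop} {inv : Set (Mem → Prop)} {p q : Mem → Prop} {F G : Mem → Mem}

theorem id : Shrinking good inv (fun _ => True) id :=
  ⟨fun _ h => h, fun _ _ _ h => h, fun _ _ _ _ h => h, fun _ _ _ => trivial⟩

theorem mono (hF : Shrinking good inv p F) (h : ∀ m, p m → q m) : Shrinking good inv q F :=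
  ⟨hF.keeps, hF.le, hF.keeps_inv, fun m hm e => h m (hF.fixed m hm e)⟩

theorem comp (hF : Shrinking good inv p F) (hG : Shrinking good inv q G) :
    Shrinking good inv (fun m => p m ∧ q m) fun m => G (F m) := by
  refine ⟨fun m h => hG.keeps _ (hF.keeps m h), fun m h a ha => hF.le m h a (hG.le _ (hF.keeps m h) a ha),
    fun m h P hP hm => hG.keeps_inv _ (hF.keeps m h) P hP (hF.keeps_inv m h P hP hm), fun m h e => ?_⟩
  -- Both maps only clear bits. If the composite changes nothing, `F` has cleared nothing, since `G`
  -- could not have restored it.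
  have hFm : F m = m := by
    funext a
    refine Bool.eq_iff_iff.2 ⟨hF.le m h a, fun ha => hG.le _ (hF.keeps m h) a ?_⟩
    rw [show G (F m) = m from e, ha]
  refine ⟨hF.fixed m h hFm, hG.fixed m h ?_⟩
  rwa [hFm] at e

theorem iter {k : ℕ} {p : ℕ → Mem → Prop} {F : ℕ → Mem → Mem}
    (h : ∀ i < k, Shrinking good inv (p i) (F i)) :
    Shrinking good inv (fun m => ∀ i < k, p i m) (iter F k) := by
  induction k with
  | zero => exact id.mono fun m _ i hi => absurd hi (Nat.not_lt_zero i)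
  | succ k ih =>
    refine (comp (ih fun i hi => h i (by omega)) (h k (by omega))).mono fun m hm i hi => ?_
    rcases Nat.lt_succ_iff_lt_or_eq.1 hi with hi | rfl
    · exact hm.1 i hi
    · exact hm.2

/-- Iterating a shrinking operation on a region as often as the region has bits yields a fixed
point. -/
theorem iterate_fixed {lo hi K : ℕ} {m₀ m : Mem}
    (h : Shrinking (fun m => ∀ a, a < lo ∨ hi ≤ a → m a = m₀ a) inv p F)
    (hm : ∀ a, a < lo ∨ hi ≤ a → m a = m₀ a) (hK : hi - lo ≤ K) :
    p (TeamEnum.iter (fun _ => F) K m) := by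
  have hgood : ∀ K, ∀ a, a < lo ∨ hi ≤ a → TeamEnum.iter (fun _ => F) K m a = m₀ a := fun K =>
    (iter (k := K) (p := fun _ => p) fun i _ => h).keeps m hm
  let μ : Mem → ℕ := fun m => ((Finset.Ico lo hi).filter fun a => m a = true).card
  -- A round that changes something clears a bit of the region. So after `K` rounds either a fixed
  -- point has been reached or at least `K` bits are gone.
  have key : ∀ K, F (TeamEnum.iter (fun _ => F) K m) = TeamEnum.iter (fun _ => F) K m ∨
      μ (TeamEnum.iter (fun _ => F) K m) + K ≤ μ m := by
    intro K
    induction K with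
    | zero => exact .inr le_rfl
    | succ K ih =>
      by_cases hfix : F (TeamEnum.iter (fun _ => F) K m) = TeamEnum.iter (fun _ => F) K m
      · left
        simp only [TeamEnum.iter]
        rw [hfix, hfix]
      · right
        have ih := ih.resolve_left hfix
        obtain ⟨a, ha⟩ := Function.ne_iff.1 hfix
        have hle := h.le _ (hgood K)
        have ha₁ : TeamEnum.iter (fun _ => F) K m a = true := by
          by_contra h'
          refine ha ?_
          rw [Bool.not_eq_true] at h'
          rw [h', ← Bool.not_eq_true]
          exact fun h'' => by simp [hle a h''] at h'
        have hmem : a ∈ Finset.Ico lo hi := by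
          rw [Finset.mem_Ico]
          by_contra h'
          have h' : a < lo ∨ hi ≤ a := by omega
          exact ha (by rw [h.keeps _ (hgood K) a h', hgood K a h'])
        have : μ (F (TeamEnum.iter (fun _ => F) K m)) < μ (TeamEnum.iter (fun _ => F) K m) := by
          refine Finset.card_lt_card (Finset.ssubset_iff_of_subset (fun b hb => ?_) |>.2
            ⟨a, Finset.mem_filter.2 ⟨hmem, ha₁⟩, fun hb => ha ?_⟩)
          · rw [Finset.mem_filter] at hb ⊢
            exact ⟨hb.1, hle b hb.2⟩
          · rw [(Finset.mem_filter.1 hb).2, ha₁]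
        simp only [TeamEnum.iter]
        omega
  refine h.fixed _ (hgood K) ?_
  rcases key K with h' | h'
  · exact h'
  -- In the other case every bit of the region has been cleared, and a map that only clears bits
  -- fixes such a memory.
  · have hle : μ m ≤ hi - lo := (Finset.card_filter_le _ _).trans (by simp)
    have h0 : μ (TeamEnum.iter (fun _ => F) K m) = 0 := by omega
    rw [Finset.card_eq_zero, Finset.filter_eq_empty_iff] at h0
    funext a
    by_cases hmem : a ∈ Finset.Ico lo hi
    · have h1 := h0 hmem
      rw [Bool.not_eq_true] at h1
      rw [h1, ← Bool.not_eq_true]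
      exact fun h'' => by simp [h.le _ (hgood K) a h''] at h1
    · have h' : a < lo ∨ hi ≤ a := by rw [Finset.mem_Ico] at hmem; omega
      rw [h.keeps _ (hgood K) a h', hgood K a h']

end Shrinking

/-! ### Deleting violating assignments in rounds -/

/-- Do nothing. -/
def Cmd.skip : Cmd := .loop 0 (.const 0) (.store (.const 0) (.const 0))

/-- Run the programs of a list one after the other. -/
def Cmd.seqL : List Cmd → Cmd
  | [] => .skip
  | C :: l => .seq C (seqL l)

theorem Shrinking.seqL {good : Mem → Prop} {inv : Set (Mem → Prop)} {ρ : Env} {p : Cmd → Mem → Prop}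
    {l : List Cmd} (h : ∀ C ∈ l, Shrinking good inv (p C) (C.run ρ)) :
    Shrinking good inv (fun m => ∀ C ∈ l, p C m) ((Cmd.seqL l).run ρ) := by
  induction l with
  | nil => exact Shrinking.id.mono fun m _ => by simp
  | cons C l ih =>
    refine ((h C (by simp)).comp (ih fun D hD => h D (by simp [hD]))).mono fun m hm => ?_
    simpa using hm

instance (e : Exp) (ρ : Env) (m : Mem) : Decidable (e.Tr ρ m) :=
  inferInstanceAs (Decidable (_ ≠ _))

open Exp

/-- Delete the assignment with code `7` from a team if it violates a condition. -/
def cellCmd (g : ℕ × Exp) : Cmd := .store (wA g.1 (.var 7)) (andE (wE g.1 (.var 7)) g.2)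

def roundCmd {σ : Vocabulary} (k : ℕ) (φ : Formula σ) : Cmd :=
  .loop 7 (.var 3) (.seqL ((condExps k φ 0).map cellCmd))

section Round

variable {σ : Vocabulary} {n k L N : ℕ} {ρ : Env} {m m₀ : Mem} {φ : Formula σ}

/-- The memory has changed only in the part that stores a family of `z` teams. -/
def Outside (n k L N z : ℕ) (m₀ m : Mem) : Prop :=
  ∀ a, a < wAddr L N ((n + 1) ^ k) 0 0 ∨ wAddr L N ((n + 1) ^ k) z 0 ≤ a → m a = m₀ a

theorem wAddr_region {S o s z : ℕ} (ho : o < z) (hs : s < S) :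
    wAddr L N S 0 0 ≤ wAddr L N S o s ∧ wAddr L N S o s < wAddr L N S z 0 := by
  have : o * S + S ≤ z * S := by rw [← Nat.succ_mul]; exact Nat.mul_le_mul_right _ ho
  simp only [wAddr]
  omega

theorem wAddr_inj {S o s o' s' : ℕ} (hs : s < S) (hs' : s' < S)
    (h : wAddr L N S o s = wAddr L N S o' s') : o = o' ∧ s = s' := by
  have h : s + S * o = s' + S * o' := by
    simp only [wAddr] at h
    rw [mul_comm S, mul_comm S]
    omega
  have hd := congrArg (· / S) h
  have hm := congrArg (· % S) h
  simp only [Nat.add_mul_mod_self_left, Nat.mod_eq_of_lt hs, Nat.mod_eq_of_lt hs'] at hm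
  simp only [Nat.add_mul_div_left _ _ (Nat.zero_lt_of_lt hs), Nat.div_eq_of_lt hs,
    Nat.div_eq_of_lt hs', zero_add] at hd
  exact ⟨hd, hm⟩

theorem cellCmd_run (h : Dims n k L N ρ) (g : ℕ × Exp) : (cellCmd g).run ρ m =
    Function.update m (wAddr L N ((n + 1) ^ k) g.1 (ρ 7))
      (decide (m (wAddr L N ((n + 1) ^ k) g.1 (ρ 7)) = true ∧ g.2.Tr ρ m)) := by
  have e : (wA g.1 (.var 7)).eval ρ m = wAddr L N ((n + 1) ^ k) g.1 (ρ 7) := by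
    simp [wAddr, h.len, h.codes, h.values]
  rw [cellCmd, Cmd.run, e]
  congr 1
  refine decide_eq_decide.2 ?_
  have := tr_andE (wE g.1 (.var 7)) g.2 ρ m
  rw [tr_get, e] at this
  exact this

/-- The cell is overwritten by its old value conjoined with the condition, so it can only be
cleared, and if it is set and stays set the condition holds. Preservation of `inv` is left as a
hypothesis, since it depends on what the condition means. -/
theorem cellCmd_shrinking (h : Dims n k L N ρ) {g : ℕ × Exp} {z : ℕ} {inv : Set (Mem → Prop)}
    (hg : g.1 < z) (hs : ρ 7 < (n + 1) ^ k)
    (hinv : ∀ m, Outside n k L N z m₀ m → ∀ P ∈ inv, P m → P ((cellCmd g).run ρ m)) :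
    Shrinking (Outside n k L N z m₀) inv
      (fun m => m (wAddr L N ((n + 1) ^ k) g.1 (ρ 7)) = true → g.2.Tr ρ m) ((cellCmd g).run ρ) := by
  obtain ⟨h₁, h₂⟩ := wAddr_region (L := L) (N := N) hg hs
  refine ⟨fun m hm a ha => ?_, fun m hm a ha => ?_, hinv, fun m hm e hw => ?_⟩
  · rw [cellCmd_run h, Function.update_of_ne (by omega)]
    exact hm a ha
  · rw [cellCmd_run h, Function.update_apply] at ha
    split_ifs at ha with he
    · rw [he]; exact (of_decide_eq_true ha).1
    · exact ha
  · rw [cellCmd_run h] at e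
    have := congrFun e (wAddr L N ((n + 1) ^ k) g.1 (ρ 7))
    rw [Function.update_self, hw] at this
    exact (of_decide_eq_true this).2

theorem roundCmd_shrinking (h : Dims n k L N ρ) {z : ℕ} {inv : Set (Mem → Prop)}
    (hz : ∀ g ∈ condExps k φ 0, g.1 < z)
    (hinv : ∀ g ∈ condExps k φ 0, ∀ s < (n + 1) ^ k, ∀ m, Outside n k L N z m₀ m →
      ∀ P ∈ inv, P m → P ((cellCmd g).run (Function.update ρ 7 s) m)) :
    Shrinking (Outside n k L N z m₀) inv
      (fun m => ∀ s < (n + 1) ^ k, ∀ g ∈ condExps k φ 0,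
        m (wAddr L N ((n + 1) ^ k) g.1 s) = true → g.2.Tr (Function.update ρ 7 s) m)
      ((roundCmd k φ).run ρ) := by
  have e : (roundCmd k φ).run ρ = iter (fun i => (Cmd.seqL ((condExps k φ 0).map cellCmd)).run
      (Function.update ρ 7 i)) ((n + 1) ^ k) := by
    funext m
    rw [roundCmd, Cmd.run, eval_var, h.codes]
  rw [e]
  refine Shrinking.iter fun s hs => ?_
  -- The property attached to a program is taken to be "it changes nothing"; its meaning for the
  -- cell is extracted afterwards, when the pair `g` behind the program is known.
  refine (Shrinking.seqL (p := fun C m => C.run (Function.update ρ 7 s) m = m) ?_).mono ?_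
  · intro C hC
    obtain ⟨g, hg, rfl⟩ := List.mem_map.1 hC
    have := cellCmd_shrinking (m₀ := m₀) (inv := inv) (h.update (x := 7) (i := s) (by omega))
      (hz g hg) (by simpa using hs) (hinv g hg s hs)
    exact ⟨this.keeps, this.le, this.keeps_inv, fun m _ e => e⟩
  · intro m hm g hg hw
    have e := hm _ (List.mem_map_of_mem hg)
    rw [cellCmd_run (h.update (x := 7) (i := s) (by omega)), Function.update_self] at e
    have := congrFun e (wAddr L N ((n + 1) ^ k) g.1 s)
    rw [Function.update_self, hw] at this
    exact (of_decide_eq_true this).2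

theorem List.Forall₂.exists_left {α β : Type*} {R : α → β → Prop} {l : List α} {l' : List β}
    (h : List.Forall₂ R l l') : ∀ b ∈ l', ∃ a ∈ l, R a b := by
  induction h with
  | nil => simp
  | cons h _ ih =>
    simp only [List.mem_cons, forall_eq_or_imp]
    exact ⟨⟨_, .inl rfl, h⟩, fun b hb => (ih b hb).imp fun a ha => ⟨.inr ha.1, ha.2⟩⟩

theorem List.Forall₂.exists_right {α β : Type*} {R : α → β → Prop} {l : List α} {l' : List β}
    (h : List.Forall₂ R l l') : ∀ a ∈ l, ∃ b ∈ l', R a b := by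
  induction h with
  | nil => simp
  | cons h _ ih =>
    simp only [List.mem_cons, forall_eq_or_imp]
    exact ⟨⟨_, .inl rfl, h⟩, fun b hb => (ih b hb).imp fun a ha => ⟨.inr ha.1, ha.2⟩⟩

/-- Node numbers do not depend on the structure, so the bound can be read off from `conds_local`
over the empty universe. -/
theorem condExps_node_lt (hk : φ.bound ≤ k) : ∀ g ∈ condExps k φ 0, g.1 < φ.size := by
  intro g hg
  obtain ⟨f, hf, h, -⟩ := List.Forall₂.exists_left
    (condExps_spec (n := 0) (L := 0) (N := 0) (I := fun _ => ∅) φ 0 hk) g hg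
  have := (conds_local _ φ 0 f hf).1.2
  omega

/-- The stored family has `φ.size * S` bits, and every round before stabilisation clears one, so
this many rounds suffice. Variable `7` merely counts here; `roundCmd` reuses it. -/
def roundsCmd (k : ℕ) (φ : Formula σ) : Cmd :=
  .loop 7 (.const φ.size * .var 3) (roundCmd k φ)

theorem roundsCmd_run (h : Dims n k L N ρ) : (roundsCmd k φ).run ρ m =
    iter (fun _ => (roundCmd k φ).run ρ) (φ.size * (n + 1) ^ k) m := by
  rw [roundsCmd, Cmd.run, eval_mul, eval_const, eval_var, h.codes]
  congr 1
  funext i m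
  simp [roundCmd, Cmd.run, Function.update_idem]

end Round

end TeamEnum

/-! ### Deciding whether prescribed bits extend to a solution -/

namespace TeamEnum

/-- Programs that do not write. -/
def Cmd.Silent : Cmd → Prop
  | .store _ _ => True
  | .loop _ _ C => C.Silent
  | .seq C D => C.Silent ∧ D.Silent
  | .bind _ _ C => C.Silent
  | .write _ => False

theorem Cmd.Silent.emit {C : Cmd} (h : C.Silent) : ∀ ρ m, C.emit ρ m = [] := by
  induction C with
  | store a e => exact fun _ _ => rfl
  | loop x e C ih => exact fun ρ m => List.flatMap_eq_nil_iff.2 fun i _ => ih h _ _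
  | seq C D ih₁ ih₂ => exact fun ρ m => by rw [Cmd.emit, ih₁ h.1, ih₂ h.2, List.append_nil]
  | bind x e C ih => exact fun ρ m => ih h _ _
  | write e => exact h.elim

theorem Cmd.silent_seqL {l : List Cmd} (h : ∀ C ∈ l, C.Silent) : (Cmd.seqL l).Silent := by
  induction l with
  | nil => exact True.intro
  | cons C l ih => exact ⟨h C (by simp), ih fun D hD => h D (by simp [hD])⟩

/-- The assignment with domain `D` and code `c`. -/
def asg (n : ℕ) (D : Finset ℕ) (c : Fin (n ^ D.card)) : Assignment (Fin n) :=
  assignmentOf D (finFunctionFinEquiv.symm c)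

theorem assignmentOf_injective {A : Type} {D : Finset ℕ} :
    Function.Injective (assignmentOf (A := A) D) := by
  intro a b h
  funext i
  have := congrFun h (D.orderIsoOfFin rfl i)
  rwa [assignmentOf, assignmentOf, dif_pos (Subtype.prop _), dif_pos (Subtype.prop _),
    Subtype.coe_eta, OrderIso.symm_apply_apply, Option.some_inj] at this

theorem asg_injective {n : ℕ} {D : Finset ℕ} : Function.Injective (asg n D) := fun c c' h => by
  simpa using assignmentOf_injective h

theorem asg_below {n k : ℕ} {D : Finset ℕ} (hD : ∀ v ∈ D, v < k) (c : Fin (n ^ D.card)) :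
    (asg n D c).Below k := fun v hv => dif_neg fun h => by have := hD v h; omega

theorem assignmentOf_ne_none {A : Type} {D : Finset ℕ} (a : Fin D.card → A) (v : ℕ) :
    assignmentOf D a v ≠ none ↔ v ∈ D := by
  unfold assignmentOf
  split_ifs with h <;> simp [h]

theorem exists_asg_eq {n : ℕ} {D : Finset ℕ} {s : Assignment (Fin n)}
    (hs : ∀ v, s v ≠ none ↔ v ∈ D) : ∃ c, asg n D c = s := by
  have hsome : ∀ i : Fin D.card, ∃ a, s (D.orderIsoOfFin rfl i) = some a := fun i =>
    Option.ne_none_iff_exists'.1 ((hs _).2 (D.orderIsoOfFin rfl i).2)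
  choose a ha using hsome
  refine ⟨finFunctionFinEquiv a, ?_⟩
  funext v
  rw [asg, Equiv.symm_apply_apply, assignmentOf]
  split_ifs with h
  · rw [← ha, OrderIso.apply_symm_apply]
  · exact (not_not.1 fun h' => h ((hs v).1 h')).symm

open Exp

/-- The assignment with code `7` among all partial assignments is the assignment with code `9` among
those with domain `D`. -/
def asgE (D : Finset ℕ) (k : ℕ) : Exp :=
  allL ((List.range k).map fun v => if h : v ∈ D then
    eqE (digE v (.var 7)) (modE (.var 9 / powE (.var 2) ((D.orderIsoOfFin rfl).symm ⟨v, h⟩)) (.var 2)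
      + .const 1)
    else notE (digE v (.var 7)))

/-- Links the two numberings in use: base `n` for assignments with domain `D`, as in the output
words, and base `n + 1` for partial assignments, as in the stored teams. -/
theorem tr_asgE {n k L N : ℕ} {ρ : Env} {m : Mem} {D : Finset ℕ} (h : Dims n k L N ρ)
    (hD : ∀ v ∈ D, v < k) {c : Fin (n ^ D.card)} (hc : ρ 9 = c) :
    (asgE D k).Tr ρ m ↔ dec n k (ρ 7) = asg n D c := by
  rw [dec_ext (asg_below hD c), asgE, tr_allL, List.forall_mem_map]
  simp only [List.mem_range]
  refine forall₂_congr fun v hv => ?_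
  rw [asg, assignmentOf]
  split_ifs with hvD
  · rw [dec_eq_some hv, tr_eqE, eval_digE, finFunctionFinEquiv_symm_apply_val]
    simp [h.size, hc]
  · rw [dec_eq_none hv, tr_notE, Exp.Tr, eval_digE, h.size, not_not, eval_var]

/-- The assignment with code `9` may be in a candidate for the next solution. -/
def passE : Exp :=
  andE (impE (ltE (.var 9) (.var 6)) (.get (vA (.var 9))))
    (impE (ltE (.var 9) (.var 5)) (.get (uA (.var 9))))

/-- The assignment with code `9` must be in a candidate for the next solution. -/
def reqE : Exp :=
  orE (eqE (.var 9) (.var 6)) (orE (andE (ltE (.var 9) (.var 6)) (.get (vA (.var 9))))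
    (andE (ltE (.var 9) (.var 5)) (.get (uA (.var 9)))))

section

variable {σ : Vocabulary} {n k L N : ℕ} {ρ : Env} {m m' m₀ : Mem} {φ : Formula σ}

theorem tr_passE (h : Dims n k L N ρ) : passE.Tr ρ m ↔
    (ρ 9 < ρ 6 → m (L + L + 1 + ρ 9) = true) ∧ (ρ 9 < ρ 5 → m (L + L + 1 + N + ρ 9) = true) := by
  simp [passE, h.len, h.values]

theorem tr_reqE (h : Dims n k L N ρ) : reqE.Tr ρ m ↔ ρ 9 = ρ 6 ∨
    (ρ 9 < ρ 6 ∧ m (L + L + 1 + ρ 9) = true) ∨ (ρ 9 < ρ 5 ∧ m (L + L + 1 + N + ρ 9) = true) := by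
  simp [reqE, h.len, h.values]

/-- The largest candidates for the teams. -/
def startCmd (k : ℕ) (φ : Formula σ) : Cmd :=
  .seq (.loop 7 (.var 3) (.store (wA 0 (.var 7))
      (exE 9 (.var 4) (andE (asgE φ.free k) passE))))
    (.loop 10 (.const (φ.size - 1) * .var 3) (.store (wA 1 (.var 10)) (.const 1)))

theorem tr_start (h : Dims n k L (n ^ φ.free.card) ρ) (hk : φ.bound ≤ k) :
    (exE 9 (.var 4) (andE (asgE φ.free k) passE)).Tr ρ m ↔ ∃ c : Fin (n ^ φ.free.card),
      dec n k (ρ 7) = asg n φ.free c ∧ ((c : ℕ) < ρ 6 → m (L + L + 1 + c) = true) ∧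
        ((c : ℕ) < ρ 5 → m (L + L + 1 + n ^ φ.free.card + c) = true) := by
  have hD : ∀ v ∈ φ.free, v < k := fun v hv => (Formula.lt_bound_of_mem_free hv).trans_le hk
  simp only [tr_exE, eval_var, h.values, tr_andE]
  constructor
  · rintro ⟨c, hc, h₁, h₂⟩
    have hu := h.update (x := 9) (i := c) (by omega)
    rw [tr_asgE hu hD (c := ⟨c, hc⟩) (by simp)] at h₁
    rw [tr_passE hu] at h₂
    exact ⟨⟨c, hc⟩, by simpa using h₁, by simpa using h₂⟩
  · rintro ⟨c, h₁, h₂⟩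
    have hu := h.update (x := 9) (i := (c : ℕ)) (by omega)
    refine ⟨c, c.2, ?_, ?_⟩
    · rw [tr_asgE hu hD (c := c) (by simp)]
      simpa using h₁
    · rw [tr_passE hu]
      simpa using h₂

/-- Only team `0` is restricted, to the domain `φ.free` and the allowed codes; the other teams start
full and are tied to it by the local conditions alone. The teams lie above `V` and `U`, so filling
team `0` does not disturb the bits it is computed from. -/
theorem startCmd_spec (h : Dims n k L (n ^ φ.free.card) ρ) (hk : φ.bound ≤ k) :
    Outside n k L (n ^ φ.free.card) φ.size m ((startCmd k φ).run ρ m) ∧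
      (∀ a, a ∈ teams n k L (n ^ φ.free.card) ((startCmd k φ).run ρ m) 0 ↔
        ∃ c : Fin (n ^ φ.free.card), a = asg n φ.free c ∧
          ((c : ℕ) < ρ 6 → m (L + L + 1 + c) = true) ∧
            ((c : ℕ) < ρ 5 → m (L + L + 1 + n ^ φ.free.card + c) = true)) ∧
      ∀ j, 0 < j → j < φ.size → ∀ a : Assignment (Fin n), a.Below k →
        a ∈ teams n k L (n ^ φ.free.card) ((startCmd k φ).run ρ m) j := by
  set N := n ^ φ.free.card with hN
  set S := (n + 1) ^ k with hS
  set C₁ : Cmd := .loop 7 (.var 3) (.store (wA 0 (.var 7))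
      (exE 9 (.var 4) (andE (asgE φ.free k) passE))) with hC₁
  set C₂ : Cmd := .loop 10 (.const (φ.size - 1) * .var 3) (.store (wA 1 (.var 10)) (.const 1))
    with hC₂
  have e : (startCmd k φ).run ρ m = C₂.run ρ (C₁.run ρ m) := rfl
  have e₁ : C₁.run ρ m = iter (fun s m => Function.update m (wAddr L N S 0 s)
      (decide ((exE 9 (.var 4) (andE (asgE φ.free k) passE)).Tr (Function.update ρ 7 s) m))) S m := by
    rw [hC₁, Cmd.run, eval_var, h.codes]
    congr 1
    funext s m
    simp only [Cmd.run, wAddr, h.len, h.codes, h.values, Exp.Tr, eval_add, eval_mul, eval_var,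
      eval_const, Function.update_self, ne_eq, Function.update_of_ne, not_false_eq_true,
      Nat.reduceEqDiff, OfNat.one_ne_ofNat]
    rfl
  have e₂ : ∀ m, C₂.run ρ m = iter (fun s m => Function.update m (wAddr L N S 1 s) true)
      ((φ.size - 1) * S) m := by
    intro m
    rw [hC₂, Cmd.run, eval_mul, eval_const, eval_var, h.codes]
    congr 1
    funext s m
    simp [Cmd.run, wAddr, h.len, h.codes, h.values, ← hS]
  have hpos := φ.size_pos
  have hsz : φ.size * S = (φ.size - 1) * S + S := by
    rw [← Nat.succ_mul]; congr 1; omega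
  obtain ⟨h₁, h₂⟩ := iter_store (b := wAddr L N S 0 0) (k := S) (A := fun s => wAddr L N S 0 s)
    (f := fun s m => decide ((exE 9 (.var 4) (andE (asgE φ.free k) passE)).Tr
      (Function.update ρ 7 s) m))
    (g := fun s => decide ((exE 9 (.var 4) (andE (asgE φ.free k) passE)).Tr
      (Function.update ρ 7 s) m)) (m₀ := m)
    (fun s _ => by simp only [wAddr]; omega) (fun s _ t _ => by simp only [wAddr]; omega) (by
      intro s hs m' hm'
      refine decide_eq_decide.2 ?_
      have hu := h.update (x := 7) (i := s) (by omega)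
      rw [tr_start hu hk, tr_start hu hk]
      refine exists_congr fun c => ?_
      have hc := c.2
      simp only [wAddr] at hm'
      rw [hm' _ (by omega), hm' _ (by omega)])
  obtain ⟨h₃, h₄⟩ := iter_store (b := wAddr L N S 1 0) (k := (φ.size - 1) * S)
    (A := fun s => wAddr L N S 1 s) (f := fun _ _ => true) (g := fun _ => true) (m₀ := C₁.run ρ m)
    (fun s _ => by simp only [wAddr]; omega) (fun s _ t _ => by simp only [wAddr]; omega)
    fun _ _ _ _ => rfl
  rw [← e₂, ← e] at h₃ h₄
  rw [← e₁] at h₁ h₂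
  refine ⟨fun a ha => ?_, fun a => ?_, fun j hj hj' a ha => ?_⟩
  · simp only [wAddr, ← hN, ← hS] at ha h₂ h₄
    rw [h₄ a fun i hi => by omega, h₂ a fun i hi => by omega]
  · have : ∀ s < S, ((startCmd k φ).run ρ m (wAddr L N S 0 s) = true ↔
        ∃ c : Fin (n ^ φ.free.card), dec n k s = asg n φ.free c ∧
          ((c : ℕ) < ρ 6 → m (L + L + 1 + c) = true) ∧
            ((c : ℕ) < ρ 5 → m (L + L + 1 + n ^ φ.free.card + c) = true)) := by
      intro s hs
      rw [h₄ _ fun i _ => by simp only [wAddr]; omega, h₁ s hs, decide_eq_true_eq,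
        tr_start (h.update (by omega)) hk]
      simp
    constructor
    · rintro ⟨s, hs, hm, rfl⟩
      exact (this s hs).1 hm
    · rintro ⟨c, rfl, hc⟩
      obtain ⟨s, hs, e⟩ := exists_dec_eq (asg_below (n := n) (k := k) (D := φ.free)
        (fun v hv => (Formula.lt_bound_of_mem_free hv).trans_le hk) c)
      exact ⟨s, hs, (this s hs).2 ⟨c, e, hc⟩, e⟩
  · obtain ⟨s, hs, rfl⟩ := exists_dec_eq ha
    refine ⟨s, hs, ?_, rfl⟩
    -- Teams `1, …, φ.size - 1` are stored consecutively, so a single loop starting at team `1`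
    -- fills them all.
    have : wAddr L N ((n + 1) ^ k) j s = wAddr L N S 1 ((j - 1) * S + s) := by
      have : j * S = (j - 1) * S + S := by rw [← Nat.succ_mul]; congr 1; omega
      simp only [wAddr, ← hS]
      omega
    rw [this]
    refine h₃ _ ?_
    have : (j - 1) * S + S ≤ (φ.size - 1) * S := by
      rw [← Nat.succ_mul]; exact Nat.mul_le_mul_right _ (by omega)
    omega

theorem roundsCmd_outside (hk : φ.bound ≤ k) (h : Dims n k L N ρ) :
    Outside n k L N φ.size m ((roundsCmd k φ).run ρ m) := by
  rw [roundsCmd_run h]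
  exact (Shrinking.iter fun i _ => roundCmd_shrinking (inv := ∅) h (condExps_node_lt hk)
    (by simp)).keeps m fun _ _ => rfl

/-- The rounds compute the largest family of subteams that satisfies the local conditions. -/
theorem roundsCmd_spec {I : Interp σ (Fin n)} (hk : φ.bound ≤ k) (h : Describes I k L N ρ m) :
    (∀ j, teams n k L N ((roundsCmd k φ).run ρ m) j ⊆ teams n k L N m j) ∧
      Con I φ 0 (teams n k L N ((roundsCmd k φ).run ρ m)) ∧
      ∀ W, Con I φ 0 W → (∀ j, W j ⊆ teams n k L N m j) →
        ∀ j, W j ⊆ teams n k L N ((roundsCmd k φ).run ρ m) j := by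
  have hd : ∀ s m', Outside n k L N φ.size m m' → Describes I k L N (Function.update ρ 7 s) m' :=
    fun s m' hm' => h.congr (h.toDims.update (by omega)) fun a ha => hm' _ (.inl (by
      simp only [wAddr]; omega))
  have hsh := roundCmd_shrinking (φ := φ) (m₀ := m) (z := φ.size) (k := k) h.toDims
    (condExps_node_lt hk)
    -- The invariant "contains `W`", for every admissible `W`: a member of `W` satisfies its
    -- condition with respect to `W`, hence by monotonicity with respect to any larger family, and
    -- is not deleted.
    (inv := {P | ∃ W, Con I φ 0 W ∧ P = fun m => ∀ j, W j ⊆ teams n k L N m j}) (by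
      rintro g hg s hs m' hm' _ ⟨W, hW, rfl⟩ hle j _ ha
      obtain ⟨f, hf, hfg, hspec⟩ := List.Forall₂.exists_left
        (condExps_spec (n := n) (L := L) (N := N) (I := I) φ 0 hk) g hg
      obtain ⟨t, ht, hb, rfl⟩ := hle j ha
      refine ⟨t, ht, ?_, rfl⟩
      rw [cellCmd_run (h.toDims.update (by omega)), Function.update_self, Function.update_apply]
      split_ifs with he
      · obtain ⟨rfl, rfl⟩ := wAddr_inj ht hs he
        rw [decide_eq_true_eq]
        refine ⟨hb, (hspec _ m' (hd _ _ hm') (by simpa using hs)).2 ?_⟩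
        rw [Function.update_self]
        exact conds_mono I φ hle 0 f hf _ (hW f hf _ (by rwa [hfg]))
      · exact hb)
  rw [roundsCmd_run h.toDims]
  have hit := Shrinking.iter (k := φ.size * (n + 1) ^ k) fun i _ => hsh
  have hfix := hsh.iterate_fixed (m := m) (K := φ.size * (n + 1) ^ k) (fun _ _ => rfl) (by
    simp only [wAddr]; omega)
  have hout := hit.keeps m fun _ _ => rfl
  refine ⟨?_, ?_, ?_⟩
  · rintro j _ ⟨t, ht, hb, rfl⟩
    exact ⟨t, ht, hit.le m (fun _ _ => rfl) _ hb, rfl⟩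
  · intro f hf _ ha
    obtain ⟨g, hg, hfg, hspec⟩ := List.Forall₂.exists_right
      (condExps_spec (n := n) (L := L) (N := N) (I := I) φ 0 hk) f hf
    obtain ⟨s, hs, hb, rfl⟩ := ha
    have := (hspec _ _ (hd s _ hout) (by simpa using hs)).1 (hfix s hs g hg (by rwa [← hfg]))
    rwa [Function.update_self] at this
  · intro W hW hle
    exact hit.keeps_inv m (fun _ _ => rfl) _ ⟨W, hW, rfl⟩ hle

/-- The team that consists of the assignments with codes in `y`. -/
def teamOf {D : Finset ℕ} (y : Fin (n ^ D.card) → Bool) : Set (Assignment (Fin n)) :=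
  {a | ∃ c, y c = true ∧ asg n D c = a}

/-- The nonempty teams that satisfy `φ`, as characteristic functions. -/
def solutions (I : Interp σ (Fin n)) (φ : Formula σ) : Set (Fin (n ^ φ.free.card) → Bool) :=
  {y | (∃ c, y c = true) ∧ Sat I φ (teamOf y)}

/-- Among the teams of allowed assignments there is a largest one that satisfies `φ`, so some such
team contains the required assignments iff the largest one does. A prescribed bit `1` makes an
assignment required, a prescribed `0` makes it forbidden. The required code `i` also guarantees that
the team is nonempty. -/
theorem exists_solution_iff {I : Interp σ (Fin n)} (hk : φ.bound ≤ k)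
    (h : Describes I k L (n ^ φ.free.card) ρ m) {i : Fin (n ^ φ.free.card)} (hi : ρ 6 = i) :
    (∀ c : Fin (n ^ φ.free.card), c = i ∨ (c < i ∧ m (L + L + 1 + c) = true) ∨
        ((c : ℕ) < ρ 5 ∧ m (L + L + 1 + n ^ φ.free.card + c) = true) →
      asg n φ.free c ∈ teams n k L (n ^ φ.free.card)
        ((roundsCmd k φ).run ρ ((startCmd k φ).run ρ m)) 0) ↔
    ∃ y ∈ solutions I φ, y i = true ∧ (∀ c < i, y c = m (L + L + 1 + c)) ∧
      ∀ c : Fin _, (c : ℕ) < ρ 5 → y c = m (L + L + 1 + n ^ φ.free.card + c) := by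
  obtain ⟨hout, hst₀, hst⟩ := startCmd_spec h.toDims hk (m := m)
  have hd : Describes I k L (n ^ φ.free.card) ρ ((startCmd k φ).run ρ m) :=
    h.congr h.toDims fun a ha => hout _ (.inl (by simp only [wAddr]; omega))
  obtain ⟨hsub, hcon, hmax⟩ := roundsCmd_spec hk hd
  have hbelow := fun c => asg_below (n := n) (D := φ.free) (k := k)
    (fun v hv => (Formula.lt_bound_of_mem_free hv).trans_le hk) c
  constructor
  · intro hreq
    set T := teams n k L (n ^ φ.free.card) ((roundsCmd k φ).run ρ ((startCmd k φ).run ρ m)) 0 with hT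
    classical
    have hpass : ∀ c, asg n φ.free c ∈ T → (c < i → m (L + L + 1 + c) = true) ∧
        ((c : ℕ) < ρ 5 → m (L + L + 1 + n ^ φ.free.card + c) = true) := by
      intro c hc
      obtain ⟨c', e, hc'⟩ := (hst₀ _).1 (hsub 0 hc)
      rw [← asg_injective e, hi] at hc'
      exact hc'
    have hteam : teamOf (fun c => decide (asg n φ.free c ∈ T)) = T := by
      ext a
      simp only [teamOf, decide_eq_true_eq, Set.mem_ofPred_eq]
      constructor
      · rintro ⟨c, hc, rfl⟩
        exact hc
      · intro ha
        obtain ⟨c, rfl, -⟩ := (hst₀ _).1 (hsub 0 ha)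
        exact ⟨c, ha, rfl⟩
    refine ⟨fun c => decide (asg n φ.free c ∈ T), ⟨⟨i, decide_eq_true (hreq i (.inl rfl))⟩, ?_⟩,
      decide_eq_true (hreq i (.inl rfl)), fun c hc => ?_, fun c hc => ?_⟩
    · rw [hteam]
      exact hcon.sat
    · rw [Bool.eq_iff_iff, decide_eq_true_eq]
      exact ⟨fun hcT => (hpass c hcT).1 hc, fun hb => hreq c (.inr (.inl ⟨hc, hb⟩))⟩
    · rw [Bool.eq_iff_iff, decide_eq_true_eq]
      exact ⟨fun hcT => (hpass c hcT).2 hc, fun hb => hreq c (.inr (.inr ⟨hc, hb⟩))⟩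
  · rintro ⟨y, ⟨-, hy⟩, hyi, hv, hu⟩ c hc
    have hyc : y c = true := by
      rcases hc with rfl | ⟨hc, hb⟩ | ⟨hc, hb⟩
      · exact hyi
      · rw [hv c hc, hb]
      · rw [hu c hc, hb]
    obtain ⟨W, hW₀, hWb, hW⟩ := exists_con_of_sat (k := k) (o := 0) hk (by
      rintro _ ⟨c, -, rfl⟩
      exact hbelow c) hy
    -- Maximality is stated for all indices, but beyond `φ.size` the contents of the memory are
    -- unknown; by locality the teams there may be emptied.
    have hW' : Con I φ 0 fun j => if j < φ.size then W j else ∅ :=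
      hW.congr fun j _ hj => (if_pos (by omega)).symm
    refine hmax _ hW' (fun j => ?_) 0 ?_
    · split_ifs with hj
      · rcases Nat.eq_zero_or_pos j with rfl | hj₀
        · rw [hW₀]
          rintro _ ⟨c, hc, rfl⟩
          refine (hst₀ _).2 ⟨c, rfl, fun hci => ?_, fun hcj => ?_⟩
          · rw [← hv c (by rw [Fin.lt_def]; omega), hc]
          · rw [← hu c hcj, hc]
        · exact fun a ha => hst j hj₀ hj a (hWb j a ha)
      · exact Set.empty_subset _
    · rw [if_pos φ.size_pos, hW₀]
      exact ⟨c, hyc, rfl⟩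

/-- The input has the length and the prefix of the encoding of a structure of size `n`. -/
def validE (σ : Vocabulary) : Exp :=
  andE (ltE (.var 2) (.var 1)) (andE (allE 9 (.var 2) (xE (.var 9))) (andE (notE (xE (.var 2)))
    (eqE (.var 1) (.var 2 + .const 1 + relOffsetE σ σ.numRel))))

/-- The bits for the relations are arbitrary, so prefix and length are all that has to be checked.
-/
def Valid (σ : Vocabulary) (L n : ℕ) (X : ℕ → Bool) : Prop :=
  n < L ∧ (∀ i < n, X i = true) ∧ X n = false ∧ L = n + 1 + relOffset σ n σ.numRel

theorem tr_validE (h : Dims n k L N ρ) :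
    (validE σ).Tr ρ m ↔ Valid σ L n fun i => m (L + i) := by
  simp [validE, Valid, h.len, h.size, eval_relOffsetE]

/-- Raise the flag if there is a solution that exceeds `V` at index `6`, and agrees with `V` below
index `6` and with `U` below index `5`. -/
def candidateCmd (k : ℕ) (φ : Formula σ) : Cmd :=
  .seq (startCmd k φ) (.seq (roundsCmd k φ) (.store flagA (orE (.get flagA) (andE (validE σ)
    (andE (notE (.get (vA (.var 6)))) (allE 9 (.var 4) (impE reqE
      (exE 7 (.var 3) (andE (wE 0 (.var 7)) (asgE φ.free k))))))))))

/-- Raise the flag if there is a solution that exceeds `V` and agrees with `U` below index `5`. -/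
def searchCmd (k : ℕ) (φ : Formula σ) : Cmd :=
  .seq (.store flagA (.const 0)) (.loop 6 (.var 4) (candidateCmd k φ))

/-- `Y` is the set of solutions for the input in the memory. -/
def IsSolutionSet (k L : ℕ) (φ : Formula σ) (ρ : Env) (m : Mem)
    (Y : Set (Fin (n ^ φ.free.card) → Bool)) : Prop :=
  ((Valid σ L n fun i => m (L + i)) → ∃ I : Interp σ (Fin n),
    Describes I k L (n ^ φ.free.card) ρ m ∧ Y = solutions I φ) ∧
  ((¬ Valid σ L n fun i => m (L + i)) → Y = ∅)

/-- Two memories agree on the input and on `V` and `U`. -/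
def Agree (L N : ℕ) (m m' : Mem) : Prop :=
  ∀ a < L + L + 1 + N + N, a ≠ L + L → m' a = m a

theorem Agree.input (h : Agree L N m m') {i : ℕ} (hi : i < L) : m' (L + i) = m (L + i) :=
  h _ (by omega) (by omega)

theorem valid_congr {X X' : ℕ → Bool} (h : ∀ i < L, X' i = X i) :
    Valid σ L n X' ↔ Valid σ L n X := by
  unfold Valid
  refine and_congr_right fun hn => ?_
  rw [h n hn]
  refine and_congr_left fun _ => forall₂_congr fun i hi => ?_
  rw [h i (hi.trans hn)]

theorem IsSolutionSet.congr {Y : Set (Fin (n ^ φ.free.card) → Bool)} {ρ' : Env}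
    (hY : IsSolutionSet k L φ ρ m Y) (h : ∀ i < L, m' (L + i) = m (L + i))
    (hρ : Dims n k L (n ^ φ.free.card) ρ') : IsSolutionSet k L φ ρ' m' Y := by
  refine ⟨fun hv => ?_, fun hv => hY.2 (by rwa [valid_congr h] at hv)⟩
  obtain ⟨I, hI, rfl⟩ := hY.1 ((valid_congr h).1 hv)
  exact ⟨I, hI.congr hρ h, rfl⟩

/-- The teams are written above `U`, so the flag is the only lower bit from the input copy on that
can change. The check of validity guards the answer, because on other inputs the computed fixed
point has no meaning. -/
theorem candidateCmd_spec {Y : Set (Fin (n ^ φ.free.card) → Bool)} (hk : φ.bound ≤ k)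
    (h : Dims n k L (n ^ φ.free.card) ρ) (hY : IsSolutionSet k L φ ρ m Y)
    {i : Fin (n ^ φ.free.card)} (hi : ρ 6 = i) :
    Agree L (n ^ φ.free.card) m ((candidateCmd k φ).run ρ m) ∧
      ((candidateCmd k φ).run ρ m (L + L) = true ↔ m (L + L) = true ∨ ∃ y ∈ Y,
        m (L + L + 1 + i) = false ∧ y i = true ∧ (∀ c < i, y c = m (L + L + 1 + c)) ∧
        ∀ c : Fin _, (c : ℕ) < ρ 5 → y c = m (L + L + 1 + n ^ φ.free.card + c)) := by
  set m₂ := (roundsCmd k φ).run ρ ((startCmd k φ).run ρ m) with hm₂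
  have hout : ∀ a < L + L + 1 + n ^ φ.free.card + n ^ φ.free.card, m₂ a = m a := fun a ha => by
    rw [hm₂, roundsCmd_outside hk h a (.inl (by simp only [wAddr]; omega)),
      (startCmd_spec h hk).1 a (.inl (by simp only [wAddr]; omega))]
  have hrun : (candidateCmd k φ).run ρ m = Function.update m₂ (L + L) (decide ((orE (.get flagA)
      (andE (validE σ) (andE (notE (.get (vA (.var 6)))) (allE 9 (.var 4) (impE reqE
      (exE 7 (.var 3) (andE (wE 0 (.var 7)) (asgE φ.free k)))))))).Tr ρ m₂)) := by
    simp only [candidateCmd, Cmd.run, ← hm₂, eval_add, eval_var, h.len, Exp.Tr]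
    rfl
  have hagree : Agree L (n ^ φ.free.card) m m₂ := fun a ha _ => hout a ha
  refine ⟨fun a ha ha' => by rw [hrun, Function.update_of_ne ha', hout a ha], ?_⟩
  have hcov : (allE 9 (.var 4) (impE reqE (exE 7 (.var 3) (andE (wE 0 (.var 7))
      (asgE φ.free k))))).Tr ρ m₂ ↔ ∀ c : Fin (n ^ φ.free.card), c = i ∨
        (c < i ∧ m (L + L + 1 + c) = true) ∨
        ((c : ℕ) < ρ 5 ∧ m (L + L + 1 + n ^ φ.free.card + c) = true) →
      asg n φ.free c ∈ teams n k L (n ^ φ.free.card) m₂ 0 := by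
    rw [tr_allE, eval_var, h.values, Fin.forall_iff]
    refine forall₂_congr fun c hc => ?_
    have hu := h.update (x := 9) (i := c) (by omega)
    rw [tr_impE, tr_reqE hu, Function.update_self, Function.update_of_ne (by omega),
      Function.update_of_ne (by omega), hi, Fin.ext_iff, Fin.lt_def, hout _ (by omega),
      hout _ (by omega), tr_exE, eval_var, hu.codes]
    refine imp_congr_right fun _ => ?_
    have : ∀ s < (n + 1) ^ k, (andE (wE 0 (.var 7)) (asgE φ.free k)).Tr
        (Function.update (Function.update ρ 9 c) 7 s) m₂ ↔
        m₂ (wAddr L (n ^ φ.free.card) ((n + 1) ^ k) 0 s) = true ∧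
          dec n k s = asg n φ.free ⟨c, hc⟩ := by
      intro s hs
      have hu' := hu.update (x := 7) (i := s) (by omega)
      rw [tr_andE, tr_asgE hu' (fun v hv => (Formula.lt_bound_of_mem_free hv).trans_le hk)
        (c := ⟨c, hc⟩) (by simp), tr_get]
      simp [wAddr, h.len, h.values]
    exact exists_congr fun s => and_congr_right fun hs => this s hs
  rw [hrun, Function.update_self, decide_eq_true_eq, tr_orE, tr_andE, tr_andE, tr_notE, tr_validE h,
    hcov, valid_congr fun i => hagree.input, tr_get, tr_get]
  simp only [eval_add, eval_var, eval_const, h.len, hi]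
  rw [hout _ (by omega), hout _ (by omega), Bool.not_eq_true]
  refine or_congr_right ?_
  by_cases hv : Valid σ L n fun i => m (L + i)
  · obtain ⟨I, hI, rfl⟩ := hY.1 hv
    rw [exists_solution_iff hk hI hi]
    constructor
    · rintro ⟨-, h₁, y, hy, h₂⟩
      exact ⟨y, hy, h₁, h₂⟩
    · rintro ⟨y, hy, h₁, h₂⟩
      exact ⟨hv, h₁, y, hy, h₂⟩
  · rw [hY.2 hv]
    simp [hv]

/-- Each pass leaves the input, `V` and `U` intact, so the flag accumulates the disjunction over all
indices at which a solution may first exceed `V`. -/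
theorem searchCmd_spec {Y : Set (Fin (n ^ φ.free.card) → Bool)} (hk : φ.bound ≤ k)
    (h : Dims n k L (n ^ φ.free.card) ρ) (hY : IsSolutionSet k L φ ρ m Y) :
    Agree L (n ^ φ.free.card) m ((searchCmd k φ).run ρ m) ∧
      ((searchCmd k φ).run ρ m (L + L) = true ↔ ∃ y ∈ Y, ∃ i : Fin (n ^ φ.free.card),
        m (L + L + 1 + i) = false ∧ y i = true ∧ (∀ c < i, y c = m (L + L + 1 + c)) ∧
        ∀ c : Fin _, (c : ℕ) < ρ 5 → y c = m (L + L + 1 + n ^ φ.free.card + c)) := by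
  have hrun : (searchCmd k φ).run ρ m = iter (fun i => (candidateCmd k φ).run
      (Function.update ρ 6 i)) (n ^ φ.free.card) (Function.update m (L + L) false) := by
    simp [searchCmd, Cmd.run, h.len, h.values]
  have key := iter_induction (k := n ^ φ.free.card)
    (f := fun i => (candidateCmd k φ).run (Function.update ρ 6 i))
    (m := Function.update m (L + L) false)
    (fun j m' => Agree L (n ^ φ.free.card) m m' ∧ (m' (L + L) = true ↔
      ∃ y ∈ Y, ∃ i : Fin (n ^ φ.free.card), (i : ℕ) < j ∧
        m (L + L + 1 + i) = false ∧ y i = true ∧ (∀ c < i, y c = m (L + L + 1 + c)) ∧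
        ∀ c : Fin _, (c : ℕ) < ρ 5 → y c = m (L + L + 1 + n ^ φ.free.card + c)))
    ⟨fun a _ ha => Function.update_of_ne ha _ _, by simp⟩ (by
      rintro j hj m' ⟨hag, hfl⟩
      have hu := h.update (x := 6) (i := j) (by omega)
      obtain ⟨h₁, h₂⟩ := candidateCmd_spec hk hu (hY.congr (fun i => hag.input) hu) (i := ⟨j, hj⟩) (by simp)
      refine ⟨fun a ha ha' => by rw [h₁ a ha ha', hag a ha ha'], ?_⟩
      rw [h₂, hfl, Function.update_of_ne (by omega)]
      have e₁ : ∀ c : Fin (n ^ φ.free.card), m' (L + L + 1 + c) = m (L + L + 1 + c) := fun c =>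
        hag _ (by omega) (by omega)
      have e₂ : ∀ c : Fin (n ^ φ.free.card), m' (L + L + 1 + n ^ φ.free.card + c) =
          m (L + L + 1 + n ^ φ.free.card + c) := fun c => hag _ (by omega) (by omega)
      simp only [e₂, e₁, show m' (L + L + 1 + j) = m (L + L + 1 + j) from e₁ ⟨j, hj⟩]
      constructor
      · rintro (⟨y, hy, i, hi, h⟩ | ⟨y, hy, h⟩)
        · exact ⟨y, hy, i, by omega, h⟩
        · exact ⟨y, hy, ⟨j, hj⟩, Nat.lt_succ_self j, h⟩
      · rintro ⟨y, hy, i, hi, h⟩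
        rcases Nat.lt_succ_iff_lt_or_eq.1 hi with hi | hi
        · exact .inl ⟨y, hy, i, hi, h⟩
        · obtain rfl : i = ⟨j, hj⟩ := Fin.ext hi
          exact .inr ⟨y, hy, h⟩)
  rw [hrun]
  refine ⟨key.1, key.2.trans ?_⟩
  simp

theorem searchCmd_silent : (searchCmd k φ).Silent := by
  refine ⟨trivial, ⟨trivial, trivial⟩, Cmd.silent_seqL fun C hC => ?_, trivial⟩
  obtain ⟨g, -, rfl⟩ := List.mem_map.1 hC
  trivial

end

end TeamEnum

namespace TeamEnum

/-! ### Words that encode structures -/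

section

variable {σ : Vocabulary} {n : ℕ}

theorem relOffset_succ (i : Fin σ.numRel) :
    relOffset σ n (i + 1) = relOffset σ n i + n ^ σ.arity i := by
  rw [relOffset, List.take_add_one, List.getElem?_eq_getElem (by simp)]
  simp [relOffset]

theorem relOffset_mono {i j : ℕ} (h : i ≤ j) : relOffset σ n i ≤ relOffset σ n j :=
  ((List.take_sublist_take_left (l := List.finRange σ.numRel) h).map _).sum_le_sum
    fun _ _ => Nat.zero_le _

theorem sum_mul_pow_lt {a : ℕ} (f : Fin a → Fin n) : ∑ l, (f l : ℕ) * n ^ (l : ℕ) < n ^ a := by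
  rw [← finFunctionFinEquiv_apply]
  exact (finFunctionFinEquiv f).2

/-- The blocks of the relations follow one another without gaps; induction on the number of blocks
finds the one that contains `p`. -/
theorem exists_relPos_eq {p : ℕ} (hp : n < p) : ∀ {j : ℕ}, j ≤ σ.numRel →
    p < n + 1 + relOffset σ n j → ∃ i a, relPos σ n i a = p := by
  intro j
  induction j with
  | zero => simp [relOffset]; omega
  | succ j ih =>
    intro hj hpj
    rcases Nat.lt_or_ge p (n + 1 + relOffset σ n j) with h | h
    · exact ih (by omega) h
    · rw [relOffset_succ ⟨j, hj⟩] at hpj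
      dsimp only at hpj
      refine ⟨⟨j, hj⟩, finFunctionFinEquiv.symm ⟨p - (n + 1 + relOffset σ n j), by omega⟩, ?_⟩
      rw [relPos, ← finFunctionFinEquiv_apply, Equiv.apply_symm_apply]
      dsimp only
      omega

theorem relPos_lt (i : Fin σ.numRel) (a : Fin (σ.arity i) → Fin n) :
    relPos σ n i a < n + 1 + relOffset σ n σ.numRel := by
  have h₁ := sum_mul_pow_lt a
  have h₂ := relOffset_mono (σ := σ) (n := n) (show (i : ℕ) + 1 ≤ σ.numRel from i.2)
  rw [relOffset_succ] at h₂
  rw [relPos]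
  omega

theorem length_flatMap_encodeRel (I : Interp σ (Fin n)) (i : ℕ) :
    (((List.finRange σ.numRel).take i).flatMap fun i => encodeRel (I i)).length =
      relOffset σ n i := by
  simp [List.length_flatMap, relOffset, encodeRel]

theorem FinStructure.length_encode (I : Interp σ (Fin n)) :
    (FinStructure.mk n I).encode.length = n + 1 + relOffset σ n σ.numRel := by
  have := length_flatMap_encodeRel I σ.numRel
  rw [List.take_of_length_le (by simp)] at this
  rw [encode, List.length_append, List.length_replicate, List.length_cons, this]
  dsimp only
  omega

theorem FinStructure.encode_relPos (I : Interp σ (Fin n)) (i : Fin σ.numRel)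
    (a : Fin (σ.arity i) → Fin n) :
    (FinStructure.mk n I).encode.getD (relPos σ n i a) false = true ↔ a ∈ I i := by
  have hsplit : (List.finRange σ.numRel).flatMap (fun i => encodeRel (I i)) =
      (((List.finRange σ.numRel).take i).flatMap fun i => encodeRel (I i)) ++
        (encodeRel (I i) ++ ((List.finRange σ.numRel).drop (i + 1)).flatMap fun i =>
          encodeRel (I i)) := by
    conv_lhs => rw [← List.take_append_drop i (List.finRange σ.numRel)]
    rw [List.flatMap_append, List.drop_eq_getElem_cons (by simp),
      show (List.finRange σ.numRel)[(i : ℕ)]'(by simp) = i by simp, List.flatMap_cons]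
  have hlt := sum_mul_pow_lt a
  rw [encode, List.getD_append_right _ _ _ _ (by simp [relPos]; omega), List.length_replicate,
    show relPos σ n i a - n = relOffset σ n i + (∑ l, (a l : ℕ) * n ^ (l : ℕ)) + 1 by
      rw [relPos]; omega, List.getD_cons_succ, hsplit,
    List.getD_append_right _ _ _ _ (by rw [length_flatMap_encodeRel]; omega),
    length_flatMap_encodeRel, Nat.add_sub_cancel_left, List.getD_append _ _ _ _ (by
      simpa [encodeRel] using hlt), List.getD_eq_getElem _ _ (by simpa [encodeRel] using hlt)]
  simp only [encodeRel, List.getElem_ofFn, decide_eq_true_eq]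
  rw [show (⟨∑ l, (a l : ℕ) * n ^ (l : ℕ), hlt⟩ : Fin (n ^ σ.arity i)) = finFunctionFinEquiv a from
    Fin.ext (finFunctionFinEquiv_apply a).symm, Equiv.symm_apply_apply]

theorem FinStructure.valid_encode (I : Interp σ (Fin n)) :
    Valid σ (FinStructure.mk n I).encode.length n
      fun i => (FinStructure.mk n I).encode.getD i false := by
  refine ⟨by rw [length_encode]; omega, fun i hi => ?_, ?_, length_encode I⟩
  · dsimp only
    rw [encode, List.getD_append _ _ _ _ (by simpa using hi),
      List.getD_eq_getElem _ _ (by simpa using hi), List.getElem_replicate]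
  · dsimp only
    rw [encode, List.getD_append_right _ _ _ _ (by simp)]
    simp

theorem Valid.size_unique {L n' : ℕ} {X : ℕ → Bool} (h : Valid σ L n X) (h' : Valid σ L n' X) :
    n = n' := by
  obtain ⟨-, h₁, h₂, -⟩ := h
  obtain ⟨-, h₃, h₄, -⟩ := h'
  rcases lt_trichotomy n n' with hlt | heq | hlt
  · rw [h₃ n hlt] at h₂; cases h₂
  · exact heq
  · rw [h₁ n' hlt] at h₄; cases h₄

/-- The relations are defined by reading the bits. Every position lies in the prefix of ones, is the
separating `0`, or is of the form `relPos`, so the word is recovered completely. -/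
theorem Valid.exists_encode {x : List Bool} (h : Valid σ x.length n fun i => x.getD i false) :
    ∃ I : Interp σ (Fin n), x = (FinStructure.mk n I).encode := by
  let I : Interp σ (Fin n) := fun i => {a | x.getD (relPos σ n i a) false = true}
  refine ⟨I, ?_⟩
  have hlen : x.length = (FinStructure.mk n I).encode.length := by
    rw [FinStructure.length_encode]
    exact h.2.2.2
  obtain ⟨-, h₁, h₂, -⟩ := FinStructure.valid_encode I
  refine List.ext_getElem hlen fun p hp hp' => ?_
  rw [← List.getD_eq_getElem _ false, ← List.getD_eq_getElem _ false]
  rcases lt_trichotomy p n with hpn | rfl | hpn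
  · exact (h.2.1 p hpn).trans (h₁ p hpn).symm
  · exact h.2.2.1.trans h₂.symm
  · obtain ⟨i, a, rfl⟩ := exists_relPos_eq hpn le_rfl (by rw [← h.2.2.2]; exact hp)
    rw [Bool.eq_iff_iff, FinStructure.encode_relPos]
    rfl

theorem FinStructure.encode_inj {I J : Interp σ (Fin n)}
    (h : (FinStructure.mk n I).encode = (FinStructure.mk n J).encode) : I = J := by
  funext i
  ext a
  rw [← encode_relPos, h, encode_relPos]

open Classical in
theorem encodeTeam_eq {D : Finset ℕ} (X : Set (Assignment (Fin n))) :
    encodeTeam D X = List.ofFn fun c => decide (asg n D c ∈ X) := by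
  rw [encodeTeam, encodeRel]
  rfl

/-- The prefix determines the size and the bits determine the relations, so the structure in the
definition of `ESatTeam` is unique. Teams with domain `φ.free` correspond to characteristic
functions on codes. -/
theorem eSatTeam_encode (I : Interp σ (Fin n)) (φ : Formula σ) :
    ESatTeam φ (FinStructure.mk n I).encode = List.ofFn '' solutions I φ := by
  classical
  ext w
  constructor
  · rintro ⟨⟨n', J⟩, e, X, hX, ⟨s, hs⟩, hsat, rfl⟩
    obtain rfl : n = n' := by
      have h := FinStructure.valid_encode J
      rw [← e] at h
      exact (FinStructure.valid_encode I).size_unique h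
    obtain rfl := FinStructure.encode_inj e
    refine ⟨fun c => decide (asg n φ.free c ∈ X), ⟨?_, ?_⟩, (encodeTeam_eq X).symm⟩
    · obtain ⟨c, rfl⟩ := exists_asg_eq (hX s hs)
      exact ⟨c, decide_eq_true hs⟩
    · convert hsat using 1
      ext s
      simp only [teamOf, decide_eq_true_eq, Set.mem_ofPred_eq]
      constructor
      · rintro ⟨c, hc, rfl⟩
        exact hc
      · intro hs
        obtain ⟨c, rfl⟩ := exists_asg_eq (hX s hs)
        exact ⟨c, hs, rfl⟩
  · rintro ⟨y, ⟨⟨c, hc⟩, hsat⟩, rfl⟩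
    refine ⟨⟨n, I⟩, rfl, teamOf y, ?_, ⟨_, c, hc, rfl⟩, hsat, ?_⟩
    · rintro _ ⟨c, -, rfl⟩ v
      exact assignmentOf_ne_none _ v
    · rw [encodeTeam_eq]
      congr 1
      funext c
      rw [Bool.eq_iff_iff, decide_eq_true_eq]
      constructor
      · exact fun h => ⟨c, h, rfl⟩
      · rintro ⟨c', h, e⟩
        rwa [← asg_injective e]

/-! ### Recovering the universe size from the input -/

open Exp

/-- The number of leading ones of the input. -/
def sizeE : Exp := .sum 9 (.var 1) (allE 10 (.var 9 + .const 1) (xE (.var 10)))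

/-- The summand for `i` is `1` when the bits `0, …, i` are all ones and `0` otherwise; the
separating `0` at position `n` stops the count. -/
theorem eval_sizeE {L : ℕ} {ρ : Env} {m : Mem} (hL : ρ 1 = L)
    (h : Valid σ L n fun i => m (L + i)) : sizeE.eval ρ m = n := by
  have key : ∀ i < L, (allE 10 (.var 9 + .const 1) (xE (.var 10))).eval (Function.update ρ 9 i) m =
      if i < n then 1 else 0 := by
    intro i hi
    have hle : (allE 10 (.var 9 + .const 1) (xE (.var 10))).eval (Function.update ρ 9 i) m ≤ 1 := by
      rw [allE, notE, eval_sub]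
      exact Nat.sub_le _ _
    have htr : (allE 10 (.var 9 + .const 1) (xE (.var 10))).Tr (Function.update ρ 9 i) m ↔ i < n := by
      simp only [tr_allE, eval_add, eval_var, eval_const, Function.update_self, tr_get]
      constructor
      · intro h'
        by_contra hin
        have := h' n (by omega)
        rw [Function.update_of_ne (by omega), Function.update_of_ne (by omega), hL] at this
        exact Bool.false_ne_true (h.2.2.1.symm.trans this)
      · intro hin j hj
        rw [Function.update_of_ne (by omega), Function.update_of_ne (by omega), hL]
        exact h.2.1 j (by omega)
    rw [Exp.Tr] at htr
    split_ifs with hin <;> omega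
  have hn := h.1
  rw [sizeE, Exp.eval, eval_var, hL, Finset.sum_congr rfl fun i hi => key i (Finset.mem_range.1 hi),
    ← Finset.card_filter, show (Finset.range L).filter (· < n) = Finset.range n by
      ext i; simp only [Finset.mem_filter, Finset.mem_range]; omega, Finset.card_range]

/-- The solutions for an input, as characteristic functions. -/
theorem exists_isSolutionSet (φ : Formula σ) (k : ℕ) (x : List Bool)
    (hn : ∀ n', Valid σ x.length n' (fun i => x.getD i false) → n' = n) :
    ∃ Y : Set (Fin (n ^ φ.free.card) → Bool), ESatTeam φ x = List.ofFn '' Y ∧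
      (∀ y ∈ Y, ∃ c, y c = true) ∧ ∀ ρ m, Dims n k x.length (n ^ φ.free.card) ρ →
        (∀ i < x.length, m (x.length + i) = x.getD i false) → IsSolutionSet k x.length φ ρ m Y := by
  by_cases h : Valid σ x.length n fun i => x.getD i false
  · obtain ⟨I, rfl⟩ := h.exists_encode
    refine ⟨solutions I φ, eSatTeam_encode I φ, fun y hy => hy.1, fun ρ m hρ hm =>
      ⟨fun _ => ⟨I, ⟨hρ, fun i a => ?_, fun i a => ?_⟩, rfl⟩, fun h' => absurd ((valid_congr hm).2 h) h'⟩⟩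
    · rw [FinStructure.length_encode]
      exact relPos_lt i a
    · rw [hm _ (by rw [FinStructure.length_encode]; exact relPos_lt i a),
        FinStructure.encode_relPos]
  · refine ⟨∅, ?_, fun y hy => hy.elim, fun ρ m _ hm => ⟨fun h' => absurd ((valid_congr hm).1 h') h,
      fun _ => rfl⟩⟩
    rw [Set.image_empty, Set.eq_empty_iff_forall_notMem]
    rintro w ⟨⟨n', I⟩, rfl, -⟩
    have h' := FinStructure.valid_encode I
    exact h (hn n' h' ▸ h')

end

end TeamEnum

namespace TeamEnum

open Exp

/-! ### Enumerating the solutions in lexicographic order -/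

/-- Run a program with the variables `2`, `3`, `4` set up. -/
def withDims (k d : ℕ) (C : Cmd) : Cmd :=
  .bind 2 sizeE (.bind 3 (powE (.var 2 + .const 1) k) (.bind 4 (powE (.var 2) d) C))

/-- The values of the variables in `withDims`. -/
def dimsEnv (k d : ℕ) (ρ : Env) (n : ℕ) : Env :=
  Function.update (Function.update (Function.update ρ 2 n) 3 ((n + 1) ^ k)) 4 (n ^ d)

theorem withDims_run {k d : ℕ} {C : Cmd} {ρ : Env} {m : Mem} :
    (withDims k d C).run ρ m = C.run (dimsEnv k d ρ (sizeE.eval ρ m)) m := by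
  simp [withDims, Cmd.run, dimsEnv]

theorem withDims_emit {k d : ℕ} {C : Cmd} {ρ : Env} {m : Mem} :
    (withDims k d C).emit ρ m = C.emit (dimsEnv k d ρ (sizeE.eval ρ m)) m := by
  simp [withDims, Cmd.emit, dimsEnv]

theorem dims_dimsEnv {k d n L : ℕ} {ρ : Env} (h : ρ 1 = L) :
    Dims n k L (n ^ d) (dimsEnv k d ρ n) := by
  constructor <;> simp [dimsEnv, h]

section

variable {σ : Vocabulary} {n k L : ℕ} {ρ : Env} {m m' : Mem} {φ : Formula σ}

/-- Compute in `U` the next solution after `V`. -/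
def nextCmd (k : ℕ) (φ : Formula σ) : Cmd :=
  .loop 11 (.var 4) (.seq (.store (uA (.var 11)) (.const 0))
    (.seq (.bind 5 (.var 11 + .const 1) (searchCmd k φ))
      (.store (uA (.var 11)) (notE (.get flagA)))))

def writeCmd : Cmd := .loop 9 (.var 4) (.write (.get (uA (.var 9))))

def copyCmd : Cmd := .loop 9 (.var 4) (.store (vA (.var 9)) (.get (uA (.var 9))))

/-- The first index at which `y` differs from `v` carries `0` in `v` and `1` in `y` exactly when `y`
is larger, so the search over all such indices is the lexicographic comparison. -/
theorem searchCmd_lex {Y : Set (Fin (n ^ φ.free.card) → Bool)} (hk : φ.bound ≤ k)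
    (h : Dims n k L (n ^ φ.free.card) ρ) (hY : IsSolutionSet k L φ ρ m Y)
    {v : Fin (n ^ φ.free.card) → Bool} (hv : ∀ c : Fin _, m (L + L + 1 + c) = v c) :
    (searchCmd k φ).run ρ m (L + L) = true ↔ ∃ y ∈ Y, toLex v < toLex y ∧
        ∀ c : Fin _, (c : ℕ) < ρ 5 → y c = m (L + L + 1 + n ^ φ.free.card + c) := by
  rw [(searchCmd_spec hk h hY).2]
  simp only [hv]
  refine exists_congr fun y => and_congr_right fun _ => ?_
  constructor
  · rintro ⟨i, h₁, h₂, h₃, h₄⟩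
    exact ⟨⟨i, fun c hc => (h₃ c hc).symm, by change v i < y i; rw [h₁, h₂]; decide⟩, h₄⟩
  · rintro ⟨⟨i, h₁, h₂⟩, h₄⟩
    change v i < y i at h₂
    have := Bool.lt_iff.1 h₂
    exact ⟨i, this.1, this.2, fun c hc => (h₁ c hc).symm, h₄⟩

/-- Bit `p` is tentatively set to `0` and becomes `1` only if no solution above `v` has the
resulting prefix of length `p + 1`. Taking `0` whenever possible yields the least solution. -/
theorem nextCmd_spec {Y : Set (Fin (n ^ φ.free.card) → Bool)} (hk : φ.bound ≤ k)
    (h : Dims n k L (n ^ φ.free.card) ρ) (hY : IsSolutionSet k L φ ρ m Y)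
    {v y : Fin (n ^ φ.free.card) → Bool} (hv : ∀ c : Fin _, m (L + L + 1 + c) = v c)
    (hyY : y ∈ Y) (hvy : toLex v < toLex y)
    (hmin : ∀ y' ∈ Y, toLex v < toLex y' → toLex y ≤ toLex y') :
    (∀ a < L + L + 1 + n ^ φ.free.card, a ≠ L + L → (nextCmd k φ).run ρ m a = m a) ∧
      ∀ c : Fin _, (nextCmd k φ).run ρ m (L + L + 1 + n ^ φ.free.card + c) = y c := by
  have hrun : (nextCmd k φ).run ρ m = iter (fun p m => (Cmd.seq (.store (uA (.var 11)) (.const 0))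
    (.seq (.bind 5 (.var 11 + .const 1) (searchCmd k φ))
      (.store (uA (.var 11)) (notE (.get flagA))))).run (Function.update ρ 11 p) m) (n ^ φ.free.card) m := by
    rw [nextCmd, Cmd.run, eval_var, h.values]
  have key := iter_induction (k := n ^ φ.free.card) (m := m)
    (f := fun p m => (Cmd.seq (.store (uA (.var 11)) (.const 0))
    (.seq (.bind 5 (.var 11 + .const 1) (searchCmd k φ))
      (.store (uA (.var 11)) (notE (.get flagA))))).run (Function.update ρ 11 p) m)
    (fun p m' => (∀ a < L + L + 1 + n ^ φ.free.card, a ≠ L + L → m' a = m a) ∧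
      ∀ c : Fin (n ^ φ.free.card), (c : ℕ) < p → m' (L + L + 1 + n ^ φ.free.card + c) = y c)
    ⟨fun _ _ _ => rfl, fun c hc => absurd hc (Nat.not_lt_zero _)⟩ (by
      rintro p hp m' ⟨h₁, h₂⟩
      set m₁ := Function.update m' (L + L + 1 + n ^ φ.free.card + p) false with hm₁
      set ρ' := Function.update (Function.update ρ 11 p) 5 (p + 1) with hρ'
      have hd : Dims n k L (n ^ φ.free.card) ρ' := (h.update (by omega)).update (by omega)
      have e : (Cmd.seq (.store (uA (.var 11)) (.const 0))
          (.seq (.bind 5 (.var 11 + .const 1) (searchCmd k φ))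
          (.store (uA (.var 11)) (notE (.get flagA))))).run (Function.update ρ 11 p) m' =
          Function.update ((searchCmd k φ).run ρ' m₁) (L + L + 1 + n ^ φ.free.card + p)
            (!(searchCmd k φ).run ρ' m₁ (L + L)) := by
        simp only [Cmd.run, eval_add, eval_var, eval_const, Function.update_self, notE, eval_sub,
          eval_get, (h.update (x := 11) (i := p) (by omega)).len,
          (h.update (x := 11) (i := p) (by omega)).values, ne_eq, not_true_eq_false, decide_false,
          ← hm₁, ← hρ']
        congr 1
        cases (searchCmd k φ).run ρ' m₁ (L + L) <;> rfl
      have hm₁m : ∀ a < L + L + 1 + n ^ φ.free.card, a ≠ L + L → m₁ a = m a := fun a ha ha' => by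
        rw [hm₁, Function.update_of_ne (by omega), h₁ a ha ha']
      have hY' : IsSolutionSet k L φ ρ' m₁ Y :=
        hY.congr (fun i hi => hm₁m _ (by omega) (by omega)) hd
      have hag := (searchCmd_spec hk hd hY').1
      have hflag := searchCmd_lex hk hd hY' (v := v) fun c => by
        rw [hm₁m _ (by omega) (by omega), hv]
      have h₅ : ρ' 5 = p + 1 := by simp [hρ']
      have hu : ∀ c : Fin (n ^ φ.free.card), (c : ℕ) < p → m₁ (L + L + 1 + n ^ φ.free.card + c) = y c := fun c hc => by
        rw [hm₁, Function.update_of_ne (by omega), h₂ c hc]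
      have hu' : m₁ (L + L + 1 + n ^ φ.free.card + p) = false := by rw [hm₁, Function.update_self]
      rw [e]
      refine ⟨fun a ha ha' => ?_, fun c hc => ?_⟩
      · rw [Function.update_of_ne (by omega), hag a (by omega) ha', hm₁m a ha ha']
      · rcases Nat.lt_succ_iff_lt_or_eq.1 hc with hc | hc
        · rw [Function.update_of_ne (by omega), hag _ (by omega) (by omega), hu c hc]
        · obtain rfl : c = ⟨p, hp⟩ := Fin.ext hc
          rw [Function.update_self, Bool.not_eq_eq_eq_not, Bool.eq_iff_iff, hflag, h₅]
          cases hyp : y ⟨p, hp⟩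
          · simp only [Bool.not_false, iff_true]
            refine ⟨y, hyY, hvy, fun c hc => ?_⟩
            rcases Nat.lt_succ_iff_lt_or_eq.1 hc with hc | hc
            · exact (hu c hc).symm
            · obtain rfl : c = ⟨p, hp⟩ := Fin.ext hc
              rw [hyp]
              exact hu'.symm
          · simp only [Bool.not_true, Bool.false_eq_true, iff_false]
            rintro ⟨y', hy', hvy', hag'⟩
            -- A solution above `v` that agrees with `y` below `p` and has `0` at `p` would be
            -- smaller than `y`.
            refine absurd (hmin y' hy' hvy') (not_le.2 ⟨⟨p, hp⟩, fun c hc => ?_, ?_⟩)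
            · exact (hag' c (Nat.lt_succ_of_lt hc)).trans (hu c hc)
            · change y' ⟨p, hp⟩ < y ⟨p, hp⟩
              rw [hag' ⟨p, hp⟩ (Nat.lt_succ_self p), hyp]
              exact (congrArg (· < true) hu').mpr (by decide))
  rw [hrun]
  exact ⟨key.1, fun c => key.2 c c.2⟩

theorem iter_const {α : Type*} (k : ℕ) (m : α) : iter (fun _ m => m) k m = m := by
  induction k with
  | zero => rfl
  | succ k ih => exact ih

theorem writeCmd_emit {N : ℕ} (h : Dims n k L N ρ) {y : Fin N → Bool}
    (hy : ∀ c : Fin N, m (L + L + 1 + N + c) = y c) : writeCmd.emit ρ m = List.ofFn y := by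
  rw [writeCmd, Cmd.emit, eval_var, h.values]
  have e : ∀ i < N, (Cmd.write (.get (uA (.var 9)))).emit (Function.update ρ 9 i)
      (iter (fun i => (Cmd.write (.get (uA (.var 9)))).run (Function.update ρ 9 i)) i m) =
        [m (L + L + 1 + N + i)] := by
    intro i _
    rw [show (fun i => (Cmd.write (.get (uA (.var 9)))).run (Function.update ρ 9 i)) =
      fun _ m => m from rfl, iter_const]
    have hu := h.update (x := 9) (i := i) (by omega)
    simp only [Cmd.emit, eval_get, eval_add, eval_var, eval_const, hu.len, hu.values,
      Function.update_self]
    cases m (L + L + 1 + N + i) <;> rfl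
  rw [List.flatMap_congr fun i hi => e i (List.mem_range.1 hi), ← List.map_eq_flatMap]
  refine List.ext_getElem (by simp) fun i hi _ => ?_
  have hi : i < N := by simpa using hi
  simpa using hy ⟨i, hi⟩

/-- The copied word lies above the region that is overwritten, so reading is unaffected by the
earlier stores. -/
theorem copyCmd_spec {N : ℕ} (h : Dims n k L N ρ) :
    (∀ a < L + L + 1, copyCmd.run ρ m a = m a) ∧
      ∀ c < N, copyCmd.run ρ m (L + L + 1 + c) = m (L + L + 1 + N + c) := by
  have hrun : copyCmd.run ρ m = iter (fun i m => Function.update m (L + L + 1 + i)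
      (m (L + L + 1 + N + i))) N m := by
    rw [copyCmd, Cmd.run, eval_var, h.values]
    congr 1
    funext i m
    have hu := h.update (x := 9) (i := i) (by omega)
    simp only [Cmd.run, eval_get, eval_add, eval_var, eval_const, hu.len, hu.values,
      Function.update_self]
    congr 1
    cases m (L + L + 1 + N + i) <;> rfl
  have key := iter_induction (k := N) (m := m)
    (f := fun i m => Function.update m (L + L + 1 + i) (m (L + L + 1 + N + i)))
    (fun p m' => (∀ a, a < L + L + 1 ∨ L + L + 1 + N ≤ a → m' a = m a) ∧
      ∀ c < p, m' (L + L + 1 + c) = m (L + L + 1 + N + c))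
    ⟨fun _ _ => rfl, fun c hc => absurd hc (Nat.not_lt_zero _)⟩ (by
      rintro p hp m' ⟨h₁, h₂⟩
      refine ⟨fun a ha => by rw [Function.update_of_ne (by omega), h₁ a ha], fun c hc => ?_⟩
      rcases Nat.lt_succ_iff_lt_or_eq.1 hc with hc | rfl
      · rw [Function.update_of_ne (by omega), h₂ c hc]
      · rw [Function.update_self, h₁ _ (by omega)])
  rw [hrun]
  exact ⟨fun a ha => key.1 a (.inl ha), key.2⟩

/-- Look for a solution after `V`. -/
def testCmd (k : ℕ) (φ : Formula σ) : Cmd :=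
  withDims k φ.free.card (.bind 5 (.const 0) (searchCmd k φ))

/-- Write the next solution after `V`, and store it in `V`. -/
def stepCmd (k : ℕ) (φ : Formula σ) : Cmd :=
  withDims k φ.free.card (.seq (nextCmd k φ) (.seq writeCmd copyCmd))

theorem testCmd_silent : (testCmd k φ).Silent := searchCmd_silent (k := k) (φ := φ)

theorem nextCmd_silent : (nextCmd k φ).Silent := ⟨trivial, searchCmd_silent, trivial⟩

end

/-! ### Reading the input -/

/-- Copy the input to the addresses from its length on. -/
def readCmd (l : ℕ) : Cmd :=
  .seq (.loop 9 (.var 1) (.store (.var 1 + .var 9) (.get (.var 9 - .const l))))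
    (.seqL ((List.range l).map fun j =>
      .store (.var 1 + .const j) (modE (.var 0 / .const (2 ^ j)) (.const 2))))

theorem readCmd_silent (l : ℕ) : (readCmd l).Silent := by
  refine ⟨trivial, Cmd.silent_seqL fun C hC => ?_⟩
  obtain ⟨j, -, rfl⟩ := List.mem_map.1 hC
  trivial

theorem Cmd.vars_seqL_le {b : ℕ} {l : List Cmd} (hb : 1 ≤ b) (h : ∀ C ∈ l, C.vars ≤ b) :
    (Cmd.seqL l).vars ≤ b := by
  induction l with
  | nil => simpa [seqL, skip, vars, Exp.vars] using hb
  | cons C l ih => exact max_le (h C (by simp)) (ih fun D hD => h D (by simp [hD]))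

theorem Cmd.need_seqL_le {b : ℕ} {l : List Cmd} (hb : 6 ≤ b) (h : ∀ C ∈ l, C.need ≤ b) :
    (Cmd.seqL l).need ≤ b := by
  induction l with
  | nil => simpa [seqL, skip, need, Exp.need] using hb
  | cons C l ih => exact max_le (h C (by simp)) (ih fun D hD => h D (by simp [hD]))

/-- The bounds for `readCmd l` are uniform in `l`. This avoids a circle, since `l` is fixed only
after the registers of all programs, this one included, have been counted. -/
theorem readCmd_vars_le (l : ℕ) : (readCmd l).vars ≤ 12 := by
  refine max_le (Nat.le_of_ble_eq_true rfl) (Cmd.vars_seqL_le (by omega) fun C hC => ?_)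
  obtain ⟨j, -, rfl⟩ := List.mem_map.1 hC
  exact Nat.le_of_ble_eq_true rfl

theorem readCmd_need_le (l : ℕ) : (readCmd l).need ≤ 12 := by
  refine max_le (Nat.le_of_ble_eq_true rfl) (Cmd.need_seqL_le (by omega) fun C hC => ?_)
  obtain ⟨j, -, rfl⟩ := List.mem_map.1 hC
  exact Nat.le_of_ble_eq_true rfl

/-- Bits from index `l` on are copied from the memory; for `i < l` the difference `i - l` is `0` and
the copy is wrong, but it is overwritten by the binary digits of variable `0`. Reads stay below
`|x|` and stores start there. Since `i` is arbitrary, the area after the input is seen to be zero as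
well. -/
theorem readCmd_run {l : ℕ} {x : List Bool} {ρ : Env} (h₀ : ρ 0 = pack x l x.length)
    (h₁ : ρ 1 = x.length) (i : ℕ) :
    (readCmd l).run ρ (inputMem (l + 1) x) (x.length + i) = x.getD i false := by
  set C : Cmd := .loop 9 (.var 1) (.store (.var 1 + .var 9) (.get (.var 9 - .const l))) with hC
  have key : ∀ (l' : List ℕ) (m : Mem), (∀ j ∈ l', j < l) →
      (Cmd.seqL (l'.map fun j => .store (.var 1 + .const j)
        (modE (.var 0 / .const (2 ^ j)) (.const 2)))).run ρ m (x.length + i) =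
          if i ∈ l' then x.getD i false else m (x.length + i) := by
    intro l'
    induction l' with
    | nil => intro m _; simp [Cmd.seqL, Cmd.skip, Cmd.run, iter]
    | cons j l' ih =>
      intro m hl
      rw [List.map_cons, Cmd.seqL, Cmd.run, ih _ fun j hj => hl j (by simp [hj])]
      simp only [Cmd.run, eval_add, eval_var, eval_const, eval_modE, eval_div, h₀, h₁,
        pack_bit x (hl j (by simp))]
      by_cases hil : i ∈ l'
      · simp [hil]
      · rw [if_neg hil]
        by_cases hij : i = j
        · subst hij
          rw [Function.update_self, if_pos (by simp)]
          cases x.getD i false <;> rfl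
        · rw [Function.update_of_ne (by omega), if_neg (by simp [hij, hil])]
  rw [readCmd, Cmd.run, key _ _ fun j hj => List.mem_range.1 hj, ← hC]
  split_ifs with hi
  · rfl
  rw [List.mem_range] at hi
  have hrun : C.run ρ (inputMem (l + 1) x) = iter (fun i m => Function.update m (x.length + i)
      (m (i - l))) x.length (inputMem (l + 1) x) := by
    rw [hC, Cmd.run, eval_var, h₁]
    congr 1
    funext i m
    have h1 : Function.update ρ 9 i 1 = x.length := by rw [Function.update_of_ne (by omega), h₁]
    simp only [Cmd.run, eval_get, eval_add, eval_sub, eval_var, eval_const, h1,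
      Function.update_self]
    congr 1
    cases m (i - l) <;> rfl
  obtain ⟨h₂, h₃⟩ := iter_store (b := x.length) (k := x.length) (A := fun i => x.length + i)
    (f := fun i m => m (i - l)) (g := fun i => inputMem (l + 1) x (i - l))
    (m₀ := inputMem (l + 1) x) (fun i _ => by omega) (fun i _ j _ => by omega)
    fun i hi m hm => hm _ (by omega)
  rw [hrun]
  rcases Nat.lt_or_ge i x.length with hix | hix
  · rw [h₂ i hix, inputMem]
    congr 1
    omega
  · rw [h₃ _ fun j hj => by omega, inputMem, List.getD_eq_default _ _ (by omega),
      List.getD_eq_default _ _ hix]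

end TeamEnum

/-! ### The invariant of the enumeration and the final machine -/

namespace TeamEnum

open Exp

/-- The inner index is at most the outer one, so only the copy of the input is read. Hence the size
comes out the same in every pass of the main loop. -/
theorem eval_sizeE_congr {L : ℕ} {ρ : Env} {m m' : Mem} (hL : ρ 1 = L)
    (h : ∀ i < L, m' (L + i) = m (L + i)) : sizeE.eval ρ m' = sizeE.eval ρ m := by
  simp only [sizeE, eval_sum, eval_var, hL, allE, exE, notE, eval_sub, eval_const, eval_get, eval_add]
  refine Finset.sum_congr rfl fun i hi => ?_
  congr 1
  refine Finset.sum_congr rfl fun j hj => ?_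
  have hi := Finset.mem_range.1 hi
  have hj := Finset.mem_range.1 hj
  rw [Function.update_self] at hj
  simp only [Function.update_self, ne_eq, not_false_eq_true, Function.update_of_ne,
    OfNat.one_ne_ofNat, hL, h j (by omega)]

section

variable {σ : Vocabulary}

/-- The state of the enumeration: the solutions up to `V` have been output, and `r` solutions
remain. -/
def EnumState (x : List Bool) {N : ℕ} (Y : Set (Fin N → Bool)) (r : ℕ) (m : Mem)
    (out : List (List Bool)) : Prop :=
  (∀ i < x.length, m (x.length + i) = x.getD i false) ∧ ∃ v : Fin N → Bool,
    (∀ c : Fin N, m (x.length + x.length + 1 + c) = v c) ∧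
    r = {y ∈ Y | toLex v < toLex y}.ncard ∧ out.Nodup ∧
    {w | w ∈ out} = List.ofFn '' {y ∈ Y | toLex y ≤ toLex v}

theorem EnumState.congr {x : List Bool} {N r : ℕ} {Y : Set (Fin N → Bool)} {m m' : Mem}
    {out : List (List Bool)} (h : EnumState x Y r m out) (hm : Agree x.length N m m') :
    EnumState x Y r m' out := by
  obtain ⟨h₁, v, h₂, h₃⟩ := h
  exact ⟨fun i hi => (hm.input hi).trans (h₁ i hi), v,
    fun c => (hm _ (by omega) (by omega)).trans (h₂ c), h₃⟩

/-- Initially `V` is the zero word. It is the least word and stands for the empty team, so no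
solution lies at or below it. -/
theorem enumState_readCmd {x : List Bool} {N l : ℕ} {Y : Set (Fin N → Bool)} {ρ : Env}
    (hY : ∀ y ∈ Y, ∃ c, y c = true) (h₀ : ρ 0 = pack x l x.length) (h₁ : ρ 1 = x.length) :
    ∃ r, EnumState x Y r ((readCmd l).run ρ (inputMem (l + 1) x)) [] := by
  refine ⟨_, fun i _ => readCmd_run h₀ h₁ i, fun _ => false, fun c => ?_, rfl, List.nodup_nil, ?_⟩
  · rw [add_assoc, add_assoc, readCmd_run h₀ h₁, List.getD_eq_default _ _ (by omega)]
  · rw [eq_comm, Set.image_eq_empty.2]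
    · simp
    · refine Set.eq_empty_iff_forall_notMem.2 fun y ⟨hy, hle⟩ => ?_
      obtain ⟨c, hc⟩ := hY y hy
      have h : toLex y = toLex fun _ => false :=
        le_antisymm hle (Pi.toLex_monotone fun c => Bool.false_le _)
      rw [toLex_inj.1 h] at hc
      cases hc

/-- With variable `5` equal to `0` the word `U` imposes nothing, so the flag tells whether any
solution at all lies above `V`. -/
theorem testCmd_spec {φ : Formula σ} {x : List Bool} {n k : ℕ} {ρ : Env} {m : Mem}
    {Y : Set (Fin (n ^ φ.free.card) → Bool)} (hk : φ.bound ≤ k) (h₁ : ρ 1 = x.length)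
    (hn : sizeE.eval ρ m = n) (hY : ∀ ρ m, Dims n k x.length (n ^ φ.free.card) ρ →
        (∀ i < x.length, m (x.length + i) = x.getD i false) → IsSolutionSet k x.length φ ρ m Y)
    {r : ℕ} {out : List (List Bool)} (h : EnumState x Y r m out) :
    Agree x.length (n ^ φ.free.card) m ((testCmd k φ).run ρ m) ∧
      ((Exp.get flagA).eval ρ ((testCmd k φ).run ρ m) ≠ 0 ↔ r ≠ 0) := by
  obtain ⟨hx, v, hv, rfl, -⟩ := h
  have hd : Dims n k x.length (n ^ φ.free.card)
      (Function.update (dimsEnv k φ.free.card ρ n) 5 0) := (dims_dimsEnv h₁).update le_rfl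
  have e : (testCmd k φ).run ρ m =
      (searchCmd k φ).run (Function.update (dimsEnv k φ.free.card ρ n) 5 0) m := by
    rw [testCmd, withDims_run, hn]
    rfl
  have hY := hY _ m hd hx
  rw [e]
  refine ⟨(searchCmd_spec hk hd hY).1, ?_⟩
  rw [← Exp.Tr, tr_get, eval_add, eval_var, h₁, searchCmd_lex hk hd hY hv,
    ← Nat.pos_iff_ne_zero, Set.ncard_pos]
  simp [Set.Nonempty]

theorem stepCmd_spec {φ : Formula σ} {x : List Bool} {n k : ℕ} {ρ : Env} {m : Mem}
    {Y : Set (Fin (n ^ φ.free.card) → Bool)} (hk : φ.bound ≤ k) (h₁ : ρ 1 = x.length)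
    (hn : sizeE.eval ρ m = n) (hY : ∀ ρ m, Dims n k x.length (n ^ φ.free.card) ρ →
        (∀ i < x.length, m (x.length + i) = x.getD i false) → IsSolutionSet k x.length φ ρ m Y)
    {r : ℕ} {out : List (List Bool)} (h : EnumState x Y (r + 1) m out) :
    EnumState x Y r ((stepCmd k φ).run ρ m) (out ++ [(stepCmd k φ).emit ρ m]) := by
  obtain ⟨hx, v, hv, hr, hnodup, hout⟩ := h
  have hd : Dims n k x.length (n ^ φ.free.card) (dimsEnv k φ.free.card ρ n) := dims_dimsEnv h₁
  have hfin : {y ∈ Y | toLex v < toLex y}.Finite := Set.toFinite _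
  obtain ⟨y, ⟨hyY, hvy⟩, hmin⟩ := Set.exists_min_image _ toLex hfin
    ((Set.ncard_pos hfin).1 (by omega))
  have hmin : ∀ y' ∈ Y, toLex v < toLex y' → toLex y ≤ toLex y' := fun y' h h' => hmin y' ⟨h, h'⟩
  obtain ⟨hm, hu⟩ := nextCmd_spec hk hd (hY _ m hd hx) hv hyY hvy hmin
  obtain ⟨hc₁, hc₂⟩ := copyCmd_spec hd
    (m := (nextCmd k φ).run (dimsEnv k φ.free.card ρ n) m)
  have e : (stepCmd k φ).run ρ m = copyCmd.run (dimsEnv k φ.free.card ρ n)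
      ((nextCmd k φ).run (dimsEnv k φ.free.card ρ n) m) := by
    rw [stepCmd, withDims_run, hn, Cmd.run, Cmd.run, show ∀ m, writeCmd.run
      (dimsEnv k φ.free.card ρ n) m = m from fun m => iter_const _ m]
  have e' : (stepCmd k φ).emit ρ m = List.ofFn y := by
    rw [stepCmd, withDims_emit, hn, Cmd.emit, Cmd.emit, nextCmd_silent.emit,
      writeCmd_emit hd hu, Cmd.Silent.emit (C := copyCmd) trivial]
    simp
  rw [e, e']
  -- No solution lies strictly between `v` and `y`, so replacing `v` by `y` adds exactly one
  -- solution to those already output.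
  have hle : ∀ y' ∈ Y, toLex y' ≤ toLex y ↔ toLex y' ≤ toLex v ∨ y' = y := by
    intro y' hy'
    constructor
    · intro h
      rcases le_or_gt (toLex y') (toLex v) with h' | h'
      · exact .inl h'
      · exact .inr (toLex_inj.1 (h.antisymm (hmin y' hy' h')))
    · rintro (h | rfl)
      · exact h.trans hvy.le
      · exact le_rfl
  refine ⟨fun i hi => ?_, y, fun c => ?_, ?_, ?_, ?_⟩
  · rw [hc₁ _ (by omega), hm _ (by omega) (by omega), hx i hi]
  · rw [hc₂ _ c.2, hu]
  · have : {y' ∈ Y | toLex v < toLex y'} = insert y {y' ∈ Y | toLex y < toLex y'} := by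
      ext y'
      simp only [Set.mem_insert_iff, Set.mem_ofPred_eq]
      constructor
      · rintro ⟨h, h'⟩
        rcases (hmin y' h h').eq_or_lt with e | h''
        · exact .inl (toLex_inj.1 e).symm
        · exact .inr ⟨h, h''⟩
      · rintro (rfl | ⟨h, h'⟩)
        · exact ⟨hyY, hvy⟩
        · exact ⟨h, hvy.trans h'⟩
    rw [this, Set.ncard_insert_of_notMem (fun h => lt_irrefl _ h.2)] at hr
    omega
  · refine List.nodup_append.2 ⟨hnodup, List.nodup_singleton _, fun w hw w' hw' => ?_⟩
    rw [List.mem_singleton.1 hw']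
    rintro rfl
    obtain ⟨y', ⟨-, h⟩, e⟩ := hout.le hw
    rw [List.ofFn_injective e] at h
    exact absurd hvy (not_lt.2 h)
  · ext w
    simp only [Set.ext_iff, Set.mem_ofPred_eq, Set.mem_image] at hout
    simp only [List.mem_append, Set.mem_ofPred_eq, hout, List.mem_singleton, Set.mem_image]
    constructor
    · rintro (⟨y', ⟨h, h'⟩, rfl⟩ | rfl)
      · exact ⟨y', ⟨h, (hle y' h).2 (.inl h')⟩, rfl⟩
      · exact ⟨y, ⟨hyY, le_rfl⟩, rfl⟩
    · rintro ⟨y', ⟨h, h'⟩, rfl⟩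
      rcases (hle y' h).1 h' with h' | rfl
      · exact .inl ⟨y', ⟨h, h'⟩, rfl⟩
      · exact .inr rfl

theorem eSatTeam_mem_DelP (φ : Formula σ) : ESatTeam φ ∈ DelP := by
  set k := φ.bound with hk
  set nv := max 12 (max (testCmd k φ).vars (max (stepCmd k φ).vars (Exp.get flagA).vars)) with hnv
  -- Room for the variables and for the scratch registers of every program, `12` being the share of
  -- `readCmd`; the memory starts right above.
  set l := nv + 12 + (testCmd k φ).need + (stepCmd k φ).need + (Exp.get flagA).need with hl
  have hv := readCmd_vars_le l
  have hn := readCmd_need_le l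
  refine mem_DelP_of_loop (nv := nv) (M₀ := l + 1) (init := readCmd l) (test := testCmd k φ)
    (body := stepCmd k φ) (flag := .get flagA) (by omega) (by omega)
    ⟨by omega, by omega, by omega, by omega⟩ ⟨by omega, by omega, by omega, by omega⟩ ?_
  rw [Nat.add_sub_cancel]
  intro x ρ h₀ h₁
  set m₀ := (readCmd l).run ρ (inputMem (l + 1) x) with hm₀
  set n := sizeE.eval ρ m₀ with hndef
  have hx₀ : ∀ i < x.length, m₀ (x.length + i) = x.getD i false := fun i _ => readCmd_run h₀ h₁ i
  -- `sizeE` has a value `n` on every input. On an encoding it is the size of the universe; on other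
  -- words its value is irrelevant, because there are no solutions.
  obtain ⟨Y, hE, hpos, hY⟩ := exists_isSolutionSet (n := n) φ k x fun n' h' =>
    (eval_sizeE h₁ ((valid_congr hx₀).2 h')).symm
  have hsize : ∀ {r m out}, EnumState x Y r m out → sizeE.eval ρ m = n := fun h =>
    eval_sizeE_congr h₁ fun i hi => by rw [h.1 i hi, hx₀ i hi]
  refine ⟨EnumState x Y, (readCmd_silent l).emit _ _, enumState_readCmd hpos h₀ h₁,
    fun r m out h => ?_⟩
  obtain ⟨hag, hflag⟩ := testCmd_spec le_rfl h₁ (hsize h) hY h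
  refine ⟨testCmd_silent.emit _ _, ?_, ?_⟩
  · rintro rfl
    refine ⟨by simpa using hflag, ?_⟩
    obtain ⟨-, v, -, hr, hnodup, hout⟩ := h
    refine ⟨hnodup, hout.trans ?_⟩
    rw [hE]
    congr 1
    have := (Set.ncard_eq_zero (Set.toFinite _)).1 hr.symm
    ext y
    refine ⟨fun h => h.1, fun h => ⟨h, not_lt.1 fun h' => ?_⟩⟩
    exact this.le ⟨h, h'⟩
  · rintro r rfl
    have h' := h.congr hag
    exact ⟨hflag.2 (Nat.succ_ne_zero r), stepCmd_spec le_rfl h₁ (hsize h') hY h'⟩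

end

end TeamEnum

theorem mainTheorem2 (σ : TeamEnum.Vocabulary) (φ : TeamEnum.Formula σ) :
    TeamEnum.ESatTeam φ ∈ TeamEnum.DelP := by
  exact TeamEnum.eSatTeam_mem_DelP φ
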